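/- Let $\mathbb{R}^5_1$ be $\mathbb{R}^5$ with $\langle x,y\rangle=\sum_{i=1}^4x^iy^i-x^5y^5$ and $\mathbb{H}^4=\{x:\langle x,x\rangle=-1,\ x^5>0\}$. Let $M$ be a connected smooth surface and $\Phi:M\to\mathbb{H}^4\subset\mathbb{R}^5_1$ a smooth immersion, with the induced metric on $M$, which is PNMC biconservative; that is, with $B$ the second fundamental form of $M$ in $\mathbb{H}^4$, $H=\tfrac12\operatorname{trace}B$ and $f=|H|$: $f>0$ and $\operatorname{grad}f\neq0$ everywhere; $\nabla^\perp(H/f)=0$; the tangential part of the bitension field $\tau_2=-\Delta\tau-\operatorname{trace}R(d\Phi,\tau)d\Phi$ vanishes, where $\tau=2H$, $R$ is the curvature tensor of $\mathbb{H}^4$ and $\Delta$ is the rough Laplacian on the pull-back of $T\mathbb{H}^4$; and no non-empty open subset of $M$ is mapped into a totally geodesic $\mathbb{H}^3\subset\mathbb{H}^4$. Then there are constants $c\neq0$ and $C$, with $c^2$ and $C$ uniquely determined by the surface, such that on $M$, with $E_1=\operatorname{grad}f/|\operatorname{grad}f|$, $E_3=H/f$ and $\{E_1,E_2\}$, $\{E_3,E_4\}$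 orthonormal bases of the tangent and normal planes ($E_4$ suitably oriented at each point), the shape operator of $E_4$ is $\operatorname{diag}(cf^{3/2},-cf^{3/2})$ with respect to $\{E_1,E_2\}$, and $$|\operatorname{grad}f|=E_1f=\tfrac43 f\sqrt{1+9Cf^{3/2}-9f^2-c^2f^3}.$$ If $C<0$, then every point of $M$ lies in a local chart $(u,t)$, centred at it and with image a product of two open intervals, in which $$\Phi(u,t)=\hat\sigma(u)+\frac1{\hat\kappa(u)}\bigl(\sinh t\;\overline b_1+(\cosh t-1)\,\overline b_2\bigr),$$ where (i) the mean curvature function is a function $f=f(u)>0$ with $f'=\frac43f\sqrt{1+9Cf^{3/2}-9f^2-c^2f^3}>0$; (ii) $\hat\kappa=3\sqrt{-C}\,f^{3/4}$; (iii) $\overline b_1,\overline b_2\in\mathbb{R}^5_1$ are constant vectors with $\langle\overline b_1,\overline b_2\rangle=0$ and $\langle\overline b_1,\overline b_1\rangle=-\langle\overline b_2,\overline b_2\rangle=1$; (iv) $\hat\sigma$ is a smooth curve parametrized by arc length in the totally geodesic hypersurface $\mathbb{H}^3=\mathbb{H}^4\cap\overline b_1^{\perp}$; as a curve in $\mathbb{H}^3$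 (suitably oriented) it has curvature and torsion $$\kappa=f\sqrt{1+c^2f},\qquad \tau=\frac{2|c|\sqrt f}{3(1+c^2f)}\sqrt{1+9Cf^{3/2}-9f^2-c^2f^3};$$ and it satisfies $\langle\hat\sigma(u),\overline b_2\rangle=-1/\hat\kappa(u)$. -/

import Mathlib

open scoped Manifold ContDiff

noncomputable section

namespace PNMC

/-- The coordinate plane on which surfaces are modelled. -/
abbrev E2 := EuclideanSpace ℝ (Fin 2)

/-- The vector space underlying the Minkowski space `ℝ⁵₁`. -/
abbrev R51 := Fin 5 → ℝ

/-- The Minkowski form `x¹y¹ + x²y² + x³y³ + x⁴y⁴ - x⁵y⁵`. -/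
def mink (x y : R51) : ℝ := (∑ i : Fin 4, x i.castSucc * y i.castSucc) - x (Fin.last 4) * y (Fin.last 4)

/-- The hyperboloid model of hyperbolic space `ℍ⁴`. -/
def hyp4 : Set R51 := {x | mink x x = -1 ∧ 0 < x (Fin.last 4)}

/-- The curvature tensor `R(X, Y) Z = [∇_X, ∇_Y] Z - ∇_[X,Y] Z` of `ℍ⁴`
(constant sectional curvature `-1`). -/
def hypCurv (X Y Z : R51) : R51 := -(mink Y Z • X - mink X Z • Y)

/-! ### Geometry of a parametrized surface

`F : E2 → ℝ⁵₁` takes values in `ℍ⁴` near the point considered, and is an immersion there. All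
quantities are the classical coordinate expressions with respect to the induced metric. -/

/-- Partial derivative. -/
def pd {W : Type*} [NormedAddCommGroup W] [NormedSpace ℝ W] (i : Fin 2) (G : E2 → W) (x : E2) : W :=
  fderiv ℝ G x (EuclideanSpace.single i 1)

/-- The induced metric `g_ij`. -/
def metric (F : E2 → R51) (x : E2) : Matrix (Fin 2) (Fin 2) ℝ :=
  Matrix.of fun i j => mink (pd i F x) (pd j F x)

/-- The inverse metric `g^ij`. -/
def invMetric (F : E2 → R51) (x : E2) : Matrix (Fin 2) (Fin 2) ℝ := (metric F x)⁻¹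

/-- The Christoffel symbols `Γ^k_ij` of the Levi-Civita connection of the induced metric. -/
def christoffel (F : E2 → R51) (k i j : Fin 2) (x : E2) : ℝ :=
  (1 / 2) * ∑ l, invMetric F x k l *
    (pd i (fun y => metric F y j l) x + pd j (fun y => metric F y i l) x
      - pd l (fun y => metric F y i j) x)

/-- The connection `∇^φ` on `φ⁻¹(Tℍ⁴)` in the `i`-th coordinate direction: the component of the
flat derivative of `V` tangent to `ℍ⁴` at `F x`. -/
def cov (F : E2 → R51) (i : Fin 2) (V : E2 → R51) (x : E2) : R51 :=
  pd i V x + mink (pd i V x) (F x) • F x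

/-- The second fundamental form `B_ij = (∇dφ)(∂_i, ∂_j)` of the surface in `ℍ⁴`. -/
def secondFF (F : E2 → R51) (i j : Fin 2) (x : E2) : R51 :=
  cov F i (pd j F) x - ∑ k, christoffel F k i j x • pd k F x

/-- The tension field `τ(φ) = trace B`. -/
def tension (F : E2 → R51) (x : E2) : R51 :=
  ∑ i, ∑ j, invMetric F x i j • secondFF F i j x

/-- The mean curvature vector field `H = (trace B) / 2`. -/
def meanCurvVec (F : E2 → R51) (x : E2) : R51 := (1 / 2 : ℝ) • tension F x

/-- The mean curvature function `f = |H|`. -/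
def meanCurv (F : E2 → R51) (x : E2) : ℝ := Real.sqrt (mink (meanCurvVec F x) (meanCurvVec F x))

/-- The norm `|grad f|` of the gradient of the mean curvature function. -/
def normGradMeanCurv (F : E2 → R51) (x : E2) : ℝ :=
  Real.sqrt (∑ i, ∑ j, invMetric F x i j * pd i (meanCurv F) x * pd j (meanCurv F) x)

/-- The rough Laplacian `Δ^φ = -trace (∇^φ ∇^φ - ∇^φ_∇)`. -/
def roughLaplacian (F : E2 → R51) (V : E2 → R51) (x : E2) : R51 :=
  -∑ i, ∑ j, invMetric F x i j •
    (cov F i (cov F j V) x - ∑ k, christoffel F k i j x • cov F k V x)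

/-- The bitension field `τ₂(φ) = -Δ^φ τ(φ) - trace R(dφ, τ(φ)) dφ`. -/
def bitension (F : E2 → R51) (x : E2) : R51 :=
  -roughLaplacian F (tension F) x
    - ∑ i, ∑ j, invMetric F x i j • hypCurv (pd i F x) (tension F x) (pd j F x)

/-- The connection `∇^⊥` of the normal bundle of the surface in `ℍ⁴`: the component of
`∇^φ_i V` orthogonal to the surface. -/
def normalCov (F : E2 → R51) (i : Fin 2) (V : E2 → R51) (x : E2) : R51 :=
  cov F i V x - ∑ k, ∑ l, (invMetric F x k l * mink (cov F i V x) (pd k F x)) • pd l F x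

/-! ### Surfaces in `ℍ⁴` -/

section

variable (M : Type*) [TopologicalSpace M] [ChartedSpace E2 M]

/-- The smooth charts of the surface `M`. -/
abbrev charts : Set (OpenPartialHomeomorph M E2) := IsManifold.maximalAtlas (𝓡 2) ∞ M

variable {M}

/-- `Φ = ι ∘ φ` where `φ : M → ℍ⁴` is a (non-CMC) PNMC biconservative immersion. -/
structure IsPNMCBiconservative (Φ : M → R51) : Prop where
  smooth : ContMDiff (𝓡 2) 𝓘(ℝ, R51) ∞ Φ
  mem_hyp : ∀ p, Φ p ∈ hyp4
  immersion : ∀ p, Function.Injective (mfderiv (𝓡 2) 𝓘(ℝ, R51) Φ p)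
  /-- `f > 0` -/
  meanCurv_pos : ∀ e ∈ charts M, ∀ x ∈ e.target, 0 < meanCurv (Φ ∘ e.symm) x
  /-- `grad f` vanishes nowhere -/
  grad_ne_zero : ∀ e ∈ charts M, ∀ x ∈ e.target, ∃ i, pd i (meanCurv (Φ ∘ e.symm)) x ≠ 0
  /-- `∇^⊥ (H / |H|) = 0` -/
  parallel : ∀ e ∈ charts M, ∀ x ∈ e.target, ∀ i,
    normalCov (Φ ∘ e.symm) i
      (fun y => (meanCurv (Φ ∘ e.symm) y)⁻¹ • meanCurvVec (Φ ∘ e.symm) y) x = 0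
  /-- the tangential part of `τ₂(φ)` vanishes -/
  biconservative : ∀ e ∈ charts M, ∀ x ∈ e.target, ∀ k,
    mink (bitension (Φ ∘ e.symm) x) (pd k (Φ ∘ e.symm) x) = 0
  /-- no non-empty open part of `M` lies in a totally geodesic `ℍ³ = ℍ⁴ ∩ n^⊥`, `n` spacelike -/
  full : ∀ U : Set M, IsOpen U → U.Nonempty → ∀ n : R51, 0 < mink n n → ∃ p ∈ U, mink (Φ p) n ≠ 0

/-- The expression under the root in the first order equation for `f`. -/
def radicand (c C f : ℝ) : ℝ := 1 + 9 * C * f ^ (3 / 2 : ℝ) - 9 * f ^ 2 - c ^ 2 * f ^ 3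

/-- `c` and `C` are the two constants attached to the surface. With `E₁ = grad f / |grad f|`,
`E₃ = H / f`, and `E₁, E₂`, respectively `E₃, E₄`, orthonormal bases of the tangent and normal
planes:
* the shape operator of `E₄` has the matrix `diag (c f^(3/2), -c f^(3/2))` in the basis `E₁, E₂`,
  that is, `⟨B(X, Y), E₄⟩ = c f^(3/2) (2 ⟨X, E₁⟩⟨Y, E₁⟩ - ⟨X, Y⟩)` (`E₄` is determined up to
  sign, hence so is `c`);
* `E₁ f = |grad f| = (4/3) f √(1 + 9 C f^(3/2) - 9 f² - c² f³)`. -/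
structure HasConstants (Φ : M → R51) (c C : ℝ) : Prop where
  shape : ∀ e ∈ charts M, ∀ x ∈ e.target, ∃ E₄ : R51,
    mink E₄ E₄ = 1 ∧ mink E₄ (Φ (e.symm x)) = 0 ∧
    (∀ i, mink E₄ (pd i (Φ ∘ e.symm) x) = 0) ∧ mink E₄ (meanCurvVec (Φ ∘ e.symm) x) = 0 ∧
    ∀ i j, mink (secondFF (Φ ∘ e.symm) i j x) E₄ =
      c * meanCurv (Φ ∘ e.symm) x ^ (3 / 2 : ℝ) *
        (2 * (pd i (meanCurv (Φ ∘ e.symm)) x * pd j (meanCurv (Φ ∘ e.symm)) x)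
            / normGradMeanCurv (Φ ∘ e.symm) x ^ 2
          - metric (Φ ∘ e.symm) x i j)
  first_integral : ∀ e ∈ charts M, ∀ x ∈ e.target,
    normGradMeanCurv (Φ ∘ e.symm) x =
      4 / 3 * meanCurv (Φ ∘ e.symm) x * Real.sqrt (radicand c C (meanCurv (Φ ∘ e.symm) x))

end

/-! ### Curves in `ℍ³` -/

/-- Covariant derivative in hyperbolic space of the field `V` along the curve `σ`. -/
def curveCov (σ V : ℝ → R51) (u : ℝ) : R51 := deriv V u + mink (deriv V u) (σ u) • σ u

/-- `σ`, restricted to the open interval `I`, is an arc-length curve in `ℍ³ = ℍ⁴ ∩ b^⊥` (with `b`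
spacelike) with curvature `κ > 0` and torsion `τ` as a curve in `ℍ³`, for one of the two
orientations of `ℍ³`: it has an orthonormal Frenet frame `V₁ = σ', V₂, V₃` in `Tℍ³`. -/
def IsFrenetCurve (b : R51) (σ : ℝ → R51) (κ τ : ℝ → ℝ) (I : Set ℝ) : Prop :=
  ContDiffOn ℝ ∞ σ I ∧ (∀ u ∈ I, σ u ∈ hyp4 ∧ mink (σ u) b = 0) ∧
  ∃ V : Fin 3 → ℝ → R51, (∀ i, ContDiffOn ℝ ∞ (V i) I) ∧ ∀ u ∈ I,
    (∀ i, mink (V i u) (σ u) = 0 ∧ mink (V i u) b = 0) ∧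
    (∀ i j, mink (V i u) (V j u) = if i = j then 1 else 0) ∧
    V 0 u = deriv σ u ∧
    0 < κ u ∧
    curveCov σ (V 0) u = κ u • V 1 u ∧
    curveCov σ (V 1) u = -κ u • V 0 u + τ u • V 2 u ∧
    curveCov σ (V 2) u = -τ u • V 1 u

end PNMC

end

/-! Put E₁ = grad f/|grad f|, E₃ = H/f, and let n (`perp`) be the part of B(E₁,E₁) orthogonal to H.
Since E₃ is parallel in the normal bundle, its Codazzi equation identifies the divergence of its
shape operator A₃ with 2 grad f, and biconservativity becomes A₃ grad f = −f grad f. As trace A₃ =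
2f, this forces A₃ = diag(−f, 3f) (`shape_E₃`). The eigenvalues are distinct, so the Codazzi and
Ricci equations of E₃ determine the frame (`deriv_frame`): the E₁-curves are geodesics of the
surface, ∇_{E₂}E₁ = ωE₂ with ω = −(3/4) E₁f/f (`conn`), and B(E₁,E₂) = 0.

The functions f, ω and |n|² are constant along E₂, and `deriv_perp` gives along E₁ the system E₁f =
−(4/3)fω, E₁ω = 1 + 3f² + |n|² − ω², E₁|n|² = −4ω|n|². Therefore |n|²/f³ and (ω² − 1 + 9f² +
|n|²)/f^(3/2) are first integrals; they are c² and 9C (`exists_constants`). If c = 0 then n = 0, and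
an open piece would lie in a totally geodesic ℍ³ (`exists_orthogonal`), which fullness excludes.
Both constants can be recovered at a single point (`eq_of_hasConstantsAt`), so they do not depend on
the chart, are locally constant, and are global by connectedness.

In ℝ⁵₁ the acceleration of an E₂-curve has Minkowski square 9C f^(3/2). For C < 0 it is timelike and
equals κ̂T with ⟨T,T⟩ = −1. Along E₂ one has E₂' = κ̂T and T' = κ̂E₂, while E₂ and T are constant
along E₁. So the plane of E₂ and T is fixed, the E₂-curves are hyperbolas in parallel planes, and
the hyperbolic angle t is a smooth function (`exists_angle`). With the arc length u of the E₁-curves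
it forms a chart (`exists_coord`). The centre F − T/κ̂ depends on u alone, which is the formula for
the immersion (`immersion_eq`). The directrix is the E₁-curve t = 0, and its curvature and torsion
come from the structure equations (`hasD_frenet₁`, `hasD_frenet₂`). -/

noncomputable section

namespace PNMC

/-! ### Algebra of the Minkowski form -/

section Mink

variable (a b x y z : R51) (r : ℝ)

lemma mink_comm : mink x y = mink y x := by
  simp only [mink, mul_comm]

@[simp] lemma mink_add_left : mink (x + y) z = mink x z + mink y z := by
  simp only [mink, Pi.add_apply, add_mul, Finset.sum_add_distrib]; ring

@[simp] lemma mink_add_right : mink x (y + z) = mink x y + mink x z := by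
  simp only [mink_comm x, mink_add_left]

@[simp] lemma mink_smul_left : mink (r • x) y = r * mink x y := by
  simp only [mink, Pi.smul_apply, smul_eq_mul, mul_assoc, ← Finset.mul_sum]; ring

@[simp] lemma mink_smul_right : mink x (r • y) = r * mink x y := by
  simp only [mink_comm x, mink_smul_left]

@[simp] lemma mink_neg_left : mink (-x) y = -mink x y := by
  simpa using mink_smul_left x y (-1)

@[simp] lemma mink_neg_right : mink x (-y) = -mink x y := by
  simp only [mink_comm x, mink_neg_left]

@[simp] lemma mink_sub_left : mink (x - y) z = mink x z - mink y z := by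
  rw [sub_eq_add_neg, mink_add_left, mink_neg_left, sub_eq_add_neg]

@[simp] lemma mink_sub_right : mink x (y - z) = mink x y - mink x z := by
  simp only [mink_comm x, mink_sub_left]

@[simp] lemma mink_zero_left : mink 0 x = 0 := by simp [mink]

@[simp] lemma mink_zero_right : mink x 0 = 0 := by simp [mink]

/-- The Minkowski form as a continuous bilinear map. -/
def minkL : R51 →L[ℝ] R51 →L[ℝ] ℝ :=
  (LinearMap.mk₂ ℝ mink mink_add_left (fun c x y => mink_smul_left x y c) mink_add_right
    (fun c x y => mink_smul_right x y c)).toContinuousBilinearMap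

lemma minkL_apply : minkL x y = mink x y := rfl

variable {a b x y}

/-- The orthogonal complement of a timelike vector is positive definite. If ⟨y,y⟩ ≤ 0,
Cauchy–Schwarz for the spatial parts gives (x⁵y⁵)² ≤ ((x⁵)² − 1)(y⁵)², so y⁵ = 0, and then the
spatial part vanishes too. -/
lemma mink_self_eq_zero_or_pos (hx : mink x x = -1) (hxy : mink y x = 0) :
    y = 0 ∨ 0 < mink y y := by
  by_contra! h
  obtain ⟨hy, hyy⟩ := h
  simp only [mink] at hx hxy hyy
  have cs := Finset.sum_mul_sq_le_sq_mul_sq Finset.univ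
    (fun i : Fin 4 => y i.castSucc) (fun i : Fin 4 => x i.castSucc)
  have h1 : ∑ i : Fin 4, y i.castSucc * x i.castSucc = y (Fin.last 4) * x (Fin.last 4) := by
    linarith
  have h2 : ∑ i : Fin 4, x i.castSucc ^ 2 = x (Fin.last 4) ^ 2 - 1 := by
    simp only [pow_two]; linarith
  have h3 : ∑ i : Fin 4, y i.castSucc ^ 2 ≤ y (Fin.last 4) ^ 2 := by
    simp only [pow_two]; linarith
  have h5 : 0 ≤ x (Fin.last 4) ^ 2 - 1 := by
    rw [← h2]; positivity
  rw [h1, h2] at cs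
  have h4 : y (Fin.last 4) ^ 2 ≤ 0 := by
    nlinarith [mul_le_mul_of_nonneg_right h3 h5]
  have h6 : y (Fin.last 4) = 0 := by
    have := sq_nonneg (y (Fin.last 4)); exact pow_eq_zero_iff two_ne_zero |>.1 (le_antisymm h4 this)
  rw [h6] at h3
  have h7 : ∑ i : Fin 4, y i.castSucc ^ 2 = 0 :=
    le_antisymm (by simpa using h3) (by positivity)
  rw [Finset.sum_eq_zero_iff_of_nonneg (fun i _ => sq_nonneg _)] at h7
  apply hy
  ext i
  refine Fin.lastCases ?_ (fun i => ?_) i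
  · exact h6
  · exact pow_eq_zero_iff two_ne_zero |>.1 (h7 i (Finset.mem_univ _))

lemma mink_self_pos (hx : mink x x = -1) (hxy : mink y x = 0) (hy : y ≠ 0) : 0 < mink y y :=
  (mink_self_eq_zero_or_pos hx hxy).resolve_left hy

lemma eq_zero_of_mink_self (hx : mink x x = -1) (hxy : mink y x = 0) (hy : mink y y = 0) :
    y = 0 :=
  (mink_self_eq_zero_or_pos hx hxy).resolve_right hy.not_gt

lemma mink_self_nonneg (hx : mink x x = -1) (hxy : mink y x = 0) : 0 ≤ mink y y := by
  rcases mink_self_eq_zero_or_pos hx hxy with h | h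
  · simp [h]
  · exact h.le

end Mink

/-! ### Directional derivatives -/

section HasD

variable {E W : Type*} [NormedAddCommGroup E] [NormedSpace ℝ E]
  [NormedAddCommGroup W] [NormedSpace ℝ W] {v x : E}

/-- `G` is differentiable at `x`, with derivative `G'` in the direction `v`. -/
def HasD (v : E) (G : E → W) (G' : W) (x : E) : Prop :=
  ∃ L : E →L[ℝ] W, HasFDerivAt G L x ∧ L v = G'

lemma hasD_of_differentiableAt {G : E → W} (h : DifferentiableAt ℝ G x) (v : E) :
    HasD v G (fderiv ℝ G x v) x := ⟨_, h.hasFDerivAt, rfl⟩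

namespace HasD

variable {G K : E → W} {G' K' : W} {g k : E → ℝ} {g' k' : ℝ} {A B : E → R51} {A' B' : R51}

lemma differentiableAt (h : HasD v G G' x) : DifferentiableAt ℝ G x :=
  let ⟨_, h, _⟩ := h; h.differentiableAt

lemma fderiv_eq (h : HasD v G G' x) : fderiv ℝ G x v = G' := by
  obtain ⟨L, h, rfl⟩ := h; rw [h.fderiv]

lemma unique (h : HasD v G G' x) (h' : HasD v G K' x) : G' = K' := by
  rw [← h.fderiv_eq, h'.fderiv_eq]

lemma congr_eq (h : HasD v G G' x) (e : G' = K') : HasD v G K' x := e ▸ h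

/-- Structure equations hold only on an open set; this is what allows them to be differentiated
again. -/
lemma congr_on {s : Set E} (h : HasD v G G' x) (hs : IsOpen s) (hx : x ∈ s)
    (e : ∀ y ∈ s, K y = G y) : HasD v K G' x := by
  obtain ⟨L, h, rfl⟩ := h
  exact ⟨L, h.congr_of_eventuallyEq (Filter.eventuallyEq_of_mem (hs.mem_nhds hx) e), rfl⟩

lemma const (c : W) : HasD v (fun _ => c) 0 x := ⟨0, hasFDerivAt_const _ _, rfl⟩

lemma add (h : HasD v G G' x) (h' : HasD v K K' x) :
    HasD v (fun y => G y + K y) (G' + K') x := by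
  obtain ⟨L, h, rfl⟩ := h; obtain ⟨L', h', rfl⟩ := h'
  exact ⟨_, h.add h', rfl⟩

lemma sub (h : HasD v G G' x) (h' : HasD v K K' x) :
    HasD v (fun y => G y - K y) (G' - K') x := by
  obtain ⟨L, h, rfl⟩ := h; obtain ⟨L', h', rfl⟩ := h'
  exact ⟨_, h.sub h', rfl⟩

lemma neg (h : HasD v G G' x) : HasD v (fun y => -G y) (-G') x := by
  obtain ⟨L, h, rfl⟩ := h
  exact ⟨_, h.neg, rfl⟩

lemma smul (h : HasD v g g' x) (h' : HasD v K K' x) :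
    HasD v (fun y => g y • K y) (g x • K' + g' • K x) x := by
  obtain ⟨L, h, rfl⟩ := h; obtain ⟨L', h', rfl⟩ := h'
  exact ⟨_, h.smul h', by simp⟩

lemma mul (h : HasD v g g' x) (h' : HasD v k k' x) :
    HasD v (fun y => g y * k y) (g x * k' + g' * k x) x := by
  simpa only [smul_eq_mul] using h.smul h'

lemma comp_hasDerivAt {φ : ℝ → W} {φ' : W} (hφ : HasDerivAt φ φ' (g x)) (h : HasD v g g' x) :
    HasD v (fun y => φ (g y)) (g' • φ') x := by
  obtain ⟨L, h, rfl⟩ := h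
  exact ⟨_, hφ.hasFDerivAt.comp x h, by simp⟩

lemma pow (h : HasD v g g' x) (n : ℕ) :
    HasD v (fun y => g y ^ n) (n * g x ^ (n - 1) * g') x :=
  (comp_hasDerivAt (hasDerivAt_pow n (g x)) h).congr_eq (by simp [mul_comm])

lemma inv (h : HasD v g g' x) (h0 : g x ≠ 0) :
    HasD v (fun y => (g y)⁻¹) (-g' / g x ^ 2) x :=
  (comp_hasDerivAt (hasDerivAt_inv h0) h).congr_eq (by simp; ring)

lemma div (h : HasD v g g' x) (h' : HasD v k k' x) (h0 : k x ≠ 0) :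
    HasD v (fun y => g y / k y) ((g' * k x - g x * k') / k x ^ 2) x := by
  simp only [div_eq_mul_inv]
  refine (h.mul (h'.inv h0)).congr_eq ?_
  field_simp
  ring

lemma mink (h : HasD v A A' x) (h' : HasD v B B' x) :
    HasD v (fun y => mink (A y) (B y)) (PNMC.mink A' (B x) + PNMC.mink (A x) B') x := by
  obtain ⟨L, h, rfl⟩ := h; obtain ⟨L', h', rfl⟩ := h'
  refine ⟨_, minkL.hasFDerivAt_of_bilinear h h', ?_⟩
  simp [minkL_apply, add_comm]

lemma clm_comp {V : Type*} [NormedAddCommGroup V] [NormedSpace ℝ V] (T : W →L[ℝ] V)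
    (h : HasD v G G' x) : HasD v (fun y => T (G y)) (T G') x := by
  obtain ⟨L, h, rfl⟩ := h
  exact ⟨_, T.hasFDerivAt.comp x h, rfl⟩

end HasD

lemma _root_.ContDiffOn.mink {A B : E → R51} {s : Set E} {n : WithTop ℕ∞}
    (hA : ContDiffOn ℝ n A s) (hB : ContDiffOn ℝ n B s) :
    ContDiffOn ℝ n (fun y => PNMC.mink (A y) (B y)) s :=
  minkL.isBoundedBilinearMap.contDiff.comp_contDiffOn (hA.prodMk hB)

/-- Derivative of `G` along the vector field `e`. -/
def dd (e : E → E) (G : E → W) (x : E) : W := fderiv ℝ G x (e x)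

lemma contDiffOn_dd {e : E → E} {G : E → W} {s : Set E} (hs : IsOpen s)
    (he : ContDiffOn ℝ ∞ e s) (hG : ContDiffOn ℝ ∞ G s) : ContDiffOn ℝ ∞ (dd e G) s :=
  ((contDiffOn_infty_iff_fderiv_of_isOpen hs).1 hG).2.clm_apply he

lemma _root_.ContDiffOn.differentiableAt_of_isOpen {G : E → W} {s : Set E}
    (hG : ContDiffOn ℝ ∞ G s) (hs : IsOpen s) (hx : x ∈ s) : DifferentiableAt ℝ G x :=
  (hG.contDiffAt (hs.mem_nhds hx)).differentiableAt (by simp)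

lemma _root_.ContDiffOn.hasD {G : E → W} {s : Set E}
    (hG : ContDiffOn ℝ ∞ G s) (hs : IsOpen s) (hx : x ∈ s) (e : E → E) :
    HasD (e x) G (dd e G x) x :=
  hasD_of_differentiableAt (hG.differentiableAt_of_isOpen hs hx) _

lemma hasD_dd {e : E → E} {G : E → W} {s : Set E} (hs : IsOpen s) (hx : x ∈ s)
    (he : ContDiffOn ℝ ∞ e s) (hG : ContDiffOn ℝ ∞ G s) (v : E) :
    HasD v (dd e G) (fderiv ℝ (fderiv ℝ G) x v (e x) + fderiv ℝ G x (fderiv ℝ e x v)) x := by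
  have h1 := ((contDiffOn_infty_iff_fderiv_of_isOpen hs).1 hG).2.differentiableAt_of_isOpen hs hx
  have h2 := he.differentiableAt_of_isOpen hs hx
  exact ⟨_, h1.hasFDerivAt.clm_apply h2.hasFDerivAt, by simp [add_comm]⟩

lemma snd_fderiv_symm {G : E → W} {s : Set E} (hs : IsOpen s) (hx : x ∈ s)
    (hG : ContDiffOn ℝ ∞ G s) (v w : E) :
    fderiv ℝ (fderiv ℝ G) x v w = fderiv ℝ (fderiv ℝ G) x w v :=
  ((hG.contDiffAt (hs.mem_nhds hx)).isSymmSndFDerivAt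
    (by simp only [minSmoothness_of_isRCLikeNormedField]; exact WithTop.coe_le_coe.2 le_top)) v w

/-- The commutator of two derivations is the derivation along the Lie bracket. -/
lemma dd_comm {e₁ e₂ : E → E} {G : E → W} {s : Set E} (hs : IsOpen s) (hx : x ∈ s)
    (h₁ : ContDiffOn ℝ ∞ e₁ s) (h₂ : ContDiffOn ℝ ∞ e₂ s) (hG : ContDiffOn ℝ ∞ G s) :
    dd e₁ (dd e₂ G) x - dd e₂ (dd e₁ G) x =
      fderiv ℝ G x (fderiv ℝ e₂ x (e₁ x) - fderiv ℝ e₁ x (e₂ x)) := by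
  have e1 := (hasD_dd hs hx h₂ hG (e₁ x)).fderiv_eq
  have e2 := (hasD_dd hs hx h₁ hG (e₂ x)).fderiv_eq
  simp only [dd] at e1 e2 ⊢
  rw [e1, e2, map_sub, snd_fderiv_symm hs hx hG]
  abel

end HasD

end PNMC

end

/-! ### Moving frames and the structure equations of the surface -/

noncomputable section

namespace PNMC

variable {Ω : Set E2} {F E₃ : E2 → R51} {e₁ e₂ : E2 → E2} {f : E2 → ℝ} {x : E2}

/-- `e₁, e₂` is a smooth orthonormal frame for the metric induced by `F : Ω → ℍ⁴`. -/
structure IsFrame (Ω : Set E2) (F : E2 → R51) (e₁ e₂ : E2 → E2) : Prop where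
  isOpen : IsOpen Ω
  smooth : ContDiffOn ℝ ∞ F Ω
  smooth₁ : ContDiffOn ℝ ∞ e₁ Ω
  smooth₂ : ContDiffOn ℝ ∞ e₂ Ω
  hyp : ∀ x ∈ Ω, mink (F x) (F x) = -1
  unit₁ : ∀ x ∈ Ω, mink (dd e₁ F x) (dd e₁ F x) = 1
  unit₂ : ∀ x ∈ Ω, mink (dd e₂ F x) (dd e₂ F x) = 1
  ortho : ∀ x ∈ Ω, mink (dd e₁ F x) (dd e₂ F x) = 0

namespace IsFrame

variable (h : IsFrame Ω F e₁ e₂)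
include h

lemma smooth_dd₁ : ContDiffOn ℝ ∞ (dd e₁ F) Ω := contDiffOn_dd h.isOpen h.smooth₁ h.smooth

lemma smooth_dd₂ : ContDiffOn ℝ ∞ (dd e₂ F) Ω := contDiffOn_dd h.isOpen h.smooth₂ h.smooth

lemma mink_deriv {e : E2 → E2} {A B : E2 → R51} {r : ℝ} (hA : ContDiffOn ℝ ∞ A Ω)
    (hB : ContDiffOn ℝ ∞ B Ω) (hAB : ∀ x ∈ Ω, mink (A x) (B x) = r) (hx : x ∈ Ω) :
    mink (dd e A x) (B x) + mink (A x) (dd e B x) = 0 :=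
  ((hA.hasD h.isOpen hx e).mink (hB.hasD h.isOpen hx e)).unique
    ((HasD.const r).congr_on h.isOpen hx hAB)

lemma mink_dd_self {e : E2 → E2} (hx : x ∈ Ω) : mink (dd e F x) (F x) = 0 := by
  have := h.mink_deriv (e := e) h.smooth h.smooth h.hyp hx
  rw [mink_comm (F x)] at this
  linarith

lemma eq_combination (hx : x ∈ Ω) (v : E2) :
    v = mink (fderiv ℝ F x v) (dd e₁ F x) • e₁ x + mink (fderiv ℝ F x v) (dd e₂ F x) • e₂ x := by
  have h1 := h.unit₁ x hx
  have h2 := h.unit₂ x hx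
  have h3 := h.ortho x hx
  have h4 := h3
  rw [mink_comm] at h4
  -- The metric recovers the two coefficients, so the frame is linearly independent, and two such
  -- vectors span the plane.
  have key : ∀ a b : ℝ, a = mink (fderiv ℝ F x (a • e₁ x + b • e₂ x)) (dd e₁ F x) ∧
      b = mink (fderiv ℝ F x (a • e₁ x + b • e₂ x)) (dd e₂ F x) := by
    intro a b
    simp only [map_add, map_smul, mink_add_left, mink_smul_left]
    simp only [dd] at h1 h2 h3 h4 ⊢
    rw [h1, h2, h3, h4]
    constructor <;> ring
  have li : LinearIndependent ℝ ![e₁ x, e₂ x] := by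
    rw [LinearIndependent.pair_iff]
    intro a b hab
    have := key a b
    rw [hab] at this
    simpa using this
  have sp := li.span_eq_top_of_card_eq_finrank (by simp)
  have hv : v ∈ Submodule.span ℝ (Set.range ![e₁ x, e₂ x]) := sp ▸ Submodule.mem_top
  rw [Matrix.range_cons, Matrix.range_cons, Matrix.range_empty, Set.union_empty,
    Set.singleton_union, Submodule.mem_span_pair] at hv
  obtain ⟨a, b, rfl⟩ := hv
  rw [← (key a b).1, ← (key a b).2]

lemma fderiv_eq {W : Type*} [NormedAddCommGroup W] [NormedSpace ℝ W] (G : E2 → W)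
    (hx : x ∈ Ω) (v : E2) :
    fderiv ℝ G x v = mink (fderiv ℝ F x v) (dd e₁ F x) • dd e₁ G x +
      mink (fderiv ℝ F x v) (dd e₂ F x) • dd e₂ G x := by
  conv_lhs => rw [h.eq_combination hx v]
  simp only [map_add, map_smul, dd]

/-- The relations between the first derivatives of an orthonormal frame. -/
lemma relations (hx : x ∈ Ω) :
    mink (dd e₁ F x) (F x) = 0 ∧ mink (dd e₂ F x) (F x) = 0 ∧
    mink (dd e₁ (dd e₁ F) x) (F x) = -1 ∧ mink (dd e₂ (dd e₂ F) x) (F x) = -1 ∧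
    mink (dd e₁ (dd e₂ F) x) (F x) = 0 ∧ mink (dd e₂ (dd e₁ F) x) (F x) = 0 ∧
    (∀ e : E2 → E2, mink (dd e (dd e₁ F) x) (dd e₁ F x) = 0) ∧
    (∀ e : E2 → E2, mink (dd e (dd e₂ F) x) (dd e₂ F x) = 0) ∧
    (∀ e : E2 → E2, mink (dd e (dd e₂ F) x) (dd e₁ F x) =
      - mink (dd e (dd e₁ F) x) (dd e₂ F x)) := by
  have u1 := h.unit₁ x hx
  have u2 := h.unit₂ x hx
  have u3 := h.ortho x hx
  have u4 := u3
  rw [mink_comm] at u4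
  have z (e : E2 → E2) : ∀ x ∈ Ω, mink (dd e F x) (F x) = 0 := fun x hx => h.mink_dd_self hx
  refine ⟨z _ x hx, z _ x hx, ?_, ?_, ?_, ?_, fun e => ?_, fun e => ?_, fun e => ?_⟩
  · linarith [h.mink_deriv (e := e₁) h.smooth_dd₁ h.smooth (z e₁) hx]
  · linarith [h.mink_deriv (e := e₂) h.smooth_dd₂ h.smooth (z e₂) hx]
  · linarith [h.mink_deriv (e := e₁) h.smooth_dd₂ h.smooth (z e₂) hx]
  · linarith [h.mink_deriv (e := e₂) h.smooth_dd₁ h.smooth (z e₁) hx]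
  · have := h.mink_deriv (e := e) h.smooth_dd₁ h.smooth_dd₁ h.unit₁ hx
    rw [mink_comm (dd e₁ F x)] at this
    linarith
  · have := h.mink_deriv (e := e) h.smooth_dd₂ h.smooth_dd₂ h.unit₂ hx
    rw [mink_comm (dd e₂ F x)] at this
    linarith
  · have := h.mink_deriv (e := e) h.smooth_dd₁ h.smooth_dd₂ h.ortho hx
    rw [mink_comm (dd e₁ F x)] at this
    linarith

/-- The connection has no torsion, so [e₁,e₂] is determined by the connection form. Its coefficients
are found by applying `dd_comm` to F itself and pairing with the tangent frame. -/
lemma comm {W : Type*} [NormedAddCommGroup W] [NormedSpace ℝ W] {G : E2 → W}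
    (hG : ContDiffOn ℝ ∞ G Ω) (hx : x ∈ Ω) :
    dd e₁ (dd e₂ G) x - dd e₂ (dd e₁ G) x =
      -(mink (dd e₁ (dd e₁ F) x) (dd e₂ F x) • dd e₁ G x) -
        mink (dd e₂ (dd e₁ F) x) (dd e₂ F x) • dd e₂ G x := by
  obtain ⟨-, -, -, -, -, -, r1, r2, r3⟩ := h.relations hx
  rw [dd_comm h.isOpen hx h.smooth₁ h.smooth₂ hG, h.fderiv_eq G hx,
    ← dd_comm h.isOpen hx h.smooth₁ h.smooth₂ h.smooth]
  simp only [mink_sub_left, r1, r2, r3]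
  module

end IsFrame

/-- The component of `V` orthogonal to `A₁`, `A₂` and `X`, for `A₁, A₂` orthonormal in
`T_X ℍ⁴`. -/
def nor (X A₁ A₂ V : R51) : R51 := V + mink V X • X - mink V A₁ • A₁ - mink V A₂ • A₂

/-- The covariant derivative in `ℍ⁴` along the vector field `e`. -/
def cd (F : E2 → R51) (e : E2 → E2) (V : E2 → R51) (x : E2) : R51 :=
  dd e V x + mink (dd e V x) (F x) • F x

/-- A frame adapted to a PNMC biconservative surface with mean curvature function `f` and
`E₃ = H / f`, such that `grad f = (e₁ f) e₁`. -/
structure IsAdapted (Ω : Set E2) (F : E2 → R51) (e₁ e₂ : E2 → E2) (f : E2 → ℝ) (E₃ : E2 → R51) :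
    Prop extends IsFrame Ω F e₁ e₂ where
  smooth_f : ContDiffOn ℝ ∞ f Ω
  smooth_E₃ : ContDiffOn ℝ ∞ E₃ Ω
  f_pos : ∀ x ∈ Ω, 0 < f x
  grad_pos : ∀ x ∈ Ω, 0 < dd e₁ f x
  grad_zero : ∀ x ∈ Ω, dd e₂ f x = 0
  unit₃ : ∀ x ∈ Ω, mink (E₃ x) (E₃ x) = 1
  ortho₀ : ∀ x ∈ Ω, mink (E₃ x) (F x) = 0
  ortho₁ : ∀ x ∈ Ω, mink (E₃ x) (dd e₁ F x) = 0
  ortho₂ : ∀ x ∈ Ω, mink (E₃ x) (dd e₂ F x) = 0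
  parallel₁ : ∀ x ∈ Ω, nor (F x) (dd e₁ F x) (dd e₂ F x) (dd e₁ E₃ x) = 0
  parallel₂ : ∀ x ∈ Ω, nor (F x) (dd e₁ F x) (dd e₂ F x) (dd e₂ E₃ x) = 0
  trace : ∀ x ∈ Ω, nor (F x) (dd e₁ F x) (dd e₂ F x) (dd e₁ (dd e₁ F) x) +
    nor (F x) (dd e₁ F x) (dd e₂ F x) (dd e₂ (dd e₂ F) x) = (2 * f x) • E₃ x
  bicons : ∀ x ∈ Ω, ∀ v : E2, mink
    (cd F e₁ (cd F e₁ fun y => (2 * f y) • E₃ y) x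
      - mink (dd e₁ (dd e₁ F) x) (dd e₂ F x) • cd F e₂ (fun y => (2 * f y) • E₃ y) x
      + (cd F e₂ (cd F e₂ fun y => (2 * f y) • E₃ y) x
      - mink (dd e₂ (dd e₂ F) x) (dd e₁ F x) • cd F e₁ (fun y => (2 * f y) • E₃ y) x))
    (fderiv ℝ F x v) = 0

/-- `-3 (e₁ f) / (4 f)`, the connection form of the frame evaluated on `e₂`. -/
def conn (e₁ : E2 → E2) (f : E2 → ℝ) (x : E2) : ℝ := -(3 / 4) * (dd e₁ f x / f x)

/-- The component of `B(e₁, e₁)` orthogonal to the mean curvature vector. -/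
def perp (F : E2 → R51) (e₁ : E2 → E2) (f : E2 → ℝ) (E₃ : E2 → R51) (x : E2) : R51 :=
  dd e₁ (dd e₁ F) x - F x + f x • E₃ x

namespace IsAdapted

variable (h : IsAdapted Ω F e₁ e₂ f E₃)
include h

lemma smooth_conn : ContDiffOn ℝ ∞ (conn e₁ f) Ω :=
  contDiffOn_const.mul ((contDiffOn_dd h.isOpen h.smooth₁ h.smooth_f).div h.smooth_f
    fun x hx => (h.f_pos x hx).ne')

lemma smooth_perp : ContDiffOn ℝ ∞ (perp F e₁ f E₃) Ω :=
  ((contDiffOn_dd h.isOpen h.smooth₁ h.smooth_dd₁).sub h.smooth).add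
    (h.smooth_f.smul h.smooth_E₃)

/-- The coefficients of the shape operator of `E₃`. -/
lemma deriv_E₃_aux (hx : x ∈ Ω) :
    dd e₁ E₃ x = -(mink (dd e₁ (dd e₁ F) x) (E₃ x) • dd e₁ F x) -
      mink (dd e₁ (dd e₂ F) x) (E₃ x) • dd e₂ F x ∧
    dd e₂ E₃ x = -(mink (dd e₁ (dd e₂ F) x) (E₃ x) • dd e₁ F x) -
      mink (dd e₂ (dd e₂ F) x) (E₃ x) • dd e₂ F x := by
  have key (e : E2 → E2) (hp : nor (F x) (dd e₁ F x) (dd e₂ F x) (dd e E₃ x) = 0) :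
      dd e E₃ x = -(mink (dd e (dd e₁ F) x) (E₃ x) • dd e₁ F x) -
        mink (dd e (dd e₂ F) x) (E₃ x) • dd e₂ F x := by
    have h0 := h.mink_deriv (e := e) h.smooth_E₃ h.smooth h.ortho₀ hx
    have h1 := h.mink_deriv (e := e) h.smooth_E₃ h.smooth_dd₁ h.ortho₁ hx
    have h2 := h.mink_deriv (e := e) h.smooth_E₃ h.smooth_dd₂ h.ortho₂ hx
    have h3 : mink (E₃ x) (dd e F x) = 0 := by
      change mink (E₃ x) (fderiv ℝ F x (e x)) = 0
      rw [h.fderiv_eq F hx]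
      simp [h.ortho₁ x hx, h.ortho₂ x hx]
    rw [h3, add_zero] at h0
    rw [mink_comm (E₃ x)] at h1 h2
    rw [nor, h0, eq_neg_of_add_eq_zero_left h1, eq_neg_of_add_eq_zero_left h2] at hp
    rw [← sub_eq_zero, ← hp]
    module
  -- The second fundamental form is symmetric because the bracket of the frame is tangent, hence
  -- orthogonal to E₃.
  have sym : mink (dd e₂ (dd e₁ F) x) (E₃ x) = mink (dd e₁ (dd e₂ F) x) (E₃ x) := by
    have := congrArg (mink (E₃ x)) (h.comm h.smooth hx)
    simp only [mink_sub_right, mink_neg_right, mink_smul_right, h.ortho₁ x hx,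
      h.ortho₂ x hx] at this
    rw [mink_comm, mink_comm _ (E₃ x)]
    linarith
  refine ⟨key e₁ (h.parallel₁ x hx), ?_⟩
  rw [key e₂ (h.parallel₂ x hx), sym]

/-- The Codazzi equation for `E₃` and the biconservativity condition determine the shape operator
of `E₃`. -/
lemma shape_E₃ (hx : x ∈ Ω) :
    mink (dd e₁ (dd e₁ F) x) (E₃ x) = -f x ∧ mink (dd e₁ (dd e₂ F) x) (E₃ x) = 0 ∧
      mink (dd e₂ (dd e₂ F) x) (E₃ x) = 3 * f x := by
  -- The entries of the shape operator A₃ in the frame: p and r on the diagonal, q off it.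
  obtain ⟨p, hp⟩ : ∃ p : E2 → ℝ, p = fun y => mink (dd e₁ (dd e₁ F) y) (E₃ y) := ⟨_, rfl⟩
  obtain ⟨q, hq⟩ : ∃ q : E2 → ℝ, q = fun y => mink (dd e₁ (dd e₂ F) y) (E₃ y) := ⟨_, rfl⟩
  obtain ⟨r, hr⟩ : ∃ r : E2 → ℝ, r = fun y => mink (dd e₂ (dd e₂ F) y) (E₃ y) := ⟨_, rfl⟩
  have sp : ContDiffOn ℝ ∞ p Ω := hp ▸
    (contDiffOn_dd h.isOpen h.smooth₁ h.smooth_dd₁).mink h.smooth_E₃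
  have sq : ContDiffOn ℝ ∞ q Ω := hq ▸
    (contDiffOn_dd h.isOpen h.smooth₁ h.smooth_dd₂).mink h.smooth_E₃
  have sr : ContDiffOn ℝ ∞ r Ω := hr ▸
    (contDiffOn_dd h.isOpen h.smooth₂ h.smooth_dd₂).mink h.smooth_E₃
  have d1 : ∀ y ∈ Ω, dd e₁ E₃ y = -(p y • dd e₁ F y) - q y • dd e₂ F y := fun y hy => by
    rw [(h.deriv_E₃_aux hy).1, hp, hq]
  have d2 : ∀ y ∈ Ω, dd e₂ E₃ y = -(q y • dd e₁ F y) - r y • dd e₂ F y := fun y hy => by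
    rw [(h.deriv_E₃_aux hy).2, hq, hr]
  have tr : ∀ y ∈ Ω, p y + r y = 2 * f y := fun y hy => by
    have := congrArg (mink (E₃ y)) (h.trace y hy)
    simp only [nor, mink_add_right, mink_sub_right, mink_smul_right, h.ortho₀ y hy,
      h.ortho₁ y hy, h.ortho₂ y hy, h.unit₃ y hy] at this
    simp only [hp, hr, mink_comm _ (E₃ y)]
    linarith
  have fx := h.f_pos x hx
  have gx := h.grad_pos x hx
  have zx := h.grad_zero x hx
  have D {W : Type} [NormedAddCommGroup W] [NormedSpace ℝ W] {G : E2 → W}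
    (hG : ContDiffOn ℝ ∞ G Ω) (e : E2 → E2) : HasD (e x) G (dd e G x) x := hG.hasD h.isOpen hx e
  have tr' (e : E2 → E2) : dd e p x + dd e r x = 2 * dd e f x :=
    (((D sp e).add (D sr e)).congr_on h.isOpen hx fun y hy => (tr y hy).symm).unique
      (((HasD.const (2 : ℝ)).mul (D h.smooth_f e)).congr_eq (by ring))
  obtain ⟨r1, r2, r3, r4, r5, r6, r7, r8, r9⟩ := h.relations hx
  obtain ⟨u1, u2, u3, u4⟩ : mink (dd e₁ F x) (dd e₁ F x) = 1 ∧ mink (dd e₂ F x) (dd e₂ F x) = 1 ∧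
    mink (dd e₁ F x) (dd e₂ F x) = 0 ∧ mink (dd e₂ F x) (dd e₁ F x) = 0 :=
    ⟨h.unit₁ x hx, h.unit₂ x hx, h.ortho x hx, by rw [mink_comm]; exact h.ortho x hx⟩
  have s1 := h.ortho₁ x hx
  have s2 := h.ortho₂ x hx
  have d12 := (((((D sq e₁).smul (D h.smooth_dd₁ e₁)).neg).sub
    ((D sr e₁).smul (D h.smooth_dd₂ e₁))).congr_on h.isOpen hx d2).fderiv_eq
  have d21 := (((((D sp e₂).smul (D h.smooth_dd₁ e₂)).neg).sub
    ((D sq e₂).smul (D h.smooth_dd₂ e₂))).congr_on h.isOpen hx d1).fderiv_eq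
  have cod := h.comm h.smooth_E₃ hx
  change dd e₁ (dd e₂ E₃) x = _ at d12
  change dd e₂ (dd e₁ E₃) x = _ at d21
  rw [d12, d21, d1 x hx, d2 x hx] at cod
  have cod1 := congrArg (mink · (dd e₁ F x)) cod
  have cod2 := congrArg (mink · (dd e₂ F x)) cod
  simp only [mink_sub_left, mink_neg_left, mink_smul_left, mink_add_left, r7, r8, r9,
    u1, u2, u3, u4] at cod1 cod2
  have cdV (e : E2 → E2) (y : E2) (hy : y ∈ Ω) : cd F e (fun y => (2 * f y) • E₃ y) y =
      (2 * f y) • dd e E₃ y + (2 * dd e f y) • E₃ y := by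
    have e1 : dd e (fun y => (2 * f y) • E₃ y) y =
        (2 * f y) • dd e E₃ y + (2 * dd e f y) • E₃ y :=
      ((((HasD.const (2 : ℝ)).mul (h.smooth_f.hasD h.isOpen hy e)).smul
        (h.smooth_E₃.hasD h.isOpen hy e)).congr_eq (by simp)).fderiv_eq
    -- As E₃ is normal to the surface, its flat derivative has no component along F, so flat and
    -- covariant derivatives of 2fE₃ coincide.
    have e2 : mink (dd e E₃ y) (F y) = 0 := by
      have h0 := h.mink_deriv (e := e) h.smooth_E₃ h.smooth h.ortho₀ hy
      have h3 : mink (E₃ y) (dd e F y) = 0 := by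
        change mink (E₃ y) (fderiv ℝ F y (e y)) = 0
        rw [h.fderiv_eq F hy]
        simp [h.ortho₁ y hy, h.ortho₂ y hy]
      linarith
    rw [cd, e1]
    simp [e2, h.ortho₀ y hy]
  have c1 : ∀ y ∈ Ω, cd F e₁ (fun y => (2 * f y) • E₃ y) y =
      (2 * f y) • (-(p y • dd e₁ F y) - q y • dd e₂ F y) + (2 * dd e₁ f y) • E₃ y :=
    fun y hy => by rw [cdV e₁ y hy, d1 y hy]
  have c2 : ∀ y ∈ Ω, cd F e₂ (fun y => (2 * f y) • E₃ y) y =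
      (2 * f y) • (-(q y • dd e₁ F y) - r y • dd e₂ F y) :=
    fun y hy => by rw [cdV e₂ y hy, d2 y hy, h.grad_zero y hy]; simp
  have c11 := ((((HasD.const (2 : ℝ)).mul (D h.smooth_f e₁)).smul
    (((D sp e₁).smul (D h.smooth_dd₁ e₁)).neg.sub ((D sq e₁).smul (D h.smooth_dd₂ e₁)))).add
    (((HasD.const (2 : ℝ)).mul (D (contDiffOn_dd h.isOpen h.smooth₁ h.smooth_f) e₁)).smul
      (D h.smooth_E₃ e₁))).congr_on h.isOpen hx c1 |>.fderiv_eq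
  have c22 := (((HasD.const (2 : ℝ)).mul (D h.smooth_f e₂)).smul
    (((D sq e₂).smul (D h.smooth_dd₁ e₂)).neg.sub ((D sr e₂).smul (D h.smooth_dd₂ e₂)))).congr_on
      h.isOpen hx c2 |>.fderiv_eq
  have b1 := h.bicons x hx (e₁ x)
  have b2 := h.bicons x hx (e₂ x)
  change mink _ (dd e₁ F x) = 0 at b1
  change mink _ (dd e₂ F x) = 0 at b2
  rw [c1 x hx, c2 x hx, cd, cd] at b1 b2
  change dd e₁ (cd F e₁ fun y => (2 * f y) • E₃ y) x = _ at c11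
  change dd e₂ (cd F e₂ fun y => (2 * f y) • E₃ y) x = _ at c22
  rw [c11, c22] at b1 b2
  rw [mink_comm] at r1 r2
  simp only [mink_sub_left, mink_neg_left, mink_smul_left, mink_add_left, r1, r2, r7, r8, r9,
    u1, u2, u3, u4, s1, s2, zx, d1 x hx] at b1 b2
  have t1 := tr' e₁
  have t2 := tr' e₂
  have t0 := tr x hx
  rw [zx] at t2
  -- The Codazzi equation and the trace turn div A₃ into 2 grad f. The tangential part of the trace
  -- of ∇∇(2fE₃) is then −4(A₃ grad f + f grad f), and `k1` and `k2` are its two components.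
  have k1 : dd e₁ f x * (p x + f x) = 0 := by
    linear_combination -(1 / 4) * (b1 + 2 * f x * cod2 + 2 * f x * t1)
  have k2 : dd e₁ f x * q x = 0 := by
    linear_combination -(1 / 4) * (b2 - 2 * f x * cod1 + 2 * f x * t2)
  have k1' := (mul_eq_zero.1 k1).resolve_left gx.ne'
  have k2' := (mul_eq_zero.1 k2).resolve_left gx.ne'
  subst hp hq hr
  exact ⟨by linarith, k2', by linarith⟩

lemma deriv₁_E₃ (hx : x ∈ Ω) : dd e₁ E₃ x = f x • dd e₁ F x := by
  rw [(h.deriv_E₃_aux hx).1, (h.shape_E₃ hx).1, (h.shape_E₃ hx).2.1]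
  module

lemma deriv₂_E₃ (hx : x ∈ Ω) : dd e₂ E₃ x = (-3 * f x) • dd e₂ F x := by
  rw [(h.deriv_E₃_aux hx).2, (h.shape_E₃ hx).2.2, (h.shape_E₃ hx).2.1]
  module

/-- Commuting the derivatives of E₃ with A₃ = diag(−f, 3f) gives everything: the eigenvalues differ
by 4f, and dividing by this yields both values of the connection form from the tangential part, and
B(e₁,e₂) = 0 from the normal part. -/
lemma deriv_frame (hx : x ∈ Ω) :
    dd e₁ (dd e₁ F) x = perp F e₁ f E₃ x - f x • E₃ x + F x ∧
    dd e₂ (dd e₁ F) x = conn e₁ f x • dd e₂ F x ∧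
    dd e₁ (dd e₂ F) x = 0 ∧
    dd e₂ (dd e₂ F) x =
      -(conn e₁ f x • dd e₁ F x) + (3 * f x) • E₃ x - perp F e₁ f E₃ x + F x := by
  have fx := h.f_pos x hx
  have zx := h.grad_zero x hx
  have D {W : Type} [NormedAddCommGroup W] [NormedSpace ℝ W] {G : E2 → W}
    (hG : ContDiffOn ℝ ∞ G Ω) (e : E2 → E2) : HasD (e x) G (dd e G x) x := hG.hasD h.isOpen hx e
  have d12 := (((HasD.const (-3 : ℝ)).mul (D h.smooth_f e₁)).smul
    (D h.smooth_dd₂ e₁)).congr_on h.isOpen hx (fun y hy => h.deriv₂_E₃ hy) |>.fderiv_eq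
  have d21 := ((D h.smooth_f e₂).smul
    (D h.smooth_dd₁ e₂)).congr_on h.isOpen hx (fun y hy => h.deriv₁_E₃ hy) |>.fderiv_eq
  change dd e₁ (dd e₂ E₃) x = _ at d12
  change dd e₂ (dd e₁ E₃) x = _ at d21
  have cod := h.comm h.smooth_E₃ hx
  rw [d12, d21, h.deriv₁_E₃ hx, h.deriv₂_E₃ hx, zx] at cod
  have comF := h.comm h.smooth hx
  obtain ⟨r1, r2, r3, r4, r5, r6, r7, r8, r9⟩ := h.relations hx
  obtain ⟨u1, u2, u3, u4⟩ : mink (dd e₁ F x) (dd e₁ F x) = 1 ∧ mink (dd e₂ F x) (dd e₂ F x) = 1 ∧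
    mink (dd e₁ F x) (dd e₂ F x) = 0 ∧ mink (dd e₂ F x) (dd e₁ F x) = 0 :=
    ⟨h.unit₁ x hx, h.unit₂ x hx, h.ortho x hx, by rw [mink_comm]; exact h.ortho x hx⟩
  have cod1 := congrArg (mink · (dd e₁ F x)) cod
  have cod2 := congrArg (mink · (dd e₂ F x)) cod
  simp only [mink_sub_left, mink_neg_left, mink_smul_left, mink_add_left, r7, r8, r9,
    u1, u2, u3, u4] at cod1 cod2
  have w1 : mink (dd e₁ (dd e₁ F) x) (dd e₂ F x) = 0 := by
    have : f x * mink (dd e₁ (dd e₁ F) x) (dd e₂ F x) = 0 := by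
      linear_combination (1 / 4) * cod1
    exact (mul_eq_zero.1 this).resolve_left fx.ne'
  have w2 : mink (dd e₂ (dd e₁ F) x) (dd e₂ F x) = conn e₁ f x := by
    rw [conn]
    field_simp
    linear_combination - cod2
  rw [w1, w2] at comF cod
  have hf : dd e₁ f x = -(4 / 3) * (f x * conn e₁ f x) := by
    rw [conn]
    field_simp
  -- The normal component is the Ricci equation: all shape operators commute with A₃, whose
  -- eigenvalues are distinct, so e₁, e₂ diagonalize the whole second fundamental form.
  have k2 : dd e₂ (dd e₁ F) x = conn e₁ f x • dd e₂ F x := by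
    have e1 : (4 * f x) • dd e₂ (dd e₁ F) x = (4 * f x) • (conn e₁ f x • dd e₂ F x) := by
      rw [sub_eq_iff_eq_add] at comF
      rw [comF, hf] at cod
      linear_combination (norm := module) (-1 : ℝ) • cod
    exact smul_right_injective _ (by positivity) e1
  have k1 : dd e₁ (dd e₂ F) x = 0 := by
    rw [k2] at comF
    linear_combination (norm := module) comF
  refine ⟨by rw [perp]; module, k2, k1, ?_⟩
  have tr := h.trace x hx
  simp only [nor, r3, r4, r7, r8, r9, w1, w2] at tr
  rw [perp]
  linear_combination (norm := module) tr

lemma perp_ortho (hx : x ∈ Ω) :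
    mink (perp F e₁ f E₃ x) (F x) = 0 ∧ mink (perp F e₁ f E₃ x) (dd e₁ F x) = 0 ∧
      mink (perp F e₁ f E₃ x) (dd e₂ F x) = 0 ∧ mink (perp F e₁ f E₃ x) (E₃ x) = 0 := by
  obtain ⟨r1, r2, r3, r4, r5, r6, r7, r8, r9⟩ := h.relations hx
  have w1 := r9 e₁
  rw [(h.deriv_frame hx).2.2.1, mink_zero_left] at w1
  simp only [perp, mink_add_left, mink_sub_left, mink_smul_left, r3, r7, h.hyp x hx,
    h.ortho₀ x hx, h.ortho₁ x hx, h.ortho₂ x hx, h.unit₃ x hx, mink_comm (F x), r1, r2,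
    (h.shape_E₃ hx).1]
  refine ⟨by ring, by ring, by linarith, by ring⟩

lemma perp_nonneg (hx : x ∈ Ω) : 0 ≤ mink (perp F e₁ f E₃ x) (perp F e₁ f E₃ x) :=
  mink_self_nonneg (h.hyp x hx) (h.perp_ortho hx).1

/-- The Gauss equation, and the Codazzi equation for the component of the second fundamental form
orthogonal to the mean curvature vector. -/
lemma deriv_perp (hx : x ∈ Ω) :
    dd e₁ (perp F e₁ f E₃) x =
      -(mink (perp F e₁ f E₃ x) (perp F e₁ f E₃ x) • dd e₁ F x) -
        (2 * conn e₁ f x) • perp F e₁ f E₃ x ∧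
    dd e₂ (perp F e₁ f E₃) x = mink (perp F e₁ f E₃ x) (perp F e₁ f E₃ x) • dd e₂ F x ∧
    dd e₁ (conn e₁ f) x =
      1 + 3 * f x ^ 2 + mink (perp F e₁ f E₃ x) (perp F e₁ f E₃ x) - conn e₁ f x ^ 2 ∧
    dd e₂ (conn e₁ f) x = 0 := by
  have fx := h.f_pos x hx
  have D {W : Type} [NormedAddCommGroup W] [NormedSpace ℝ W] {G : E2 → W}
    (hG : ContDiffOn ℝ ∞ G Ω) (e : E2 → E2) : HasD (e x) G (dd e G x) x := hG.hasD h.isOpen hx e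
  obtain ⟨k1, k2, k3, k4⟩ := h.deriv_frame hx
  have cm {W : Type} [NormedAddCommGroup W] [NormedSpace ℝ W] {G : E2 → W}
      (hG : ContDiffOn ℝ ∞ G Ω) :
      dd e₁ (dd e₂ G) x - dd e₂ (dd e₁ G) x = -(conn e₁ f x • dd e₂ G x) := by
    rw [h.comm hG hx, k1, k2]
    simp only [mink_smul_left, h.unit₂ x hx, mink_add_left, mink_sub_left,
      (h.perp_ortho hx).2.2.1, h.ortho₂ x hx, mink_comm (F x), (h.relations hx).2.1]
    module
  obtain ⟨n, hn⟩ : ∃ n : E2 → R51, n = perp F e₁ f E₃ := ⟨_, rfl⟩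
  obtain ⟨w, hw⟩ : ∃ w : E2 → ℝ, w = conn e₁ f := ⟨_, rfl⟩
  have sn := h.smooth_perp
  have sw := h.smooth_conn
  have po := h.perp_ortho hx
  have hf : dd e₁ f x = -(4 / 3) * (f x * w x) := by
    rw [hw, conn]
    field_simp
  have d1 : ∀ y ∈ Ω, dd e₁ (dd e₁ F) y = n y - f y • E₃ y + F y := fun y hy => by
    rw [hn]; exact (h.deriv_frame hy).1
  have d2 : ∀ y ∈ Ω, dd e₂ (dd e₁ F) y = w y • dd e₂ F y := fun y hy => by
    rw [hw]; exact (h.deriv_frame hy).2.1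
  have d3 : ∀ y ∈ Ω, dd e₁ (dd e₂ F) y = 0 := fun y hy => (h.deriv_frame hy).2.2.1
  have d4 : ∀ y ∈ Ω, dd e₂ (dd e₂ F) y = -(w y • dd e₁ F y) + (3 * f y) • E₃ y - n y + F y :=
    fun y hy => by rw [hw, hn]; exact (h.deriv_frame hy).2.2.2
  rw [← hn] at sn po ⊢
  rw [← hw] at sw cm ⊢
  have a21 := ((D sw e₁).smul (D h.smooth_dd₂ e₁)).congr_on h.isOpen hx d2 |>.fderiv_eq
  have a11 := (((D sn e₂).sub ((D h.smooth_f e₂).smul (D h.smooth_E₃ e₂))).add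
    (D h.smooth e₂)).congr_on h.isOpen hx d1 |>.fderiv_eq
  have a12 := (HasD.const (v := e₂ x) (0 : R51)).congr_on h.isOpen hx d3 |>.fderiv_eq
  have a22 := (((D sw e₁).smul (D h.smooth_dd₁ e₁)).neg.add
    ((((HasD.const (3 : ℝ)).mul (D h.smooth_f e₁)).smul (D h.smooth_E₃ e₁))) |>.sub
    (D sn e₁) |>.add (D h.smooth e₁)).congr_on h.isOpen hx d4 |>.fderiv_eq
  -- Commuting derivatives of e₁F gives the Gauss equation and the e₂-derivative of n; commuting
  -- those of e₂F gives its e₁-derivative; commuting those of f shows that the connection form is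
  -- constant along e₂.
  have c1 := cm h.smooth_dd₁
  have c2 := cm h.smooth_dd₂
  have cf := cm h.smooth_f
  change dd e₁ (dd e₂ (dd e₁ F)) x = _ at a21
  change dd e₂ (dd e₁ (dd e₁ F)) x = _ at a11
  change dd e₂ (dd e₁ (dd e₂ F)) x = _ at a12
  change dd e₁ (dd e₂ (dd e₂ F)) x = _ at a22
  rw [a21, a11, h.grad_zero x hx, d3 x hx, d2 x hx, h.deriv₂_E₃ hx] at c1
  rw [a22, a12, d1 x hx, d4 x hx, h.deriv₁_E₃ hx, hf] at c2
  have nE2 := h.mink_deriv (e := e₂) (hn ▸ sn) h.smooth_dd₂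
    (fun y hy => (h.perp_ortho hy).2.2.1) hx
  rw [← hn, d4 x hx] at nE2
  simp only [mink_add_right, mink_sub_right, mink_neg_right, mink_smul_right, po] at nE2
  -- Since n is orthogonal to e₂F, differentiating along e₂ gives ⟨e₂n, e₂F⟩ = |n|². With this the
  -- e₂F-component of `c1` is the Gauss equation.
  have g0 : dd e₁ w x = 1 + 3 * f x ^ 2 + mink (n x) (n x) - w x ^ 2 := by
    have := congrArg (mink · (dd e₂ F x)) c1
    simp only [mink_add_left, mink_sub_left, mink_neg_left, mink_smul_left, h.unit₂ x hx,
      mink_zero_left, h.ortho₂ x hx] at this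
    linear_combination this + nE2
  rw [g0] at c1 c2
  refine ⟨?_, ?_, g0, ?_⟩
  · linear_combination (norm := module) -c2
  · linear_combination (norm := module) -c1
  · have e1 : dd e₁ (dd e₂ f) x = 0 :=
      (HasD.const (v := e₁ x) (0 : ℝ)).congr_on h.isOpen hx h.grad_zero |>.fderiv_eq
    rw [e1, h.grad_zero x hx] at cf
    have e2 := ((HasD.const (v := e₂ x) (-(3 / 4) : ℝ)).mul
      ((D (contDiffOn_dd h.isOpen h.smooth₁ h.smooth_f) e₂).div (D h.smooth_f e₂)
        fx.ne')).fderiv_eq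
    rw [hw]
    refine e2.trans ?_
    rw [h.grad_zero x hx]
    simp only [smul_zero, neg_zero, zero_sub, neg_eq_zero] at cf
    simp [cf]

lemma deriv₁_f (hx : x ∈ Ω) : dd e₁ f x = -(4 / 3) * (f x * conn e₁ f x) := by
  have := h.f_pos x hx
  rw [conn]
  field_simp

/-- A smooth function with vanishing derivatives along the frame is locally constant. -/
lemma fderiv_eq_zero {W : Type*} [NormedAddCommGroup W] [NormedSpace ℝ W] {G : E2 → W}
    (hx : x ∈ Ω) (h₁ : dd e₁ G x = 0) (h₂ : dd e₂ G x = 0) : fderiv ℝ G x = 0 := by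
  ext v
  rw [h.fderiv_eq G hx, h₁, h₂]
  simp

end IsAdapted

end PNMC

end

/-! ### The two first integrals, and the degenerate case n = 0 -/

noncomputable section

namespace PNMC

variable {Ω : Set E2} {F E₃ : E2 → R51} {e₁ e₂ : E2 → E2} {f : E2 → ℝ} {x : E2}

lemma HasD.rpow_const {E : Type*} [NormedAddCommGroup E] [NormedSpace ℝ E] {v x : E}
    {g : E → ℝ} {g' : ℝ} (h : HasD v g g' x) (h0 : 0 < g x) (a : ℝ) :
    HasD v (fun y => g y ^ a) (a * g x ^ a * (g' / g x)) x := by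
  refine (HasD.comp_hasDerivAt (Real.hasDerivAt_rpow_const (p := a) (Or.inl h0.ne')) h).congr_eq ?_
  rw [Real.rpow_sub_one h0.ne', smul_eq_mul]
  ring

lemma rpow_three_halves_sq {r : ℝ} (hr : 0 ≤ r) : (r ^ (3 / 2 : ℝ)) ^ 2 = r ^ 3 := by
  rw [← Real.rpow_natCast, ← Real.rpow_mul hr, ← Real.rpow_natCast]
  norm_num

namespace IsAdapted

variable (h : IsAdapted Ω F e₁ e₂ f E₃)
include h

/-- Both quotients `A` and `B` have zero derivative along the frame: |n|² scales as f³ because its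
logarithmic derivative is −4ω against −(4/3)ω for f, and the equation for ω makes ω² − 1 + 9f² +
|n|² scale as f^(3/2). At this stage c may still be zero. -/
lemma exists_constants (hc : IsPreconnected Ω) (hx : x ∈ Ω) : ∃ c C : ℝ, 0 ≤ c ∧ ∀ y ∈ Ω,
    mink (perp F e₁ f E₃ y) (perp F e₁ f E₃ y) = c ^ 2 * f y ^ 3 ∧
      conn e₁ f y ^ 2 = radicand c C (f y) := by
  obtain ⟨n, hn⟩ : ∃ n : E2 → R51, n = perp F e₁ f E₃ := ⟨_, rfl⟩
  obtain ⟨w, hw⟩ : ∃ w : E2 → ℝ, w = conn e₁ f := ⟨_, rfl⟩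
  have sn : ContDiffOn ℝ ∞ n Ω := hn ▸ h.smooth_perp
  have sw : ContDiffOn ℝ ∞ w Ω := hw ▸ h.smooth_conn
  have D {W : Type} [NormedAddCommGroup W] [NormedSpace ℝ W] {G : E2 → W} {y : E2} (hy : y ∈ Ω)
    (hG : ContDiffOn ℝ ∞ G Ω) (e : E2 → E2) : HasD (e y) G (dd e G y) y := hG.hasD h.isOpen hy e
  have nn1 {y : E2} (hy : y ∈ Ω) : HasD (e₁ y) (fun z => mink (n z) (n z))
      (-4 * w y * mink (n y) (n y)) y := by
    refine ((D hy sn e₁).mink (D hy sn e₁)).congr_eq ?_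
    rw [mink_comm (n y), hn, (h.deriv_perp hy).1, hw]
    simp only [mink_sub_left, mink_neg_left, mink_smul_left, mink_comm (dd e₁ F y),
      h.perp_ortho hy]
    ring
  have nn2 {y : E2} (hy : y ∈ Ω) : HasD (e₂ y) (fun z => mink (n z) (n z)) 0 y := by
    refine ((D hy sn e₂).mink (D hy sn e₂)).congr_eq ?_
    rw [mink_comm (n y), hn, (h.deriv_perp hy).2.1]
    simp only [mink_smul_left, mink_comm (dd e₂ F y), h.perp_ortho hy]
    ring
  have f1 {y : E2} (hy : y ∈ Ω) : HasD (e₁ y) f (-(4 / 3) * (f y * w y)) y := by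
    rw [hw, ← h.deriv₁_f hy]
    exact D hy h.smooth_f e₁
  have f2 {y : E2} (hy : y ∈ Ω) : HasD (e₂ y) f 0 y := by
    rw [← h.grad_zero y hy]
    exact D hy h.smooth_f e₂
  have w1 {y : E2} (hy : y ∈ Ω) : HasD (e₁ y) w
      (1 + 3 * f y ^ 2 + mink (n y) (n y) - w y ^ 2) y := by
    rw [hw, hn, ← (h.deriv_perp hy).2.2.1]
    exact D hy h.smooth_conn e₁
  have w2 {y : E2} (hy : y ∈ Ω) : HasD (e₂ y) w 0 y := by
    rw [hw, ← (h.deriv_perp hy).2.2.2]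
    exact D hy h.smooth_conn e₂
  have const (G : E2 → ℝ) (h1 : ∀ y ∈ Ω, HasD (e₁ y) G 0 y) (h2 : ∀ y ∈ Ω, HasD (e₂ y) G 0 y) :
      ∀ y ∈ Ω, G y = G x := fun y hy =>
    h.isOpen.is_const_of_fderiv_eq_zero hc
      (fun z hz => (h1 z hz).differentiableAt.differentiableWithinAt)
      (fun z hz => h.fderiv_eq_zero hz (h1 z hz).fderiv_eq (h2 z hz).fderiv_eq) hy hx
  have fp {y : E2} (hy : y ∈ Ω) : f y ^ (3 / 2 : ℝ) ≠ 0 := (Real.rpow_pos_of_pos (h.f_pos y hy) _).ne'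
  have A := const (fun y => mink (n y) (n y) / f y ^ 3)
    (fun y hy => ((nn1 hy).div ((f1 hy).pow 3) (pow_pos (h.f_pos y hy) 3).ne').congr_eq (by
      have := h.f_pos y hy
      push_cast
      ring))
    (fun y hy => ((nn2 hy).div ((f2 hy).pow 3) (pow_pos (h.f_pos y hy) 3).ne').congr_eq (by simp))
  have B := const (fun y => (w y ^ 2 - 1 + 9 * f y ^ 2 + mink (n y) (n y)) /
      (9 * f y ^ (3 / 2 : ℝ)))
    (fun y hy => (((((w1 hy).pow 2).sub (HasD.const 1)).add ((HasD.const 9).mul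
      ((f1 hy).pow 2)) |>.add (nn1 hy)).div ((HasD.const 9).mul ((f1 hy).rpow_const (h.f_pos y hy)
        (3 / 2))) (mul_ne_zero (by norm_num) (fp hy))).congr_eq (by
      have := h.f_pos y hy
      have := fp hy
      field_simp
      push_cast
      ring))
    (fun y hy => (((((w2 hy).pow 2).sub (HasD.const 1)).add ((HasD.const 9).mul
      ((f2 hy).pow 2)) |>.add (nn2 hy)).div ((HasD.const 9).mul ((f2 hy).rpow_const (h.f_pos y hy)
        (3 / 2))) (mul_ne_zero (by norm_num) (fp hy))).congr_eq (by simp))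
  have pos : 0 ≤ mink (n x) (n x) / f x ^ 3 :=
    div_nonneg (hn ▸ h.perp_nonneg hx) (pow_pos (h.f_pos x hx) 3).le
  refine ⟨√(mink (n x) (n x) / f x ^ 3), (w x ^ 2 - 1 + 9 * f x ^ 2 + mink (n x) (n x)) /
      (9 * f x ^ (3 / 2 : ℝ)), Real.sqrt_nonneg _, fun y hy => ?_⟩
  rw [radicand, Real.sq_sqrt pos, ← A y hy, ← B y hy, ← hn, ← hw]
  have := h.f_pos y hy
  have := fp hy
  constructor
  · field_simp
  · field_simp
    ring

/-- If the second fundamental form takes values in the multiples of `E₃`, the surface lies in a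
totally geodesic hypersurface. -/
lemma exists_orthogonal (hc : IsPreconnected Ω) (hx : x ∈ Ω)
    (h0 : ∀ y ∈ Ω, perp F e₁ f E₃ y = 0) :
    ∃ n : R51, 0 < mink n n ∧ ∀ y ∈ Ω, mink (F y) n = 0 := by
  obtain ⟨T, hT⟩ : ∃ T : R51 →ₗ[ℝ] (Fin 4 → ℝ), ∀ v, T v =
      ![mink v (F x), mink v (dd e₁ F x), mink v (dd e₂ F x), mink v (E₃ x)] :=
    ⟨{ toFun := fun v => ![mink v (F x), mink v (dd e₁ F x), mink v (dd e₂ F x), mink v (E₃ x)]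
       map_add' := fun v w => by simp
       map_smul' := fun r v => by simp }, fun v => rfl⟩
  -- Four linear conditions on a five-dimensional space leave a nonzero vector orthogonal to F, e₁F,
  -- e₂F and E₃ at the base point.
  have hker : LinearMap.ker T ≠ ⊥ := LinearMap.ker_ne_bot_of_finrank_lt (by simp)
  obtain ⟨n, hn, hn0⟩ := (Submodule.ne_bot_iff _).1 hker
  rw [LinearMap.mem_ker, hT] at hn
  have n0 : mink n (F x) = 0 := congrFun hn 0
  have n1 : mink n (dd e₁ F x) = 0 := congrFun hn 1
  have n2 : mink n (dd e₂ F x) = 0 := congrFun hn 2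
  have n3 : mink n (E₃ x) = 0 := congrFun hn 3
  -- `P` is the orthogonal projection of the fixed vector onto the span of F, e₁F, e₂F, E₃, with a
  -- minus sign at the timelike F. When the `perp` component vanishes this span is parallel in ℝ⁵₁,
  -- so `P` is constant, and it vanishes at the base point.
  obtain ⟨P, hP⟩ : ∃ P : E2 → R51, P = fun y => -(mink n (F y) • F y) +
      mink n (dd e₁ F y) • dd e₁ F y + mink n (dd e₂ F y) • dd e₂ F y +
      mink n (E₃ y) • E₃ y := ⟨_, rfl⟩
  have D {W : Type} [NormedAddCommGroup W] [NormedSpace ℝ W] {G : E2 → W} {y : E2} (hy : y ∈ Ω)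
    (hG : ContDiffOn ℝ ∞ G Ω) (e : E2 → E2) : HasD (e y) G (dd e G y) y := hG.hasD h.isOpen hy e
  have dP (e : E2 → E2) (y : E2) (hy : y ∈ Ω) := hP ▸ (((((HasD.const n).mink
    (D hy h.smooth e)).smul (D hy h.smooth e)).neg.add (((HasD.const n).mink
    (D hy h.smooth_dd₁ e)).smul (D hy h.smooth_dd₁ e))).add (((HasD.const n).mink
    (D hy h.smooth_dd₂ e)).smul (D hy h.smooth_dd₂ e))).add (((HasD.const n).mink
    (D hy h.smooth_E₃ e)).smul (D hy h.smooth_E₃ e))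
  have key : ∀ y ∈ Ω, P y = P x := fun y hy => by
    refine h.isOpen.is_const_of_fderiv_eq_zero (𝕜 := ℝ) hc
      (fun z hz => (dP e₁ z hz).differentiableAt.differentiableWithinAt)
      (fun z hz => h.fderiv_eq_zero hz ?_ ?_) hy hx
    · refine (dP e₁ z hz).fderiv_eq.trans ?_
      obtain ⟨k1, k2, k3, k4⟩ := h.deriv_frame hz
      rw [k1, k3, h.deriv₁_E₃ hz, h0 z hz]
      simp only [mink_zero_left, mink_zero_right, mink_add_right, mink_sub_right, mink_smul_right]
      module
    · refine (dP e₂ z hz).fderiv_eq.trans ?_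
      obtain ⟨k1, k2, k3, k4⟩ := h.deriv_frame hz
      rw [k2, k4, h.deriv₂_E₃ hz, h0 z hz]
      simp only [mink_zero_left, mink_zero_right, mink_add_right, mink_sub_right, mink_smul_right,
        mink_neg_right]
      module
  have Px : P x = 0 := by
    rw [hP]
    simp [n0, n1, n2, n3]
  refine ⟨n, mink_self_pos (h.hyp x hx) n0 hn0, fun y hy => ?_⟩
  have := congrArg (mink · (F y)) ((key y hy).trans Px)
  simp only [hP, mink_add_left, mink_neg_left, mink_smul_left, h.hyp y hy, (h.relations hy).1,
    (h.relations hy).2.1, h.ortho₀ y hy, mink_zero_left] at this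
  rw [mink_comm]
  linarith

end IsAdapted

end PNMC

end

noncomputable section

namespace PNMC

variable {Ω : Set E2} {F E₃ : E2 → R51} {e₁ e₂ : E2 → E2} {f : E2 → ℝ} {x : E2}

/-! ### Coordinate expressions in terms of an orthonormal frame -/

section nor

variable (X A₁ A₂ V W : R51) (r : ℝ)

lemma nor_add : nor X A₁ A₂ (V + W) = nor X A₁ A₂ V + nor X A₁ A₂ W := by
  simp only [nor, mink_add_left]; module

lemma nor_smul : nor X A₁ A₂ (r • V) = r • nor X A₁ A₂ V := by
  simp only [nor, mink_smul_left]; module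

end nor

lemma fderiv_eq_pd {W : Type*} [NormedAddCommGroup W] [NormedSpace ℝ W] (G : E2 → W) (x v : E2) :
    fderiv ℝ G x v = v 0 • pd 0 G x + v 1 • pd 1 G x := by
  have hv : v = v 0 • EuclideanSpace.single 0 1 + v 1 • EuclideanSpace.single 1 1 := by
    ext i; fin_cases i <;> simp
  conv_lhs => rw [hv]
  rw [map_add, map_smul, map_smul]
  rfl

lemma contDiffOn_pd {W : Type*} [NormedAddCommGroup W] [NormedSpace ℝ W] {G : E2 → W}
    (hΩ : IsOpen Ω) (hG : ContDiffOn ℝ ∞ G Ω) (i : Fin 2) : ContDiffOn ℝ ∞ (pd i G) Ω :=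
  contDiffOn_dd hΩ contDiffOn_const hG

/-- `v₁, v₂` is an orthonormal basis at `x` for the metric induced by the immersion `F` of a
neighbourhood of `x` in `ℍ⁴`. -/
structure IsOrthoAt (F : E2 → R51) (x v₁ v₂ : E2) : Prop where
  exists_smooth : ∃ Ω, IsOpen Ω ∧ x ∈ Ω ∧ ContDiffOn ℝ ∞ F Ω ∧ ∀ y ∈ Ω, mink (F y) (F y) = -1
  unit₁ : mink (fderiv ℝ F x v₁) (fderiv ℝ F x v₁) = 1
  unit₂ : mink (fderiv ℝ F x v₂) (fderiv ℝ F x v₂) = 1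
  ortho : mink (fderiv ℝ F x v₁) (fderiv ℝ F x v₂) = 0

lemma IsFrame.isOrthoAt (h : IsFrame Ω F e₁ e₂) (hx : x ∈ Ω) : IsOrthoAt F x (e₁ x) (e₂ x) :=
  ⟨⟨Ω, h.isOpen, hx, h.smooth, h.hyp⟩, h.unit₁ x hx, h.unit₂ x hx, h.ortho x hx⟩

namespace IsOrthoAt

variable {v₁ v₂ : E2} (h : IsOrthoAt F x v₁ v₂)
include h

lemma hyp : mink (F x) (F x) = -1 :=
  let ⟨_, _, hx, _, h⟩ := h.exists_smooth; h x hx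

lemma mink_self (v : E2) : mink (fderiv ℝ F x v) (F x) = 0 := by
  obtain ⟨Ω, hΩ, hx, hF, hh⟩ := h.exists_smooth
  have d := hF.hasD hΩ hx (fun _ => v)
  have := (d.mink d).unique ((HasD.const (-1 : ℝ)).congr_on hΩ hx hh)
  rw [mink_comm (F x)] at this
  change mink (dd (fun _ => v) F x) (F x) = 0
  linarith

lemma invMetric_eq (i j : Fin 2) : invMetric F x i j = v₁ i * v₁ j + v₂ i * v₂ j := by
  have h1 := h.unit₁
  have h2 := h.unit₂
  have h3 := h.ortho
  simp only [fderiv_eq_pd F x, mink_add_left, mink_add_right, mink_smul_left,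
    mink_smul_right] at h1 h2 h3
  have h4 := mink_comm (pd 0 F x) (pd 1 F x)
  rw [h4] at h1 h2 h3
  obtain ⟨P, hP⟩ : ∃ P : Matrix (Fin 2) (Fin 2) ℝ, P = !![v₁ 0, v₂ 0; v₁ 1, v₂ 1] := ⟨_, rfl⟩
  have e1 : P.transpose * (metric F x * P) = 1 := by
    ext a b
    -- Orthonormality says Pᵀ g P = 1 for the matrix `P` with columns v₁, v₂, whence g⁻¹ = P Pᵀ.
    fin_cases a <;> fin_cases b <;>
      simp [hP, Matrix.mul_apply, Fin.sum_univ_two, metric, h4] <;> linarith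
  have e2 : metric F x * (P * P.transpose) = 1 := by
    rw [← Matrix.mul_assoc]
    exact mul_eq_one_comm.1 e1
  rw [invMetric, Matrix.inv_eq_right_inv e2, hP]
  fin_cases i <;> fin_cases j <;> simp [Matrix.mul_apply, Fin.sum_univ_two]

lemma pd_pd (i j : Fin 2) : pd i (pd j F) x =
    fderiv ℝ (fderiv ℝ F) x (EuclideanSpace.single i 1) (EuclideanSpace.single j 1) := by
  obtain ⟨Ω, hΩ, hx, hF, hh⟩ := h.exists_smooth
  have := (hasD_dd hΩ hx (e := fun _ => EuclideanSpace.single j 1) contDiffOn_const hF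
    (EuclideanSpace.single i 1)).fderiv_eq
  refine Eq.trans this ?_
  simp

lemma pd_pd_comm (i j : Fin 2) : pd i (pd j F) x = pd j (pd i F) x := by
  rw [h.pd_pd, h.pd_pd]
  obtain ⟨Ω, hΩ, hx, hF, hh⟩ := h.exists_smooth
  exact snd_fderiv_symm hΩ hx hF _ _

lemma snd_fderiv_eq (v w : E2) : fderiv ℝ (fderiv ℝ F) x v w =
    v 0 • w 0 • pd 0 (pd 0 F) x + v 0 • w 1 • pd 0 (pd 1 F) x + v 1 • w 0 • pd 1 (pd 0 F) x +
      v 1 • w 1 • pd 1 (pd 1 F) x := by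
  simp only [h.pd_pd]
  have hv (v : E2) : v = v 0 • EuclideanSpace.single 0 1 + v 1 • EuclideanSpace.single 1 1 := by
    ext i; fin_cases i <;> simp
  conv_lhs => rw [hv v, hv w]
  simp only [map_add, map_smul, add_apply, smul_apply]
  module

lemma pd_metric (i j l : Fin 2) : pd i (fun y => metric F y j l) x =
    mink (pd i (pd j F) x) (pd l F x) + mink (pd j F x) (pd i (pd l F) x) := by
  obtain ⟨Ω, hΩ, hx, hF, hh⟩ := h.exists_smooth
  exact (((contDiffOn_pd hΩ hF j).hasD hΩ hx (fun _ => EuclideanSpace.single i 1)).mink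
    ((contDiffOn_pd hΩ hF l).hasD hΩ hx (fun _ => EuclideanSpace.single i 1))).fderiv_eq

/-- For a metric induced from a flat space the mixed terms cancel, and the Christoffel symbols of
the first kind are ⟨∂ᵢ∂ⱼF, ∂ₗF⟩. Raising the index with the orthonormal basis gives the coefficients
of the tangential part of ∂ᵢ∂ⱼF. -/
lemma christoffel_eq (k i j : Fin 2) : christoffel F k i j x =
    v₁ k * mink (pd i (pd j F) x) (fderiv ℝ F x v₁) +
      v₂ k * mink (pd i (pd j F) x) (fderiv ℝ F x v₂) := by
  have key (l : Fin 2) : pd i (fun y => metric F y j l) x + pd j (fun y => metric F y i l) x -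
      pd l (fun y => metric F y i j) x = 2 * mink (pd i (pd j F) x) (pd l F x) := by
    simp only [h.pd_metric]
    rw [h.pd_pd_comm j i, h.pd_pd_comm l i, h.pd_pd_comm l j, mink_comm (pd j F x),
      mink_comm (pd i F x)]
    ring
  simp only [christoffel, key, Fin.sum_univ_two, h.invMetric_eq, fderiv_eq_pd F x,
    mink_add_right, mink_smul_right]
  ring

lemma tangential_eq (V : R51) :
    ∑ k, ∑ l, (invMetric F x k l * mink V (pd k F x)) • pd l F x =
      mink V (fderiv ℝ F x v₁) • fderiv ℝ F x v₁ + mink V (fderiv ℝ F x v₂) • fderiv ℝ F x v₂ := by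
  simp only [Fin.sum_univ_two, h.invMetric_eq, fderiv_eq_pd F x, mink_add_right, mink_smul_right]
  module

lemma secondFF_eq (i j : Fin 2) : secondFF F i j x =
    nor (F x) (fderiv ℝ F x v₁) (fderiv ℝ F x v₂) (pd i (pd j F) x) := by
  simp only [secondFF, cov, nor, Fin.sum_univ_two, h.christoffel_eq, fderiv_eq_pd F x]
  module

lemma tension_eq : tension F x =
    nor (F x) (fderiv ℝ F x v₁) (fderiv ℝ F x v₂) (fderiv ℝ (fderiv ℝ F) x v₁ v₁) +
    nor (F x) (fderiv ℝ F x v₁) (fderiv ℝ F x v₂) (fderiv ℝ (fderiv ℝ F) x v₂ v₂) := by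
  simp only [tension, Fin.sum_univ_two, h.secondFF_eq, h.invMetric_eq, h.snd_fderiv_eq, nor_add,
    nor_smul]
  module

lemma nor_tangent₁ : nor (F x) (fderiv ℝ F x v₁) (fderiv ℝ F x v₂) (fderiv ℝ F x v₁) = 0 := by
  rw [nor, h.mink_self, h.unit₁, h.ortho]
  module

lemma nor_tangent₂ : nor (F x) (fderiv ℝ F x v₁) (fderiv ℝ F x v₂) (fderiv ℝ F x v₂) = 0 := by
  rw [nor, h.mink_self, h.unit₂, mink_comm, h.ortho]
  module

lemma mink_nor_self (V : R51) :
    mink (nor (F x) (fderiv ℝ F x v₁) (fderiv ℝ F x v₂) V) (F x) = 0 := by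
  simp only [nor, mink_add_left, mink_sub_left, mink_smul_left, h.hyp, h.mink_self]
  ring

lemma mink_nor_tangent₁ (V : R51) :
    mink (nor (F x) (fderiv ℝ F x v₁) (fderiv ℝ F x v₂) V) (fderiv ℝ F x v₁) = 0 := by
  simp only [nor, mink_add_left, mink_sub_left, mink_smul_left, h.unit₁, mink_comm (F x),
    h.mink_self, mink_comm (fderiv ℝ F x v₂), h.ortho]
  ring

lemma mink_nor_tangent₂ (V : R51) :
    mink (nor (F x) (fderiv ℝ F x v₁) (fderiv ℝ F x v₂) V) (fderiv ℝ F x v₂) = 0 := by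
  simp only [nor, mink_add_left, mink_sub_left, mink_smul_left, h.unit₂, mink_comm (F x),
    h.mink_self, h.ortho]
  ring

lemma normalCov_eq (i : Fin 2) (V : E2 → R51) : normalCov F i V x =
    nor (F x) (fderiv ℝ F x v₁) (fderiv ℝ F x v₂) (pd i V x) := by
  rw [normalCov, h.tangential_eq, nor]
  simp only [cov, mink_add_left, mink_smul_left, mink_comm (F x), h.mink_self]
  module

lemma normGrad_eq : normGradMeanCurv F x =
    √(fderiv ℝ (meanCurv F) x v₁ ^ 2 + fderiv ℝ (meanCurv F) x v₂ ^ 2) := by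
  simp only [normGradMeanCurv, Fin.sum_univ_two, h.invMetric_eq, fderiv_eq_pd (meanCurv F) x,
    smul_eq_mul]
  congr 1
  ring

lemma eq_combination (v : E2) :
    v = mink (fderiv ℝ F x v) (fderiv ℝ F x v₁) • v₁ +
      mink (fderiv ℝ F x v) (fderiv ℝ F x v₂) • v₂ := by
  have key : ∀ a b : ℝ, a = mink (fderiv ℝ F x (a • v₁ + b • v₂)) (fderiv ℝ F x v₁) ∧
      b = mink (fderiv ℝ F x (a • v₁ + b • v₂)) (fderiv ℝ F x v₂) := by
    intro a b
    simp only [map_add, map_smul, mink_add_left, mink_smul_left, h.unit₁, h.unit₂, h.ortho,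
      mink_comm (fderiv ℝ F x v₂)]
    constructor <;> ring
  have li : LinearIndependent ℝ ![v₁, v₂] := by
    rw [LinearIndependent.pair_iff]
    intro a b hab
    have := key a b
    rw [hab] at this
    simpa using this
  have sp := li.span_eq_top_of_card_eq_finrank (by simp)
  have hv : v ∈ Submodule.span ℝ (Set.range ![v₁, v₂]) := sp ▸ Submodule.mem_top
  rw [Matrix.range_cons, Matrix.range_cons, Matrix.range_empty, Set.union_empty,
    Set.singleton_union, Submodule.mem_span_pair] at hv
  obtain ⟨a, b, rfl⟩ := hv
  rw [← (key a b).1, ← (key a b).2]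

lemma mink_tension (v : E2) : mink (tension F x) (fderiv ℝ F x v) = 0 := by
  rw [h.eq_combination v]
  simp only [map_add, map_smul, mink_add_right, mink_smul_right, h.tension_eq, mink_add_left,
    h.mink_nor_tangent₁, h.mink_nor_tangent₂]
  ring

lemma mink_tension_self : mink (tension F x) (F x) = 0 := by
  simp only [h.tension_eq, mink_add_left, h.mink_nor_self, add_zero]

/-- The curvature term does not contribute to the tangential part of the bitension field. -/
lemma mink_bitension (v : E2) : mink (bitension F x) (fderiv ℝ F x v) =
    -mink (roughLaplacian F (tension F) x) (fderiv ℝ F x v) := by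
  have t (i : Fin 2) : mink (tension F x) (pd i F x) = 0 := h.mink_tension _
  simp only [bitension, hypCurv, Fin.sum_univ_two, mink_sub_left, mink_add_left, mink_neg_left,
    mink_smul_left, h.mink_tension, t]
  ring

end IsOrthoAt

lemma cd_eq_cov (F : E2 → R51) (e : E2 → E2) (V : E2 → R51) (x : E2) :
    cd F e V x = e x 0 • cov F 0 V x + e x 1 • cov F 1 V x := by
  simp only [cd, dd, fderiv_eq_pd V x, cov, mink_add_left, mink_smul_left]
  module

namespace IsFrame

variable (h : IsFrame Ω F e₁ e₂)
include h

lemma nor_dd_dd {e : E2 → E2} (he : ContDiffOn ℝ ∞ e Ω) (hx : x ∈ Ω) :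
    nor (F x) (dd e₁ F x) (dd e₂ F x) (dd e (dd e F) x) =
      nor (F x) (dd e₁ F x) (dd e₂ F x) (fderiv ℝ (fderiv ℝ F) x (e x) (e x)) := by
  have := (hasD_dd h.isOpen hx he h.smooth (e x)).fderiv_eq
  change dd e (dd e F) x = _ at this
  rw [this, nor_add, (h.isOrthoAt hx).eq_combination (fderiv ℝ e x (e x)), map_add, map_smul,
    map_smul, nor_add, nor_smul, nor_smul]
  simp only [dd]
  rw [(h.isOrthoAt hx).nor_tangent₁, (h.isOrthoAt hx).nor_tangent₂]
  simp

lemma tension_eq (hx : x ∈ Ω) : tension F x =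
    nor (F x) (dd e₁ F x) (dd e₂ F x) (dd e₁ (dd e₁ F) x) +
      nor (F x) (dd e₁ F x) (dd e₂ F x) (dd e₂ (dd e₂ F) x) := by
  rw [h.nor_dd_dd h.smooth₁ hx, h.nor_dd_dd h.smooth₂ hx]
  exact (h.isOrthoAt hx).tension_eq

lemma smooth_tension : ContDiffOn ℝ ∞ (tension F) Ω := by
  have s (e : E2 → E2) (he : ContDiffOn ℝ ∞ e Ω) : ContDiffOn ℝ ∞ (fun x =>
      nor (F x) (dd e₁ F x) (dd e₂ F x) (dd e (dd e F) x)) Ω := by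
    have s1 := contDiffOn_dd h.isOpen he (contDiffOn_dd h.isOpen he h.smooth)
    exact ((s1.add ((s1.mink h.smooth).smul h.smooth)).sub
      ((s1.mink h.smooth_dd₁).smul h.smooth_dd₁)).sub
      ((s1.mink h.smooth_dd₂).smul h.smooth_dd₂)
  exact ((s e₁ h.smooth₁).add (s e₂ h.smooth₂)).congr fun x hx => h.tension_eq hx

lemma smooth_cov {V : E2 → R51} (hV : ContDiffOn ℝ ∞ V Ω) (i : Fin 2) :
    ContDiffOn ℝ ∞ (cov F i V) Ω :=
  (contDiffOn_pd h.isOpen hV i).add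
    (((contDiffOn_pd h.isOpen hV i).mink h.smooth).smul h.smooth)

lemma mink_cov (V : E2 → R51) (i : Fin 2) (hx : x ∈ Ω) : mink (cov F i V x) (F x) = 0 := by
  simp only [cov, mink_add_left, mink_smul_left, h.hyp x hx]
  ring

lemma cd_cd {V : E2 → R51} (hV : ContDiffOn ℝ ∞ V Ω) {e : E2 → E2}
    (he : ContDiffOn ℝ ∞ e Ω) (hx : x ∈ Ω) : cd F e (cd F e V) x =
      e x 0 • e x 0 • cov F 0 (cov F 0 V) x + e x 0 • e x 1 • cov F 0 (cov F 1 V) x +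
      e x 1 • e x 0 • cov F 1 (cov F 0 V) x + e x 1 • e x 1 • cov F 1 (cov F 1 V) x +
      ((fderiv ℝ e x (e x)) 0 • cov F 0 V x + (fderiv ℝ e x (e x)) 1 • cov F 1 V x) := by
  have hD (i : Fin 2) : HasD (e x) (fun y => e y i) ((fderiv ℝ e x (e x)) i) x :=
    HasD.clm_comp (EuclideanSpace.proj i : E2 →L[ℝ] ℝ) (he.hasD h.isOpen hx e)
  have hc (i : Fin 2) := (h.smooth_cov hV i).hasD h.isOpen hx e
  have d : dd e (cd F e V) x = _ :=
    ((((hD 0).smul (hc 0)).add ((hD 1).smul (hc 1))).congr_on h.isOpen hx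
      fun y _ => cd_eq_cov F e V y).fderiv_eq
  have cc (i j : Fin 2) : cov F i (cov F j V) x =
    pd i (cov F j V) x + mink (pd i (cov F j V) x) (F x) • F x := rfl
  rw [cd, d]
  simp only [mink_add_left, mink_smul_left, h.mink_cov V _ hx, dd, fderiv_eq_pd _ x (e x),
    cc]
  module

/-- The trace of the second covariant derivative does not depend on the basis. In ∇_e∇_eV the
derivatives of the components of e contribute an extra first-order term; comparing it with the
Christoffel term leaves ∇_{∇_e e}V, and ∇_e e has only a component along the other frame vector. -/
lemma roughLaplacian_eq {V : E2 → R51} (hV : ContDiffOn ℝ ∞ V Ω) (hx : x ∈ Ω) :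
    roughLaplacian F V x =
      -(cd F e₁ (cd F e₁ V) x - mink (dd e₁ (dd e₁ F) x) (dd e₂ F x) • cd F e₂ V x
        + (cd F e₂ (cd F e₂ V) x - mink (dd e₂ (dd e₂ F) x) (dd e₁ F x) • cd F e₁ V x)) := by
  have o := h.isOrthoAt hx
  have r := h.relations hx
  have key (e : E2 → E2) (he : ContDiffOn ℝ ∞ e Ω) :
      (fderiv ℝ e x (e x)) 0 • cov F 0 V x + (fderiv ℝ e x (e x)) 1 • cov F 1 V x =
        mink (dd e (dd e F) x - fderiv ℝ (fderiv ℝ F) x (e x) (e x)) (dd e₁ F x) • cd F e₁ V x +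
        mink (dd e (dd e F) x - fderiv ℝ (fderiv ℝ F) x (e x) (e x)) (dd e₂ F x) • cd F e₂ V x := by
    have := (hasD_dd h.isOpen hx he h.smooth (e x)).fderiv_eq
    change dd e (dd e F) x = _ at this
    rw [this, add_sub_cancel_left]
    have c := h.eq_combination hx (fderiv ℝ e x (e x))
    generalize mink (fderiv ℝ F x (fderiv ℝ e x (e x))) (dd e₁ F x) = a at c ⊢
    generalize mink (fderiv ℝ F x (fderiv ℝ e x (e x))) (dd e₂ F x) = b at c ⊢
    rw [c, cd_eq_cov, cd_eq_cov]
    simp only [PiLp.add_apply, PiLp.smul_apply, smul_eq_mul]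
    module
  rw [h.cd_cd hV h.smooth₁ hx, h.cd_cd hV h.smooth₂ hx, key e₁ h.smooth₁, key e₂ h.smooth₂]
  simp only [mink_sub_left, r.2.2.2.2.2.2.1, r.2.2.2.2.2.2.2.1, o.snd_fderiv_eq, cd_eq_cov]
  simp only [roughLaplacian, Fin.sum_univ_two, o.invMetric_eq, o.christoffel_eq, mink_add_left,
    mink_smul_left, dd]
  module

lemma rotate {p q : E2 → ℝ} (hp : ContDiffOn ℝ ∞ p Ω) (hq : ContDiffOn ℝ ∞ q Ω)
    (hpq : ∀ x ∈ Ω, p x ^ 2 + q x ^ 2 = 1) :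
    IsFrame Ω F (fun x => p x • e₁ x + q x • e₂ x) (fun x => p x • e₂ x - q x • e₁ x) := by
  refine ⟨h.isOpen, h.smooth, (hp.smul h.smooth₁).add (hq.smul h.smooth₂),
    (hp.smul h.smooth₂).sub (hq.smul h.smooth₁), h.hyp, ?_, ?_, ?_⟩ <;>
  intro x hx <;>
  have h1 := h.unit₁ x hx <;>
  have h2 := h.unit₂ x hx <;>
  have h3 := h.ortho x hx <;>
  have h4 := hpq x hx <;>
  have h5 := mink_comm (dd e₁ F x) (dd e₂ F x) <;>
  rw [h3] at h5 <;>
  simp only [dd] at h1 h2 h3 h5 ⊢ <;>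
  simp only [map_add, map_sub, map_smul, mink_add_left, mink_add_right, mink_sub_left,
    mink_sub_right, mink_smul_left, mink_smul_right, h1, h2, h3, ← h5] <;>
  linarith

end IsFrame

/-! ### Construction of a frame adapted to grad f -/

lemma exists_isFrame (hΩ : IsOpen Ω) (hF : ContDiffOn ℝ ∞ F Ω)
    (hh : ∀ x ∈ Ω, mink (F x) (F x) = -1) (hi : ∀ x ∈ Ω, Function.Injective (fderiv ℝ F x)) :
    ∃ e₁ e₂, IsFrame Ω F e₁ e₂ := by
  have ortho (x : E2) (hx : x ∈ Ω) (v : E2) : mink (fderiv ℝ F x v) (F x) = 0 := by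
    have d := hF.hasD hΩ hx (fun _ => v)
    have := (d.mink d).unique ((HasD.const (-1 : ℝ)).congr_on hΩ hx hh)
    rw [mink_comm (F x)] at this
    change mink (dd (fun _ => v) F x) (F x) = 0
    linarith
  have pos (x : E2) (hx : x ∈ Ω) (v : E2) (hv : v ≠ 0) :
      0 < mink (fderiv ℝ F x v) (fderiv ℝ F x v) := by
    refine mink_self_pos (hh x hx) (ortho x hx v) fun h0 => hv (hi x hx ?_)
    rw [h0, map_zero]
  obtain ⟨a, ha⟩ : ∃ a : E2, a = EuclideanSpace.single 0 1 := ⟨_, rfl⟩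
  obtain ⟨b, hb⟩ : ∃ b : E2, b = EuclideanSpace.single 1 1 := ⟨_, rfl⟩
  obtain ⟨s, hs⟩ : ∃ s : E2 → ℝ, s = fun x => mink (fderiv ℝ F x a) (fderiv ℝ F x a) := ⟨_, rfl⟩
  obtain ⟨t, ht⟩ : ∃ t : E2 → ℝ, t = fun x => mink (fderiv ℝ F x a) (fderiv ℝ F x b) := ⟨_, rfl⟩
  -- Gram–Schmidt without division: `u` is orthogonal to `a` in the induced metric, and is nonzero
  -- because `s` is positive.
  obtain ⟨u, hu⟩ : ∃ u : E2 → E2, u = fun x => s x • b - t x • a := ⟨_, rfl⟩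
  obtain ⟨q, hq⟩ : ∃ q : E2 → ℝ, q = fun x => mink (dd u F x) (dd u F x) := ⟨_, rfl⟩
  have ca : ContDiffOn ℝ ∞ (fun x => fderiv ℝ F x a) Ω := contDiffOn_dd hΩ contDiffOn_const hF
  have cb : ContDiffOn ℝ ∞ (fun x => fderiv ℝ F x b) Ω := contDiffOn_dd hΩ contDiffOn_const hF
  have cs : ContDiffOn ℝ ∞ s Ω := hs ▸ ca.mink ca
  have ct : ContDiffOn ℝ ∞ t Ω := ht ▸ ca.mink cb
  have cu : ContDiffOn ℝ ∞ u Ω := hu ▸ (cs.smul contDiffOn_const).sub (ct.smul contDiffOn_const)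
  have cq : ContDiffOn ℝ ∞ q Ω := hq ▸ (contDiffOn_dd hΩ cu hF).mink (contDiffOn_dd hΩ cu hF)
  have a0 : a ≠ 0 := by rw [ha]; simp
  have sp : ∀ x ∈ Ω, 0 < s x := fun x hx => hs ▸ pos x hx a a0
  have u0 : ∀ x ∈ Ω, u x ≠ 0 := fun x hx h0 => by
    have := congrArg (fun v : E2 => v 1) h0
    simp [hu, ha, hb, (sp x hx).ne'] at this
  have qp : ∀ x ∈ Ω, 0 < q x := fun x hx => hq ▸ pos x hx (u x) (u0 x hx)
  refine ⟨fun x => (√(s x))⁻¹ • a, fun x => (√(q x))⁻¹ • u x, hΩ, hF,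
    ((cs.sqrt fun x hx => (sp x hx).ne').inv fun x hx => (Real.sqrt_pos.2 (sp x hx)).ne').smul
      contDiffOn_const,
    ((cq.sqrt fun x hx => (qp x hx).ne').inv fun x hx => (Real.sqrt_pos.2 (qp x hx)).ne').smul
      cu, hh, ?_, ?_, ?_⟩
  · intro x hx
    have h1 := Real.sq_sqrt (sp x hx).le
    have h2 := (Real.sqrt_pos.2 (sp x hx)).ne'
    simp only [dd, map_smul, mink_smul_left, mink_smul_right]
    change (√(s x))⁻¹ * ((√(s x))⁻¹ * mink (fderiv ℝ F x a) (fderiv ℝ F x a)) = 1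
    rw [show mink (fderiv ℝ F x a) (fderiv ℝ F x a) = s x by rw [hs]]
    field_simp
    exact h1.symm
  · intro x hx
    have h1 := Real.sq_sqrt (qp x hx).le
    have h2 := (Real.sqrt_pos.2 (qp x hx)).ne'
    simp only [dd, map_smul, mink_smul_left, mink_smul_right]
    rw [show mink (fderiv ℝ F x (u x)) (fderiv ℝ F x (u x)) = q x by rw [hq]; rfl]
    field_simp
    exact h1.symm
  · intro x hx
    have : mink (fderiv ℝ F x a) (fderiv ℝ F x (u x)) = 0 := by
      simp only [hu, map_sub, map_smul, mink_sub_right, mink_smul_right, hs, ht]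
      ring
    simp [dd, this]

/-- A non-CMC PNMC biconservative surface in `ℍ⁴`, parametrized by an open subset of the plane. -/
structure IsLocalSurface (Ω : Set E2) (F : E2 → R51) : Prop where
  isOpen : IsOpen Ω
  smooth : ContDiffOn ℝ ∞ F Ω
  mem_hyp : ∀ x ∈ Ω, F x ∈ hyp4
  inj : ∀ x ∈ Ω, Function.Injective (fderiv ℝ F x)
  meanCurv_pos : ∀ x ∈ Ω, 0 < meanCurv F x
  grad_ne_zero : ∀ x ∈ Ω, ∃ i, pd i (meanCurv F) x ≠ 0
  parallel : ∀ x ∈ Ω, ∀ i, normalCov F i (fun y => (meanCurv F y)⁻¹ • meanCurvVec F y) x = 0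
  biconservative : ∀ x ∈ Ω, ∀ k, mink (bitension F x) (pd k F x) = 0

lemma cd_congr (hΩ : IsOpen Ω) {V W : E2 → R51} {e : E2 → E2} (h : ∀ y ∈ Ω, V y = W y) :
    ∀ y ∈ Ω, cd F e V y = cd F e W y := fun y hy => by
  have : V =ᶠ[nhds y] W := Filter.eventuallyEq_of_mem (hΩ.mem_nhds hy) h
  rw [cd, cd, dd, dd, this.fderiv_eq]

/-- An arbitrary orthonormal frame is rotated so that its first vector is grad f/|grad f|; this is
smooth because grad f has no zeros, and f is smooth because |H|² is positive. The remaining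
conditions are the coordinate hypotheses rewritten in the frame. -/
lemma IsLocalSurface.exists_isAdapted (h : IsLocalSurface Ω F) : ∃ e₁ e₂, IsAdapted Ω F e₁ e₂
    (meanCurv F) (fun y => (meanCurv F y)⁻¹ • meanCurvVec F y) := by
  obtain ⟨a₁, a₂, ha⟩ := exists_isFrame h.isOpen h.smooth (fun x hx => (h.mem_hyp x hx).1) h.inj
  have sH : ContDiffOn ℝ ∞ (meanCurvVec F) Ω := ha.smooth_tension.const_smul (1 / 2 : ℝ)
  have sf : ContDiffOn ℝ ∞ (meanCurv F) Ω :=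
    (sH.mink sH).sqrt fun x hx => (Real.sqrt_pos.1 (h.meanCurv_pos x hx)).ne'
  obtain ⟨p, hp⟩ : ∃ p : E2 → ℝ, p = dd a₁ (meanCurv F) := ⟨_, rfl⟩
  obtain ⟨q, hq⟩ : ∃ q : E2 → ℝ, q = dd a₂ (meanCurv F) := ⟨_, rfl⟩
  have sp : ContDiffOn ℝ ∞ p Ω := hp ▸ contDiffOn_dd h.isOpen ha.smooth₁ sf
  have sq : ContDiffOn ℝ ∞ q Ω := hq ▸ contDiffOn_dd h.isOpen ha.smooth₂ sf
  have pos : ∀ x ∈ Ω, 0 < p x ^ 2 + q x ^ 2 := fun x hx => by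
    by_contra! h0
    have p0 : p x = 0 := by nlinarith [sq_nonneg (p x), sq_nonneg (q x)]
    have q0 : q x = 0 := by nlinarith [sq_nonneg (p x), sq_nonneg (q x)]
    obtain ⟨i, hi⟩ := h.grad_ne_zero x hx
    apply hi
    rw [pd, ha.fderiv_eq _ hx, ← hp, ← hq, p0, q0]
    simp
  obtain ⟨r, hr⟩ : ∃ r : E2 → ℝ, r = fun x => √(p x ^ 2 + q x ^ 2) := ⟨_, rfl⟩
  have sr : ContDiffOn ℝ ∞ r Ω := hr ▸ ((sp.pow 2).add (sq.pow 2)).sqrt fun x hx => (pos x hx).ne'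
  have rp : ∀ x ∈ Ω, 0 < r x := fun x hx => hr ▸ Real.sqrt_pos.2 (pos x hx)
  have rr : ∀ x ∈ Ω, r x ^ 2 = p x ^ 2 + q x ^ 2 := fun x hx => hr ▸ Real.sq_sqrt (pos x hx).le
  have hf := ha.rotate (p := fun x => p x / r x) (q := fun x => q x / r x)
    (sp.div sr fun x hx => (rp x hx).ne') (sq.div sr fun x hx => (rp x hx).ne')
    fun x hx => by
      have := rp x hx
      have := rr x hx
      field_simp
      linarith
  obtain ⟨e₁, he₁⟩ : ∃ e₁ : E2 → E2, e₁ = fun x => (p x / r x) • a₁ x + (q x / r x) • a₂ x :=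
    ⟨_, rfl⟩
  obtain ⟨e₂, he₂⟩ : ∃ e₂ : E2 → E2, e₂ = fun x => (p x / r x) • a₂ x - (q x / r x) • a₁ x :=
    ⟨_, rfl⟩
  rw [← he₁, ← he₂] at hf
  have HH : ∀ x ∈ Ω, mink (meanCurvVec F x) (meanCurvVec F x) = meanCurv F x ^ 2 := fun x hx =>
    (Real.sq_sqrt (Real.sqrt_pos.1 (h.meanCurv_pos x hx)).le).symm
  have pn (e : E2 → E2) (x : E2) (hx : x ∈ Ω) : nor (F x) (dd e₁ F x) (dd e₂ F x)
      (dd e (fun y => (meanCurv F y)⁻¹ • meanCurvVec F y) x) = 0 := by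
    have k (i : Fin 2) := h.parallel x hx i
    simp only [(hf.isOrthoAt hx).normalCov_eq] at k
    simp only [dd] at k ⊢
    rw [fderiv_eq_pd _ x (e x), nor_add, nor_smul, nor_smul, k, k]
    simp
  refine ⟨e₁, e₂, { hf with
    smooth_f := sf
    smooth_E₃ := (sf.inv fun x hx => (h.meanCurv_pos x hx).ne').smul sH
    f_pos := h.meanCurv_pos
    grad_pos := fun x hx => ?_
    grad_zero := fun x hx => ?_
    unit₃ := fun x hx => ?_
    ortho₀ := fun x hx => ?_
    ortho₁ := fun x hx => ?_
    ortho₂ := fun x hx => ?_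
    parallel₁ := pn e₁
    parallel₂ := pn e₂
    trace := fun x hx => ?_
    bicons := fun x hx v => ?_ }⟩
  · have e : dd e₁ (meanCurv F) x = r x := by
      rw [he₁, dd, map_add, map_smul, map_smul]
      change (p x / r x) • dd a₁ (meanCurv F) x + (q x / r x) • dd a₂ (meanCurv F) x = r x
      rw [← hp, ← hq, smul_eq_mul, smul_eq_mul]
      have := rp x hx
      have := rr x hx
      field_simp
      linarith
    rw [e]
    exact rp x hx
  · rw [he₂, dd, map_sub, map_smul, map_smul]
    change (p x / r x) • dd a₂ (meanCurv F) x - (q x / r x) • dd a₁ (meanCurv F) x = 0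
    rw [← hp, ← hq, smul_eq_mul, smul_eq_mul]
    ring
  · have := (h.meanCurv_pos x hx).ne'
    rw [mink_smul_left, mink_smul_right, HH x hx]
    field_simp
  · simp [meanCurvVec, (hf.isOrthoAt hx).mink_tension_self]
  · simp [meanCurvVec, (hf.isOrthoAt hx).mink_tension, dd]
  · simp [meanCurvVec, (hf.isOrthoAt hx).mink_tension, dd]
  · have := (h.meanCurv_pos x hx).ne'
    rw [← hf.tension_eq hx, meanCurvVec, smul_smul, smul_smul, mul_assoc 2,
      mul_inv_cancel₀ this]
    simp
  · have b : mink (bitension F x) (fderiv ℝ F x v) = 0 := by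
      rw [fderiv_eq_pd, mink_add_right, mink_smul_right, mink_smul_right, h.biconservative x hx,
        h.biconservative x hx]
      simp
    rw [(hf.isOrthoAt hx).mink_bitension, hf.roughLaplacian_eq hf.smooth_tension hx] at b
    have t : ∀ y ∈ Ω, (2 * meanCurv F y) • (meanCurv F y)⁻¹ • meanCurvVec F y = tension F y := by
      intro y hy
      have := (h.meanCurv_pos y hy).ne'
      rw [meanCurvVec, smul_smul, smul_smul, mul_assoc 2, mul_inv_cancel₀ this]
      simp
    have t1 (e : E2 → E2) := cd_congr (F := F) (e := e) h.isOpen t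
    have t2 (e e' : E2 → E2) := cd_congr (F := F) (e := e') h.isOpen (t1 e)
    rw [t1 e₁ x hx, t1 e₂ x hx, t2 e₁ e₁ x hx, t2 e₂ e₂ x hx]
    simpa using b

end PNMC

end

noncomputable section

namespace PNMC

variable {Ω Ω' : Set E2} {F F' E₃ : E2 → R51} {e₁ e₂ ψ : E2 → E2} {f : E2 → ℝ} {x z : E2}

/-! ### Change of coordinates -/

/-- `F'` is obtained from the immersion `F : Ω → ℍ⁴` by the change of coordinates `ψ`. -/
structure IsReparam (Ω Ω' : Set E2) (F F' : E2 → R51) (ψ : E2 → E2) : Prop where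
  isOpen : IsOpen Ω
  isOpen' : IsOpen Ω'
  smooth : ContDiffOn ℝ ∞ F Ω
  hyp : ∀ x ∈ Ω, mink (F x) (F x) = -1
  inj : ∀ x ∈ Ω, Function.Injective (fderiv ℝ F x)
  smooth' : ContDiffOn ℝ ∞ ψ Ω'
  mapsTo : ∀ z ∈ Ω', ψ z ∈ Ω
  surj : ∀ z ∈ Ω', Function.Surjective (fderiv ℝ ψ z)
  eq : ∀ z ∈ Ω', F' z = F (ψ z)

lemma IsOrthoAt.nor_tangent {v₁ v₂ : E2} (h : IsOrthoAt F x v₁ v₂) (v : E2) :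
    nor (F x) (fderiv ℝ F x v₁) (fderiv ℝ F x v₂) (fderiv ℝ F x v) = 0 := by
  rw [h.eq_combination v, map_add, map_smul, map_smul, nor_add, nor_smul, nor_smul,
    h.nor_tangent₁, h.nor_tangent₂]
  simp

namespace IsReparam

variable (h : IsReparam Ω Ω' F F' ψ)
include h

lemma hasFDerivAt_comp {W : Type*} [NormedAddCommGroup W] [NormedSpace ℝ W] {G G' : E2 → W}
    (hG : DifferentiableAt ℝ G (ψ z)) (hG' : ∀ y ∈ Ω', G' y = G (ψ y)) (hz : z ∈ Ω') :
    HasFDerivAt G' ((fderiv ℝ G (ψ z)).comp (fderiv ℝ ψ z)) z :=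
  (hG.hasFDerivAt.comp z (h.smooth'.differentiableAt_of_isOpen h.isOpen' hz).hasFDerivAt
    ).congr_of_eventuallyEq (Filter.eventuallyEq_of_mem (h.isOpen'.mem_nhds hz) hG')

lemma fderiv_comp {W : Type*} [NormedAddCommGroup W] [NormedSpace ℝ W] {G G' : E2 → W}
    (hG : DifferentiableAt ℝ G (ψ z)) (hG' : ∀ y ∈ Ω', G' y = G (ψ y)) (hz : z ∈ Ω') (v : E2) :
    fderiv ℝ G' z v = fderiv ℝ G (ψ z) (fderiv ℝ ψ z v) := by
  rw [(h.hasFDerivAt_comp hG hG' hz).fderiv]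
  rfl

lemma fderiv_eq (hz : z ∈ Ω') (v : E2) : fderiv ℝ F' z v = fderiv ℝ F (ψ z) (fderiv ℝ ψ z v) :=
  h.fderiv_comp (h.smooth.differentiableAt_of_isOpen h.isOpen (h.mapsTo z hz)) h.eq hz v

lemma smooth_comp : ContDiffOn ℝ ∞ F' Ω' :=
  (h.smooth.comp h.smooth' h.mapsTo).congr h.eq

lemma snd_fderiv_eq (hz : z ∈ Ω') (v w : E2) : fderiv ℝ (fderiv ℝ F') z v w =
    fderiv ℝ (fderiv ℝ F) (ψ z) (fderiv ℝ ψ z v) (fderiv ℝ ψ z w) +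
      fderiv ℝ F (ψ z) (fderiv ℝ (fderiv ℝ ψ) z v w) := by
  have e1 := (hasD_dd h.isOpen' hz (e := fun _ => w) contDiffOn_const h.smooth_comp v).fderiv_eq
  simp only [fderiv_fun_const, Pi.zero_apply, zero_apply, map_zero, add_zero] at e1
  have d1 : DifferentiableAt ℝ (fderiv ℝ F) (ψ z) :=
    ((contDiffOn_infty_iff_fderiv_of_isOpen h.isOpen).1 h.smooth).2.differentiableAt_of_isOpen
      h.isOpen (h.mapsTo z hz)
  have d2 : DifferentiableAt ℝ (fderiv ℝ ψ) z :=
    ((contDiffOn_infty_iff_fderiv_of_isOpen h.isOpen').1 h.smooth').2.differentiableAt_of_isOpen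
      h.isOpen' hz
  have d3 := (h.hasFDerivAt_comp d1 (G' := fun y => fderiv ℝ F (ψ y)) (fun _ _ => rfl)
    hz).clm_apply (d2.hasFDerivAt.clm_apply (hasFDerivAt_const w z))
  have d4 : HasD v (dd (fun _ => w) F') _ z :=
    HasD.congr_on ⟨_, d3, rfl⟩ h.isOpen' hz fun y hy => h.fderiv_eq hy w
  rw [← e1, d4.fderiv_eq]
  simp [add_comm]

lemma exists_isOrthoAt (hz : z ∈ Ω') : ∃ v₁ v₂, IsOrthoAt F' z v₁ v₂ ∧
    IsOrthoAt F (ψ z) (fderiv ℝ ψ z v₁) (fderiv ℝ ψ z v₂) := by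
  obtain ⟨e₁, e₂, he⟩ := exists_isFrame h.isOpen h.smooth h.hyp h.inj
  obtain ⟨v₁, h₁⟩ := h.surj z hz (e₁ (ψ z))
  obtain ⟨v₂, h₂⟩ := h.surj z hz (e₂ (ψ z))
  have o := he.isOrthoAt (h.mapsTo z hz)
  rw [← h₁, ← h₂] at o
  refine ⟨v₁, v₂, ⟨⟨Ω', h.isOpen', hz, h.smooth_comp, fun y hy => ?_⟩, ?_, ?_, ?_⟩, o⟩
  · rw [h.eq y hy, h.hyp _ (h.mapsTo y hy)]
  · rw [h.fderiv_eq hz, o.unit₁]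
  · rw [h.fderiv_eq hz, o.unit₂]
  · rw [h.fderiv_eq hz, h.fderiv_eq hz, o.ortho]

/-- Under a change of coordinates the second derivative acquires an extra term in dF, which is
tangent and is removed by `nor`. -/
lemma tension_eq (hz : z ∈ Ω') : tension F' z = tension F (ψ z) := by
  obtain ⟨v₁, v₂, o', o⟩ := h.exists_isOrthoAt hz
  rw [o'.tension_eq, o.tension_eq]
  simp only [h.snd_fderiv_eq hz, h.fderiv_eq hz, h.eq z hz, nor_add, o.nor_tangent, add_zero]

lemma meanCurvVec_eq (hz : z ∈ Ω') : meanCurvVec F' z = meanCurvVec F (ψ z) := by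
  rw [meanCurvVec, meanCurvVec, h.tension_eq hz]

lemma meanCurv_eq (hz : z ∈ Ω') : meanCurv F' z = meanCurv F (ψ z) := by
  rw [meanCurv, meanCurv, h.meanCurvVec_eq hz]

end IsReparam

/-- The conditions of `HasConstants` at one point of a chart. -/
structure HasConstantsAt (F : E2 → R51) (x : E2) (c C : ℝ) : Prop where
  shape : ∃ E₄ : R51, mink E₄ E₄ = 1 ∧ mink E₄ (F x) = 0 ∧ (∀ i, mink E₄ (pd i F x) = 0) ∧
    mink E₄ (meanCurvVec F x) = 0 ∧ ∀ i j, mink (secondFF F i j x) E₄ =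
      c * meanCurv F x ^ (3 / 2 : ℝ) *
        (2 * (pd i (meanCurv F) x * pd j (meanCurv F) x) / normGradMeanCurv F x ^ 2
          - metric F x i j)
  first_integral : normGradMeanCurv F x =
    4 / 3 * meanCurv F x * Real.sqrt (radicand c C (meanCurv F x))

lemma mink_nor_of_orthogonal {X A₁ A₂ V E : R51} (h0 : mink E X = 0) (h1 : mink E A₁ = 0)
    (h2 : mink E A₂ = 0) : mink (nor X A₁ A₂ V) E = mink V E := by
  simp [nor, mink_comm X, mink_comm A₁, mink_comm A₂, h0, h1, h2]

/-- The shape condition, expressed without reference to coordinate vectors. -/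
lemma IsOrthoAt.shape_iff {v₁ v₂ : E2} (o : IsOrthoAt F x v₁ v₂) {E₄ : R51}
    (h0 : mink E₄ (F x) = 0) (h1 : ∀ v, mink E₄ (fderiv ℝ F x v) = 0) {r s : ℝ} :
    (∀ i j, mink (secondFF F i j x) E₄ =
      r * (2 * (pd i (meanCurv F) x * pd j (meanCurv F) x) / s - metric F x i j)) ↔
    ∀ v w, mink (fderiv ℝ (fderiv ℝ F) x v w) E₄ =
      r * (2 * (fderiv ℝ (meanCurv F) x v * fderiv ℝ (meanCurv F) x w) / s -
        mink (fderiv ℝ F x v) (fderiv ℝ F x w)) := by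
  simp only [o.secondFF_eq, mink_nor_of_orthogonal h0 (h1 _) (h1 _)]
  constructor
  · intro H v w
    rw [o.snd_fderiv_eq, fderiv_eq_pd (meanCurv F) x v, fderiv_eq_pd (meanCurv F) x w,
      fderiv_eq_pd F x v, fderiv_eq_pd F x w]
    simp only [mink_add_left, mink_add_right, mink_smul_left, mink_smul_right, H, metric,
      Matrix.of_apply, smul_eq_mul]
    ring
  · intro H i j
    rw [o.pd_pd, H]
    rfl

/-- The same E₄ serves in both coordinate systems: in the form `shape_iff` every term is evaluated
on dψ(v) and dψ(w), and the extra term of the second derivative is tangent, hence orthogonal to E₄.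
-/
lemma IsReparam.hasConstantsAt (h : IsReparam Ω Ω' F F' ψ) (hf : DifferentiableOn ℝ (meanCurv F) Ω)
    {c C : ℝ} (hz : z ∈ Ω') (hc : HasConstantsAt F (ψ z) c C) : HasConstantsAt F' z c C := by
  obtain ⟨v₁, v₂, o', o⟩ := h.exists_isOrthoAt hz
  have df (v : E2) : fderiv ℝ (meanCurv F') z v =
      fderiv ℝ (meanCurv F) (ψ z) (fderiv ℝ ψ z v) :=
    h.fderiv_comp (hf.differentiableAt (h.isOpen.mem_nhds (h.mapsTo z hz)))
      (fun y hy => h.meanCurv_eq hy) hz v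
  have ng : normGradMeanCurv F' z = normGradMeanCurv F (ψ z) := by
    rw [o.normGrad_eq, o'.normGrad_eq, df, df]
  obtain ⟨⟨E₄, a1, a2, a3, a4, a5⟩, b⟩ := hc
  have a3' (v : E2) : mink E₄ (fderiv ℝ F (ψ z) v) = 0 := by
    rw [fderiv_eq_pd, mink_add_right, mink_smul_right, mink_smul_right, a3, a3]
    simp
  have a2' : mink E₄ (F' z) = 0 := by rw [h.eq z hz, a2]
  have a3'' (v : E2) : mink E₄ (fderiv ℝ F' z v) = 0 := by rw [h.fderiv_eq hz, a3']
  refine ⟨⟨E₄, a1, a2', fun i => a3'' _, by rw [h.meanCurvVec_eq hz, a4], ?_⟩, ?_⟩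
  · rw [o'.shape_iff a2' a3'']
    rw [o.shape_iff a2 a3'] at a5
    intro v w
    rw [h.snd_fderiv_eq hz, mink_add_left, a5, h.meanCurv_eq hz, ng, df, df, h.fderiv_eq hz,
      h.fderiv_eq hz, mink_comm _ E₄, a3', add_zero]
  · rw [ng, b, h.meanCurv_eq hz]

/-- In five-dimensional Minkowski space a vector orthogonal to five orthonormal vectors is zero. -/
lemma eq_zero_of_orthonormal {X A₁ A₂ A₃ A₄ V : R51} (hX : mink X X = -1) (h₁ : mink A₁ A₁ = 1)
    (h₂ : mink A₂ A₂ = 1) (h₃ : mink A₃ A₃ = 1) (h₄ : mink A₄ A₄ = 1)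
    (h01 : mink A₁ X = 0) (h02 : mink A₂ X = 0) (h03 : mink A₃ X = 0) (h04 : mink A₄ X = 0)
    (h12 : mink A₂ A₁ = 0) (h13 : mink A₃ A₁ = 0) (h14 : mink A₄ A₁ = 0)
    (h23 : mink A₃ A₂ = 0) (h24 : mink A₄ A₂ = 0) (h34 : mink A₄ A₃ = 0)
    (k0 : mink V X = 0) (k1 : mink V A₁ = 0) (k2 : mink V A₂ = 0) (k3 : mink V A₃ = 0)
    (k4 : mink V A₄ = 0) : V = 0 := by
  obtain ⟨T, hT⟩ : ∃ T : R51 →ₗ[ℝ] R51, ∀ v, T v =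
      ![mink v X, mink v A₁, mink v A₂, mink v A₃, mink v A₄] :=
    ⟨{ toFun := fun v => ![mink v X, mink v A₁, mink v A₂, mink v A₃, mink v A₄]
       map_add' := fun v w => by simp
       map_smul' := fun r v => by simp }, fun v => rfl⟩
  have hs : Function.Surjective T := fun w => by
    refine ⟨-(w 0 • X) + w 1 • A₁ + w 2 • A₂ + w 3 • A₃ + w 4 • A₄, ?_⟩
    rw [hT]
    simp only [mink_add_left, mink_neg_left, mink_smul_left, mink_comm X A₁, mink_comm X A₂,
      mink_comm X A₃, mink_comm X A₄, mink_comm A₁ A₂, mink_comm A₁ A₃, mink_comm A₁ A₄,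
      mink_comm A₂ A₃, mink_comm A₂ A₄, mink_comm A₃ A₄, hX, h₁, h₂, h₃, h₄, h01, h02, h03, h04,
      h12, h13, h14, h23, h24, h34]
    ext i
    fin_cases i <;> simp
  have hi := LinearMap.injective_iff_surjective.2 hs
  apply hi
  rw [hT, k0, k1, k2, k3, k4, map_zero]
  ext i
  fin_cases i <;> rfl

/-! ### The two constants at a single point of the surface -/

namespace IsAdapted

variable (h : IsAdapted Ω F e₁ e₂ (meanCurv F) (fun y => (meanCurv F y)⁻¹ • meanCurvVec F y))
include h

/-- In a normal direction orthogonal to H the second fundamental form has trace zero, and it is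
diagonal because B(e₁,e₂) = 0; so one number determines it. -/
lemma mink_snd_fderiv (hx : x ∈ Ω) {E : R51} (h1 : ∀ v, mink E (fderiv ℝ F x v) = 0)
    (h0 : mink E (F x) = 0) (h3 : mink E (meanCurvVec F x) = 0) (v w : E2) :
    mink (fderiv ℝ (fderiv ℝ F) x v w) E =
      (mink (fderiv ℝ F x v) (dd e₁ F x) * mink (fderiv ℝ F x w) (dd e₁ F x) -
        mink (fderiv ℝ F x v) (dd e₂ F x) * mink (fderiv ℝ F x w) (dd e₂ F x)) *
      mink (perp F e₁ (meanCurv F) (fun y => (meanCurv F y)⁻¹ • meanCurvVec F y) x) E := by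
  have k {e e' : E2 → E2} (he : ContDiffOn ℝ ∞ e Ω) : mink (fderiv ℝ (fderiv ℝ F) x (e' x) (e x)) E
      = mink (dd e' (dd e F) x) E := by
    have := (hasD_dd h.isOpen hx he h.smooth (e' x)).fderiv_eq
    change dd e' (dd e F) x = _ at this
    rw [this, mink_add_left, mink_comm (fderiv ℝ F x _), h1, add_zero]
  obtain ⟨d1, d2, d3, d4⟩ := h.deriv_frame hx
  have e11 := k (e' := e₁) h.smooth₁
  have e12 := k (e' := e₁) h.smooth₂
  have e21 := k (e' := e₂) h.smooth₁
  have e22 := k (e' := e₂) h.smooth₂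
  have t1 : mink (dd e₁ F x) E = 0 := by rw [mink_comm]; exact h1 _
  have t2 : mink (dd e₂ F x) E = 0 := by rw [mink_comm]; exact h1 _
  rw [mink_comm] at h0 h3
  rw [d1] at e11
  rw [d2] at e21
  rw [d3] at e12
  rw [d4] at e22
  simp only [mink_add_left, mink_sub_left, mink_smul_left, mink_neg_left, mink_zero_left, t1, t2,
    h0, h3] at e11 e12 e21 e22
  conv_lhs => rw [h.eq_combination hx v, h.eq_combination hx w]
  simp only [map_add, map_smul, add_apply, smul_apply, mink_add_left, mink_smul_left, e11, e12,
    e21, e22]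
  ring

lemma normGrad (hx : x ∈ Ω) : normGradMeanCurv F x = dd e₁ (meanCurv F) x := by
  rw [(h.isOrthoAt hx).normGrad_eq]
  have := h.grad_zero x hx
  rw [dd] at this
  rw [this]
  simp only [ne_eq, OfNat.ofNat_ne_zero, not_false_eq_true, zero_pow, add_zero]
  exact Real.sqrt_sq (h.grad_pos x hx).le

lemma conn_neg (hx : x ∈ Ω) : conn e₁ (meanCurv F) x < 0 := by
  have := div_pos (h.grad_pos x hx) (h.f_pos x hx)
  rw [conn]
  linarith

lemma fderiv_meanCurv (hx : x ∈ Ω) (v : E2) : fderiv ℝ (meanCurv F) x v =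
    mink (fderiv ℝ F x v) (dd e₁ F x) * dd e₁ (meanCurv F) x := by
  rw [h.fderiv_eq _ hx, h.grad_zero x hx]
  simp

lemma mink_fderiv (hx : x ∈ Ω) (v w : E2) : mink (fderiv ℝ F x v) (fderiv ℝ F x w) =
    mink (fderiv ℝ F x v) (dd e₁ F x) * mink (fderiv ℝ F x w) (dd e₁ F x) +
      mink (fderiv ℝ F x v) (dd e₂ F x) * mink (fderiv ℝ F x w) (dd e₂ F x) := by
  conv_lhs => rw [h.fderiv_eq F hx w]
  simp only [mink_add_right, mink_smul_right]
  ring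

lemma ortho_meanCurvVec (hx : x ∈ Ω) {E : R51} :
    mink E (meanCurvVec F x) = 0 ↔ mink E ((meanCurv F x)⁻¹ • meanCurvVec F x) = 0 := by
  have := (h.f_pos x hx).ne'
  simp [this]

lemma hasConstantsAt (hx : x ∈ Ω) {c C : ℝ} (hc : 0 < c)
    (h1 : mink (perp F e₁ (meanCurv F) (fun y => (meanCurv F y)⁻¹ • meanCurvVec F y) x)
      (perp F e₁ (meanCurv F) (fun y => (meanCurv F y)⁻¹ • meanCurvVec F y) x) =
      c ^ 2 * meanCurv F x ^ 3)
    (h2 : conn e₁ (meanCurv F) x ^ 2 = radicand c C (meanCurv F x)) :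
    HasConstantsAt F x c C := by
  have fx := h.f_pos x hx
  have gx := h.grad_pos x hx
  have fp := Real.rpow_pos_of_pos fx (3 / 2)
  have fs := rpow_three_halves_sq fx.le
  obtain ⟨p0, p1, p2, p3⟩ := h.perp_ortho hx
  set N := perp F e₁ (meanCurv F) (fun y => (meanCurv F y)⁻¹ • meanCurvVec F y) x with hN
  have q0 : mink ((c * meanCurv F x ^ (3 / 2 : ℝ))⁻¹ • N) (F x) = 0 := by
    rw [mink_smul_left, p0, mul_zero]
  have q1 (v : E2) : mink ((c * meanCurv F x ^ (3 / 2 : ℝ))⁻¹ • N) (fderiv ℝ F x v) = 0 := by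
    rw [h.fderiv_eq F hx]
    simp [p1, p2]
  have q3 : mink ((c * meanCurv F x ^ (3 / 2 : ℝ))⁻¹ • N) (meanCurvVec F x) = 0 := by
    rw [h.ortho_meanCurvVec hx, mink_smul_left, p3, mul_zero]
  -- E₄ is n normalized: |n|² = c²f³. This choice of sign makes the coefficient +c.
  refine ⟨⟨(c * meanCurv F x ^ (3 / 2 : ℝ))⁻¹ • N, ?_, q0, fun i => q1 _, q3, ?_⟩, ?_⟩
  · rw [mink_smul_left, mink_smul_right, h1, ← fs]
    field_simp
  · rw [(h.isOrthoAt hx).shape_iff q0 q1]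
    intro v w
    rw [h.mink_snd_fderiv hx q1 q0 q3, ← hN, mink_smul_right, h1, h.normGrad hx,
      h.fderiv_meanCurv hx, h.fderiv_meanCurv hx, h.mink_fderiv hx, ← fs]
    field_simp
    ring
  -- As e₁f > 0, the connection form is negative, and it is minus the square root of the radicand.
  · rw [← h2, h.normGrad hx, h.deriv₁_f hx, Real.sqrt_sq_eq_abs, abs_of_neg (h.conn_neg hx)]
    ring

/-- The converse of `hasConstantsAt`: evaluating the shape condition on (e₁,e₁) recovers n from E₄.
It gives uniqueness of the constants, and carries the global constants back into any adapted frame.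
-/
lemma eq_of_hasConstantsAt (hx : x ∈ Ω) {c C : ℝ} (hc : HasConstantsAt F x c C) :
    mink (perp F e₁ (meanCurv F) (fun y => (meanCurv F y)⁻¹ • meanCurvVec F y) x)
      (perp F e₁ (meanCurv F) (fun y => (meanCurv F y)⁻¹ • meanCurvVec F y) x) =
      c ^ 2 * meanCurv F x ^ 3 ∧
    conn e₁ (meanCurv F) x ^ 2 = radicand c C (meanCurv F x) := by
  have fx := h.f_pos x hx
  have gx := h.grad_pos x hx
  have fp := Real.rpow_pos_of_pos fx (3 / 2)
  have fs := rpow_three_halves_sq fx.le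
  obtain ⟨p0, p1, p2, p3⟩ := h.perp_ortho hx
  set N := perp F e₁ (meanCurv F) (fun y => (meanCurv F y)⁻¹ • meanCurvVec F y) x with hN
  obtain ⟨⟨E₄, a1, a2, a3, a4, a5⟩, b⟩ := hc
  have a3' (v : E2) : mink E₄ (fderiv ℝ F x v) = 0 := by
    rw [fderiv_eq_pd, mink_add_right, mink_smul_right, mink_smul_right, a3, a3]
    simp
  rw [(h.isOrthoAt hx).shape_iff a2 a3'] at a5
  have k := a5 (e₁ x) (e₁ x)
  have u1 := h.unit₁ x hx
  have u2 := h.ortho x hx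
  rw [h.mink_snd_fderiv hx a3' a2 a4, h.normGrad hx, ← hN] at k
  change (mink (dd e₁ F x) (dd e₁ F x) * mink (dd e₁ F x) (dd e₁ F x) -
    mink (dd e₁ F x) (dd e₂ F x) * mink (dd e₁ F x) (dd e₂ F x)) * mink N E₄ =
      c * meanCurv F x ^ (3 / 2 : ℝ) *
      (2 * (dd e₁ (meanCurv F) x * dd e₁ (meanCurv F) x) / dd e₁ (meanCurv F) x ^ 2 -
        mink (dd e₁ F x) (dd e₁ F x)) at k
  rw [u1, u2] at k
  have k' : mink N E₄ = c * meanCurv F x ^ (3 / 2 : ℝ) := by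
    field_simp at k
    linarith
  -- The normal plane is spanned by E₃ and E₄, and n is orthogonal to E₃.
  have z : N - mink N E₄ • E₄ = 0 := by
    have a4' := (h.ortho_meanCurvVec hx).1 a4
    have b1 : mink E₄ (dd e₁ F x) = 0 := a3' _
    have b2 : mink E₄ (dd e₂ F x) = 0 := a3' _
    refine eq_zero_of_orthonormal (h.hyp x hx) u1 (h.unit₂ x hx) (h.unit₃ x hx) a1
      (h.relations hx).1 (h.relations hx).2.1 (h.ortho₀ x hx) a2 (by rw [mink_comm, u2])
      (h.ortho₁ x hx) b1 (h.ortho₂ x hx) b2 a4' ?_ ?_ ?_ ?_ ?_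
    · rw [mink_sub_left, mink_smul_left, p0, a2]; ring
    · rw [mink_sub_left, mink_smul_left, p1, b1]; ring
    · rw [mink_sub_left, mink_smul_left, p2, b2]; ring
    · rw [mink_sub_left, mink_smul_left, p3, a4']; ring
    · rw [mink_sub_left, mink_smul_left, a1]; ring
  rw [sub_eq_zero] at z
  constructor
  · rw [z, mink_smul_left, mink_smul_right, a1, k', ← fs]
    ring
  · rw [h.normGrad hx, h.deriv₁_f hx] at b
    have w := h.conn_neg hx
    have e : √(radicand c C (meanCurv F x)) = -conn e₁ (meanCurv F) x := by
      have : meanCurv F x * √(radicand c C (meanCurv F x)) =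
          meanCurv F x * -conn e₁ (meanCurv F) x := by linarith
      exact mul_left_cancel₀ fx.ne' this
    -- `Real.sqrt` is zero at nonpositive arguments, so positivity of the root shows that the
    -- radicand is positive and may be recovered by squaring.
    have pos : 0 < √(radicand c C (meanCurv F x)) := by rw [e]; linarith
    rw [← Real.sq_sqrt (Real.sqrt_pos.1 pos).le, e]
    ring

end IsAdapted

lemma radicand_inj {c c' C C' r : ℝ} (hr : 0 < r) (h1 : c' ^ 2 * r ^ 3 = c ^ 2 * r ^ 3)
    (h2 : radicand c' C' r = radicand c C r) : c' ^ 2 = c ^ 2 ∧ C' = C := by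
  have e := mul_right_cancel₀ (pow_pos hr 3).ne' h1
  refine ⟨e, ?_⟩
  have fp := Real.rpow_pos_of_pos hr (3 / 2)
  rw [radicand, radicand, e] at h2
  have : C' * r ^ (3 / 2 : ℝ) = C * r ^ (3 / 2 : ℝ) := by linarith
  exact mul_right_cancel₀ fp.ne' this

lemma IsLocalSurface.mono (h : IsLocalSurface Ω F) (hΩ : IsOpen Ω') (hs : Ω' ⊆ Ω) :
    IsLocalSurface Ω' F :=
  ⟨hΩ, h.smooth.mono hs, fun x hx => h.mem_hyp x (hs hx), fun x hx => h.inj x (hs hx),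
    fun x hx => h.meanCurv_pos x (hs hx), fun x hx => h.grad_ne_zero x (hs hx),
    fun x hx => h.parallel x (hs hx), fun x hx => h.biconservative x (hs hx)⟩

lemma IsLocalSurface.hasConstantsAt_unique (h : IsLocalSurface Ω F) (hx : x ∈ Ω) {c c' C C' : ℝ}
    (hc : HasConstantsAt F x c C) (hc' : HasConstantsAt F x c' C') : c' ^ 2 = c ^ 2 ∧ C' = C := by
  obtain ⟨e₁, e₂, ha⟩ := h.exists_isAdapted
  have k := ha.eq_of_hasConstantsAt hx hc
  have k' := ha.eq_of_hasConstantsAt hx hc'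
  exact radicand_inj (h.meanCurv_pos x hx) (k'.1.symm.trans k.1) (k'.2.symm.trans k.2)

end PNMC

end

/-! ### From charts to the whole surface -/

noncomputable section

namespace PNMC

section Global

variable {M : Type*} [TopologicalSpace M] [ChartedSpace E2 M]
  {Φ : M → R51} {e e' : OpenPartialHomeomorph M E2}

lemma contDiffOn_comp_symm (hΦ : ContMDiff (𝓡 2) 𝓘(ℝ, R51) ∞ Φ) (he : e ∈ charts M) :
    ContDiffOn ℝ ∞ (Φ ∘ e.symm) e.target :=
  (hΦ.comp_contMDiffOn (contMDiffOn_symm_of_mem_maximalAtlas he)).contDiffOn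

lemma contDiffOn_transition (he : e ∈ charts M) (he' : e' ∈ charts M) :
    ContDiffOn ℝ ∞ (e ∘ e'.symm) (e'.symm.trans e).source := by
  refine ContMDiffOn.contDiffOn ((contMDiffOn_of_mem_maximalAtlas he).comp
    ((contMDiffOn_symm_of_mem_maximalAtlas he').mono ?_) ?_)
  · rw [OpenPartialHomeomorph.trans_source]
    exact Set.inter_subset_left
  · rw [OpenPartialHomeomorph.trans_source]
    exact Set.inter_subset_right

lemma injective_fderiv_comp_symm (hΦ : ContMDiff (𝓡 2) 𝓘(ℝ, R51) ∞ Φ)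
    (hi : ∀ p, Function.Injective (mfderiv (𝓡 2) 𝓘(ℝ, R51) Φ p)) (he : e ∈ charts M) {x : E2}
    (hx : x ∈ e.target) : Function.Injective (fderiv ℝ (Φ ∘ e.symm) x) := by
  have ds : MDifferentiableAt (𝓡 2) (𝓡 2) e.symm x :=
    (contMDiffAt_symm_of_mem_maximalAtlas he hx).mdifferentiableAt (by simp)
  have de : MDifferentiableAt (𝓡 2) (𝓡 2) e (e.symm x) :=
    (contMDiffAt_of_mem_maximalAtlas he (e.map_target hx)).mdifferentiableAt (by simp)
  have dΦ : MDifferentiableAt (𝓡 2) 𝓘(ℝ, R51) Φ (e.symm x) :=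
    (hΦ _).mdifferentiableAt (by simp)
  rw [← mfderiv_eq_fderiv, mfderiv_comp x dΦ ds]
  refine (hi _).comp ?_
  have h1 := mfderiv_comp x de ds
  have h2 : mfderiv (𝓡 2) (𝓡 2) (e ∘ e.symm) x = mfderiv (𝓡 2) (𝓡 2) (id : E2 → E2) x :=
    Filter.EventuallyEq.mfderiv_eq (Filter.eventuallyEq_of_mem (e.open_target.mem_nhds hx)
      fun y hy => e.right_inv hy)
  rw [h2, mfderiv_id] at h1
  intro v w hvw
  have hv := congrArg (fun T => T v) h1
  have hw := congrArg (fun T => T w) h1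
  exact hv.trans ((congrArg _ hvw).trans hw.symm)

lemma hasConstants_iff {c C : ℝ} : HasConstants Φ c C ↔
    ∀ e ∈ charts M, ∀ x ∈ e.target, HasConstantsAt (Φ ∘ e.symm) x c C :=
  ⟨fun h e he x hx => ⟨h.shape e he x hx, h.first_integral e he x hx⟩,
    fun h => ⟨fun e he x hx => (h e he x hx).shape, fun e he x hx => (h e he x hx).first_integral⟩⟩

lemma IsPNMCBiconservative.isLocalSurface (h : IsPNMCBiconservative Φ) (he : e ∈ charts M) :
    IsLocalSurface e.target (Φ ∘ e.symm) :=
  ⟨e.open_target, contDiffOn_comp_symm h.smooth he, fun _ _ => h.mem_hyp _,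
    fun _ hx => injective_fderiv_comp_symm h.smooth h.immersion he hx, h.meanCurv_pos e he,
    h.grad_ne_zero e he, h.parallel e he, h.biconservative e he⟩

lemma surjective_fderiv_transition (he : e ∈ charts M) (he' : e' ∈ charts M) {z : E2}
    (hz : z ∈ (e'.symm.trans e).source) : Function.Surjective (fderiv ℝ (e ∘ e'.symm) z) := by
  rw [← ContinuousLinearMap.coe_coe, ← LinearMap.injective_iff_surjective]
  have hz' := hz
  rw [OpenPartialHomeomorph.trans_source] at hz'
  have hw : (e ∘ e'.symm) z ∈ (e.symm.trans e').source := by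
    rw [OpenPartialHomeomorph.trans_source]
    refine ⟨e.map_source hz'.2, ?_⟩
    change e.symm (e (e'.symm z)) ∈ e'.source
    rw [e.left_inv hz'.2]
    exact e'.map_target hz'.1
  have d1 := ((contDiffOn_transition he he').differentiableAt_of_isOpen
    (e'.symm.trans e).open_source hz).hasFDerivAt
  have d2 := ((contDiffOn_transition he' he).differentiableAt_of_isOpen
    (e.symm.trans e').open_source hw).hasFDerivAt
  have d3 := (d2.comp z d1).unique ((hasFDerivAt_id z).congr_of_eventuallyEq
    (Filter.eventuallyEq_of_mem ((e'.symm.trans e).open_source.mem_nhds hz) fun y hy => by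
      rw [OpenPartialHomeomorph.trans_source] at hy
      change e' (e.symm (e (e'.symm y))) = y
      rw [e.left_inv hy.2, e'.right_inv hy.1]))
  intro v w hvw
  have hv := congrArg (fun T => T v) d3
  have hw := congrArg (fun T => T w) d3
  exact hv.symm.trans ((congrArg _ hvw).trans hw)

lemma IsPNMCBiconservative.isReparam (h : IsPNMCBiconservative Φ) (he : e ∈ charts M)
    (he' : e' ∈ charts M) : IsReparam e.target (e'.symm.trans e).source (Φ ∘ e.symm)
      (Φ ∘ e'.symm) (e ∘ e'.symm) where
  isOpen := e.open_target
  isOpen' := (e'.symm.trans e).open_source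
  smooth := contDiffOn_comp_symm h.smooth he
  hyp := fun x hx => ((h.isLocalSurface he).mem_hyp x hx).1
  inj := (h.isLocalSurface he).inj
  smooth' := contDiffOn_transition he he'
  mapsTo := fun z hz => by
    rw [OpenPartialHomeomorph.trans_source] at hz
    exact e.map_source hz.2
  surj := fun z hz => surjective_fderiv_transition he he' hz
  eq := fun z hz => by
    rw [OpenPartialHomeomorph.trans_source] at hz
    exact congrArg Φ (e.left_inv hz.2).symm

lemma IsPNMCBiconservative.meanCurv_comp_symm (h : IsPNMCBiconservative Φ) (he : e ∈ charts M)
    (he' : e' ∈ charts M) {p : M} (hp : p ∈ e.source) (hp' : p ∈ e'.source) :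
    meanCurv (Φ ∘ e'.symm) (e' p) = meanCurv (Φ ∘ e.symm) (e p) := by
  have hz : e' p ∈ (e'.symm.trans e).source := by
    rw [OpenPartialHomeomorph.trans_source]
    refine ⟨e'.map_source hp', ?_⟩
    change e'.symm (e' p) ∈ e.source
    rwa [e'.left_inv hp']
  have := (h.isReparam he he').meanCurv_eq hz
  rwa [Function.comp_apply, e'.left_inv hp'] at this

lemma IsPNMCBiconservative.hasConstantsAt_comp_symm (h : IsPNMCBiconservative Φ)
    (he : e ∈ charts M) (he' : e' ∈ charts M) {p : M} (hp : p ∈ e.source) (hp' : p ∈ e'.source)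
    {c C : ℝ} (hc : HasConstantsAt (Φ ∘ e.symm) (e p) c C) :
    HasConstantsAt (Φ ∘ e'.symm) (e' p) c C := by
  have hz : e' p ∈ (e'.symm.trans e).source := by
    rw [OpenPartialHomeomorph.trans_source]
    refine ⟨e'.map_source hp', ?_⟩
    change e'.symm (e' p) ∈ e.source
    rwa [e'.left_inv hp']
  obtain ⟨e₁, e₂, ha⟩ := (h.isLocalSurface he).exists_isAdapted
  refine (h.isReparam he he').hasConstantsAt (fun x hx =>
    (ha.smooth_f.differentiableAt_of_isOpen ha.isOpen hx).differentiableWithinAt) hz ?_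
  rwa [Function.comp_apply, e'.left_inv hp']

variable [IsManifold (𝓡 2) ∞ M]

/-- The two constants exist near every point. -/
lemma IsPNMCBiconservative.exists_local_constants (h : IsPNMCBiconservative Φ) (p : M) :
    ∃ c C : ℝ, 0 < c ∧ ∀ᶠ q in nhds p, ∀ e ∈ charts M, q ∈ e.source →
      HasConstantsAt (Φ ∘ e.symm) (e q) c C := by
  obtain ⟨e, he⟩ : ∃ e : OpenPartialHomeomorph M E2, e = chartAt E2 p := ⟨_, rfl⟩
  have hp : p ∈ e.source := he ▸ mem_chart_source E2 p
  have hc : e ∈ charts M := he ▸ IsManifold.chart_mem_maximalAtlas p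
  obtain ⟨r, hr, hb⟩ := Metric.isOpen_iff.1 e.open_target (e p) (e.map_source hp)
  have hl := (h.isLocalSurface hc).mono Metric.isOpen_ball hb
  have hx : e p ∈ Metric.ball (e p) r := Metric.mem_ball_self hr
  have hpc : IsPreconnected (Metric.ball (e p) r) := (convex_ball _ _).isPreconnected
  have hU : IsOpen (e.source ∩ e ⁻¹' Metric.ball (e p) r) := e.isOpen_inter_preimage Metric.isOpen_ball
  obtain ⟨e₁, e₂, ha⟩ := hl.exists_isAdapted
  obtain ⟨c, C, c0, H⟩ := ha.exists_constants hpc hx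
  -- If c were zero, n would vanish on the ball, and this open piece would lie in a totally geodesic
  -- ℍ³, against fullness.
  have c1 : 0 < c := by
    refine lt_of_le_of_ne c0 fun c1 => ?_
    obtain ⟨n, hn, hn'⟩ := ha.exists_orthogonal hpc hx fun y hy => by
      refine eq_zero_of_mink_self (ha.hyp y hy) (ha.perp_ortho hy).1 ?_
      rw [(H y hy).1, ← c1]
      ring
    obtain ⟨q, hq, hq'⟩ := h.full _ hU ⟨p, hp, hx⟩ n hn
    apply hq'
    have := hn' (e q) hq.2
    rwa [Function.comp_apply, e.left_inv hq.1] at this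
  refine ⟨c, C, c1, Filter.eventually_of_mem (hU.mem_nhds ⟨hp, hx⟩) fun q hq e' he' hq' => ?_⟩
  exact h.hasConstantsAt_comp_symm hc he' hq.1 hq'
    (ha.hasConstantsAt hq.2 c1 (H _ hq.2).1 (H _ hq.2).2)

/-- Two local choices agree wherever both are valid, because a single point determines c² and C, and
c is taken positive. So the choice is locally constant, and constant on the connected surface. -/
lemma IsPNMCBiconservative.exists_hasConstants [ConnectedSpace M] (h : IsPNMCBiconservative Φ) :
    ∃ c C : ℝ, 0 < c ∧ HasConstants Φ c C := by
  choose c C hc H using h.exists_local_constants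
  have key : IsLocallyConstant fun p => (c p, C p) := by
    rw [IsLocallyConstant.iff_eventually_eq]
    intro p
    filter_upwards [H p] with q hq
    have hs := mem_chart_source E2 q
    have hm : chartAt E2 q ∈ charts M := IsManifold.chart_mem_maximalAtlas q
    have := (h.isLocalSurface hm).hasConstantsAt_unique ((chartAt E2 q).map_source hs)
      (hq _ hm hs) ((H q).self_of_nhds _ hm hs)
    rw [sq_eq_sq₀ (hc q).le (hc p).le] at this
    rw [this.1, this.2]
  obtain ⟨p⟩ : Nonempty M := inferInstance
  refine ⟨c p, C p, hc p, hasConstants_iff.2 fun e he x hx => ?_⟩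
  have := (H (e.symm x)).self_of_nhds e he (e.map_target hx)
  rw [e.right_inv hx] at this
  have k := key.apply_eq_of_preconnectedSpace (e.symm x) p
  rw [Prod.mk.injEq] at k
  rwa [← k.1, ← k.2]

lemma IsPNMCBiconservative.hasConstants_unique [ConnectedSpace M] (h : IsPNMCBiconservative Φ)
    {c c' C C' : ℝ} (hc : HasConstants Φ c C) (hc' : HasConstants Φ c' C') :
    c' ^ 2 = c ^ 2 ∧ C' = C := by
  obtain ⟨p⟩ : Nonempty M := inferInstance
  have hm : chartAt E2 p ∈ charts M := IsManifold.chart_mem_maximalAtlas p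
  have hx := (chartAt E2 p).map_source (mem_chart_source E2 p)
  exact (h.isLocalSurface hm).hasConstantsAt_unique hx (hasConstants_iff.1 hc _ hm _ hx)
    (hasConstants_iff.1 hc' _ hm _ hx)

end Global

end PNMC

end

noncomputable section

namespace PNMC

/-! ### The rotational structure in the case `C < 0` -/

variable {Ω : Set E2} {F E₃ : E2 → R51} {e₁ e₂ : E2 → E2} {f : E2 → ℝ} {x : E2} {c C : ℝ}

lemma HasD.sqrt {E : Type*} [NormedAddCommGroup E] [NormedSpace ℝ E] {v x : E}
    {g : E → ℝ} {g' : ℝ} (h : HasD v g g' x) (h0 : 0 < g x) :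
    HasD v (fun y => √(g y)) (g' / (2 * √(g x))) x :=
  (HasD.comp_hasDerivAt (Real.hasDerivAt_sqrt h0.ne') h).congr_eq
    (by rw [smul_eq_mul, mul_one_div])

/-- An adapted frame together with the two constants of the surface. -/
structure IsAdaptedWith (Ω : Set E2) (F : E2 → R51) (e₁ e₂ : E2 → E2) (f : E2 → ℝ)
    (E₃ : E2 → R51) (c C : ℝ) : Prop extends IsAdapted Ω F e₁ e₂ f E₃ where
  c_pos : 0 < c
  perp_sq : ∀ x ∈ Ω, mink (perp F e₁ f E₃ x) (perp F e₁ f E₃ x) = c ^ 2 * f x ^ 3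
  conn_sq : ∀ x ∈ Ω, conn e₁ f x ^ 2 = radicand c C (f x)

/-- The curvature of the `e₂`-curves in `ℝ⁵₁`. -/
def rotCurv (C : ℝ) (f : E2 → ℝ) (x : E2) : ℝ := 3 * √(-C) * f x ^ (3 / 4 : ℝ)

/-- The unit normal of the `e₂`-curves in `ℝ⁵₁`. -/
def rotNormal (C : ℝ) (F : E2 → R51) (e₁ : E2 → E2) (f : E2 → ℝ) (E₃ : E2 → R51) (x : E2) : R51 :=
  (rotCurv C f x)⁻¹ •
    (-(conn e₁ f x • dd e₁ F x) + (3 * f x) • E₃ x - perp F e₁ f E₃ x + F x)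

/-- The principal normal of the `e₁`-curves in `ℍ⁴`. -/
def frenet₁ (c : ℝ) (F : E2 → R51) (e₁ : E2 → E2) (f : E2 → ℝ) (E₃ : E2 → R51) (x : E2) : R51 :=
  (f x * √(1 + c ^ 2 * f x))⁻¹ • (perp F e₁ f E₃ x - f x • E₃ x)

/-- The binormal of the `e₁`-curves in `ℍ⁴`. -/
def frenet₂ (c : ℝ) (F : E2 → R51) (e₁ : E2 → E2) (f : E2 → ℝ) (E₃ : E2 → R51) (x : E2) : R51 :=
  (√(1 + c ^ 2 * f x))⁻¹ •
    ((c * f x * √(f x))⁻¹ • perp F e₁ f E₃ x + (c * √(f x)) • E₃ x)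

namespace IsAdaptedWith

variable (h : IsAdaptedWith Ω F e₁ e₂ f E₃ c C)
include h

lemma conn_neg (hx : x ∈ Ω) : conn e₁ f x < 0 := by
  have := div_pos (h.grad_pos x hx) (h.f_pos x hx)
  rw [conn]
  linarith

lemma sqrt_radicand (hx : x ∈ Ω) : √(radicand c C (f x)) = -conn e₁ f x := by
  rw [← h.conn_sq x hx, Real.sqrt_sq_eq_abs, abs_of_neg (h.conn_neg hx)]

lemma radicand_pos (hx : x ∈ Ω) : 0 < radicand c C (f x) := by
  rw [← h.conn_sq x hx]
  exact even_two.pow_pos (h.conn_neg hx).ne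

lemma hasD_f₁ (hx : x ∈ Ω) : HasD (e₁ x) f (-(4 / 3) * (f x * conn e₁ f x)) x := by
  rw [← h.deriv₁_f hx]
  exact h.smooth_f.hasD h.isOpen hx e₁

lemma hasD_f₂ (hx : x ∈ Ω) : HasD (e₂ x) f 0 x := by
  rw [← h.grad_zero x hx]
  exact h.smooth_f.hasD h.isOpen hx e₂

lemma hasD_conn₁ (hx : x ∈ Ω) : HasD (e₁ x) (conn e₁ f)
    (1 + 3 * f x ^ 2 + c ^ 2 * f x ^ 3 - conn e₁ f x ^ 2) x := by
  rw [← h.perp_sq x hx, ← (h.deriv_perp hx).2.2.1]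
  exact h.smooth_conn.hasD h.isOpen hx e₁

lemma hasD_conn₂ (hx : x ∈ Ω) : HasD (e₂ x) (conn e₁ f) 0 x := by
  rw [← (h.deriv_perp hx).2.2.2]
  exact h.smooth_conn.hasD h.isOpen hx e₂

lemma hasD_perp₁ (hx : x ∈ Ω) : HasD (e₁ x) (perp F e₁ f E₃)
    (-((c ^ 2 * f x ^ 3) • dd e₁ F x) - (2 * conn e₁ f x) • perp F e₁ f E₃ x) x := by
  rw [← h.perp_sq x hx, ← (h.deriv_perp hx).1]
  exact h.smooth_perp.hasD h.isOpen hx e₁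

lemma hasD_perp₂ (hx : x ∈ Ω) : HasD (e₂ x) (perp F e₁ f E₃)
    ((c ^ 2 * f x ^ 3) • dd e₂ F x) x := by
  rw [← h.perp_sq x hx, ← (h.deriv_perp hx).2.1]
  exact h.smooth_perp.hasD h.isOpen hx e₂

lemma hasD_E₃₁ (hx : x ∈ Ω) : HasD (e₁ x) E₃ (f x • dd e₁ F x) x := by
  rw [← h.deriv₁_E₃ hx]
  exact h.smooth_E₃.hasD h.isOpen hx e₁

lemma hasD_E₃₂ (hx : x ∈ Ω) : HasD (e₂ x) E₃ ((-3 * f x) • dd e₂ F x) x := by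
  rw [← h.deriv₂_E₃ hx]
  exact h.smooth_E₃.hasD h.isOpen hx e₂

lemma hasD_E₁₁ (hx : x ∈ Ω) : HasD (e₁ x) (dd e₁ F)
    (perp F e₁ f E₃ x - f x • E₃ x + F x) x := by
  rw [← (h.deriv_frame hx).1]
  exact h.smooth_dd₁.hasD h.isOpen hx e₁

lemma hasD_E₁₂ (hx : x ∈ Ω) : HasD (e₂ x) (dd e₁ F) (conn e₁ f x • dd e₂ F x) x := by
  rw [← (h.deriv_frame hx).2.1]
  exact h.smooth_dd₁.hasD h.isOpen hx e₂

lemma hasD_E₂₁ (hx : x ∈ Ω) : HasD (e₁ x) (dd e₂ F) 0 x := by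
  rw [← (h.deriv_frame hx).2.2.1]
  exact h.smooth_dd₂.hasD h.isOpen hx e₁

lemma hasD_F₁ (hx : x ∈ Ω) : HasD (e₁ x) F (dd e₁ F x) x := h.smooth.hasD h.isOpen hx e₁

lemma hasD_F₂ (hx : x ∈ Ω) : HasD (e₂ x) F (dd e₂ F x) x := h.smooth.hasD h.isOpen hx e₂

/-! #### The Frenet frame of the `e₁`-curves -/

lemma one_add_pos (hx : x ∈ Ω) : 0 < 1 + c ^ 2 * f x := by
  have := h.f_pos x hx
  positivity

lemma smooth_sqrt : ContDiffOn ℝ ∞ (fun x => √(1 + c ^ 2 * f x)) Ω :=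
  (contDiffOn_const.add (contDiffOn_const.mul h.smooth_f)).sqrt fun _ hx => (h.one_add_pos hx).ne'

lemma smooth_frenet₁ : ContDiffOn ℝ ∞ (frenet₁ c F e₁ f E₃) Ω :=
  ((h.smooth_f.mul h.smooth_sqrt).inv fun x hx => (mul_pos (h.f_pos x hx)
    (Real.sqrt_pos.2 (h.one_add_pos hx))).ne').smul
    (h.smooth_perp.sub (h.smooth_f.smul h.smooth_E₃))

lemma smooth_frenet₂ : ContDiffOn ℝ ∞ (frenet₂ c F e₁ f E₃) Ω := by
  have sf : ContDiffOn ℝ ∞ (fun x => √(f x)) Ω := h.smooth_f.sqrt fun x hx => (h.f_pos x hx).ne'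
  have hc := h.c_pos
  refine (h.smooth_sqrt.inv fun x hx => (Real.sqrt_pos.2 (h.one_add_pos hx)).ne').smul
    (((((contDiffOn_const.mul h.smooth_f).mul sf).inv fun x hx => ?_).smul h.smooth_perp).add
      ((contDiffOn_const.mul sf).smul h.smooth_E₃))
  have := h.f_pos x hx
  positivity

lemma frenet_ortho (hx : x ∈ Ω) :
    (mink (frenet₁ c F e₁ f E₃ x) (F x) = 0 ∧ mink (frenet₁ c F e₁ f E₃ x) (dd e₁ F x) = 0 ∧
      mink (frenet₁ c F e₁ f E₃ x) (dd e₂ F x) = 0) ∧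
    (mink (frenet₂ c F e₁ f E₃ x) (F x) = 0 ∧ mink (frenet₂ c F e₁ f E₃ x) (dd e₁ F x) = 0 ∧
      mink (frenet₂ c F e₁ f E₃ x) (dd e₂ F x) = 0) ∧
    mink (frenet₁ c F e₁ f E₃ x) (frenet₁ c F e₁ f E₃ x) = 1 ∧
    mink (frenet₁ c F e₁ f E₃ x) (frenet₂ c F e₁ f E₃ x) = 0 ∧
    mink (frenet₂ c F e₁ f E₃ x) (frenet₂ c F e₁ f E₃ x) = 1 := by
  obtain ⟨p0, p1, p2, p3⟩ := h.perp_ortho hx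
  have p4 := p3
  rw [mink_comm] at p4
  have fx := h.f_pos x hx
  have hc := h.c_pos
  have gx := Real.sqrt_pos.2 fx
  have g2 := Real.sq_sqrt fx.le
  have dx := Real.sqrt_pos.2 (h.one_add_pos hx)
  have d2 := Real.sq_sqrt (h.one_add_pos hx).le
  simp only [frenet₁, frenet₂, mink_smul_left, mink_smul_right, mink_sub_left, mink_sub_right,
    mink_add_left, mink_add_right, p0, p1, p2, p3, p4, h.ortho₀ x hx, h.ortho₁ x hx,
    h.ortho₂ x hx, h.unit₃ x hx, h.perp_sq x hx]
  -- With g² = f and d² = 1 + c²g², the remaining claims are rational identities in c, d and g.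
  generalize √(1 + c ^ 2 * f x) = d at *
  generalize √(f x) = g at *
  rw [← g2] at d2 ⊢
  refine ⟨by simp, by simp, ?_, ?_, ?_⟩
  · field_simp
    rw [d2]
    ring
  · field_simp
    ring
  · field_simp
    rw [d2]
    ring

/-- Along an e₁-curve E₃ and E₄ = n/(c f^(3/2)) have tangential derivatives. The principal normal is
−cos θ E₃ + sin θ E₄ and the binormal sin θ E₃ + cos θ E₄, where tan θ = |n|/f = c√f. The torsion is
therefore the derivative of arctan(c√f), with e₁f = (4/3) f √radicand. -/
lemma hasD_frenet₁ (hx : x ∈ Ω) : HasD (e₁ x) (frenet₁ c F e₁ f E₃)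
    (-(f x * √(1 + c ^ 2 * f x)) • dd e₁ F x +
      (2 * c * √(f x) / (3 * (1 + c ^ 2 * f x)) * √(radicand c C (f x))) •
        frenet₂ c F e₁ f E₃ x) x := by
  have fx := h.f_pos x hx
  have hc := h.c_pos
  have gx := Real.sqrt_pos.2 fx
  have g2 := Real.sq_sqrt fx.le
  have dx := Real.sqrt_pos.2 (h.one_add_pos hx)
  have d2 := Real.sq_sqrt (h.one_add_pos hx).le
  have hd := (((HasD.const (1 : ℝ)).add ((HasD.const (c ^ 2)).mul (h.hasD_f₁ hx))).sqrt
    (h.one_add_pos hx))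
  refine ((((h.hasD_f₁ hx).mul hd).inv (mul_pos fx dx).ne').smul
    ((h.hasD_perp₁ hx).sub ((h.hasD_f₁ hx).smul (h.hasD_E₃₁ hx)))).congr_eq ?_
  rw [h.sqrt_radicand hx, frenet₂, ← d2]
  have d2' : √(1 + c ^ 2 * f x) ^ 2 = 1 + c ^ 2 * √(f x) ^ 2 := by rw [d2, g2]
  generalize √(1 + c ^ 2 * f x) = d at *
  generalize conn e₁ f x = w
  rw [← g2]
  generalize √(f x) = g at *
  have hd0 := dx.ne'
  have hg0 := gx.ne'
  have hc0 := hc.ne'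
  simp only [Real.sqrt_sq dx.le, Real.sqrt_sq gx.le]
  match_scalars
  · field_simp
    simp only [d2']
    ring
  · field_simp
    simp only [d2']
    ring
  · field_simp
    simp only [d2']
    ring

lemma hasD_frenet₂ (hx : x ∈ Ω) : HasD (e₁ x) (frenet₂ c F e₁ f E₃)
    (-(2 * c * √(f x) / (3 * (1 + c ^ 2 * f x)) * √(radicand c C (f x))) •
        frenet₁ c F e₁ f E₃ x) x := by
  have fx := h.f_pos x hx
  have hc := h.c_pos
  have gx := Real.sqrt_pos.2 fx
  have g2 := Real.sq_sqrt fx.le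
  have dx := Real.sqrt_pos.2 (h.one_add_pos hx)
  have d2 := Real.sq_sqrt (h.one_add_pos hx).le
  have hd := (((HasD.const (1 : ℝ)).add ((HasD.const (c ^ 2)).mul (h.hasD_f₁ hx))).sqrt
    (h.one_add_pos hx))
  have hg := (h.hasD_f₁ hx).sqrt fx
  refine ((hd.inv dx.ne').smul ((((((HasD.const c).mul (h.hasD_f₁ hx)).mul hg).inv
    (by positivity)).smul (h.hasD_perp₁ hx)).add (((HasD.const c).mul hg).smul
      (h.hasD_E₃₁ hx)))).congr_eq ?_
  rw [h.sqrt_radicand hx, frenet₁, ← d2]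
  have d2' : √(1 + c ^ 2 * f x) ^ 2 = 1 + c ^ 2 * √(f x) ^ 2 := by rw [d2, g2]
  generalize √(1 + c ^ 2 * f x) = d at *
  generalize conn e₁ f x = w
  rw [← g2]
  generalize √(f x) = g at *
  have hd0 := dx.ne'
  have hg0 := gx.ne'
  have hc0 := hc.ne'
  simp only [Real.sqrt_sq dx.le, Real.sqrt_sq gx.le]
  match_scalars
  · field_simp
    ring
  · field_simp
    simp only [d2']
    ring
  · field_simp
    simp only [d2']
    ring

/-! #### The plane of the `e₂`-curves -/

lemma rotCurv_pos (hC : C < 0) (hx : x ∈ Ω) : 0 < rotCurv C f x := by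
  have := Real.rpow_pos_of_pos (h.f_pos x hx) (3 / 4)
  have := Real.sqrt_pos.2 (neg_pos.2 hC)
  rw [rotCurv]
  positivity

/-- The acceleration −ωe₁F + 3fE₃ − n + F of the e₂-curve has Minkowski square ω² + 9f² + c²f³ − 1 =
9C f^(3/2). This is where the sign of C decides that the acceleration is timelike. -/
lemma rotCurv_sq (hC : C < 0) (hx : x ∈ Ω) :
    rotCurv C f x ^ 2 = 1 - conn e₁ f x ^ 2 - 9 * f x ^ 2 - c ^ 2 * f x ^ 3 := by
  have e : (f x ^ (3 / 4 : ℝ)) ^ 2 = f x ^ (3 / 2 : ℝ) := by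
    rw [← Real.rpow_natCast, ← Real.rpow_mul (h.f_pos x hx).le]
    norm_num
  rw [rotCurv, mul_pow, mul_pow, Real.sq_sqrt (neg_pos.2 hC).le, e, h.conn_sq x hx, radicand]
  ring

lemma smooth_rotCurv : ContDiffOn ℝ ∞ (rotCurv C f) Ω :=
  contDiffOn_const.mul (h.smooth_f.rpow_const_of_ne fun x hx => (h.f_pos x hx).ne')

lemma smooth_rotNormal (hC : C < 0) : ContDiffOn ℝ ∞ (rotNormal C F e₁ f E₃) Ω :=
  (h.smooth_rotCurv.inv fun _ hx => (h.rotCurv_pos hC hx).ne').smul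
    ((((h.smooth_conn.smul h.smooth_dd₁).neg.add
      ((contDiffOn_const.mul h.smooth_f).smul h.smooth_E₃)).sub h.smooth_perp).add h.smooth)

lemma hasD_rotCurv₁ (hx : x ∈ Ω) :
    HasD (e₁ x) (rotCurv C f) (-(conn e₁ f x * rotCurv C f x)) x := by
  have fx := h.f_pos x hx
  refine ((HasD.const (3 * √(-C))).mul ((h.hasD_f₁ hx).rpow_const fx (3 / 4))).congr_eq ?_
  rw [rotCurv]
  field_simp
  ring

lemma hasD_rotCurv₂ (hx : x ∈ Ω) : HasD (e₂ x) (rotCurv C f) 0 x :=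
  ((HasD.const (3 * √(-C))).mul ((h.hasD_f₂ hx).rpow_const (h.f_pos x hx) (3 / 4))).congr_eq
    (by simp)

lemma hasD_E₂₂ (hC : C < 0) (hx : x ∈ Ω) : HasD (e₂ x) (dd e₂ F)
    (rotCurv C f x • rotNormal C F e₁ f E₃ x) x := by
  rw [rotNormal, smul_inv_smul₀ (h.rotCurv_pos hC hx).ne', ← (h.deriv_frame hx).2.2.2]
  exact h.smooth_dd₂.hasD h.isOpen hx e₂

/-- Along e₁ the acceleration vector and its length κ̂ (a multiple of f^(3/4)) are both multiplied
by −ω under differentiation, so their quotient is constant. -/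
lemma hasD_rotNormal₁ (hC : C < 0) (hx : x ∈ Ω) :
    HasD (e₁ x) (rotNormal C F e₁ f E₃) 0 x := by
  have k0 := (h.rotCurv_pos hC hx).ne'
  refine (((h.hasD_rotCurv₁ hx).inv k0).smul ((((((h.hasD_conn₁ hx).smul
    (h.hasD_E₁₁ hx)).neg.add (((HasD.const 3).mul (h.hasD_f₁ hx)).smul (h.hasD_E₃₁ hx))).sub
    (h.hasD_perp₁ hx)).add (h.hasD_F₁ hx)))).congr_eq ?_
  have : - -(conn e₁ f x * rotCurv C f x) / rotCurv C f x ^ 2 =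
      (rotCurv C f x)⁻¹ * conn e₁ f x := by
    field_simp
  rw [this, mul_smul (rotCurv C f x)⁻¹, ← smul_add]
  refine smul_eq_zero_of_right _ ?_
  module

lemma hasD_rotNormal₂ (hC : C < 0) (hx : x ∈ Ω) :
    HasD (e₂ x) (rotNormal C F e₁ f E₃) (rotCurv C f x • dd e₂ F x) x := by
  have k0 := (h.rotCurv_pos hC hx).ne'
  refine (((h.hasD_rotCurv₂ hx).inv k0).smul ((((((h.hasD_conn₂ hx).smul
    (h.hasD_E₁₂ hx)).neg.add (((HasD.const 3).mul (h.hasD_f₂ hx)).smul (h.hasD_E₃₂ hx))).sub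
    (h.hasD_perp₂ hx)).add (h.hasD_F₂ hx)))).congr_eq ?_
  have e : rotCurv C f x = (rotCurv C f x)⁻¹ *
      (1 - conn e₁ f x ^ 2 - 9 * f x ^ 2 - c ^ 2 * f x ^ 3) := by
    rw [← h.rotCurv_sq hC hx]
    field_simp
  conv_rhs => rw [e, mul_smul]
  rw [neg_zero, zero_div, zero_smul, add_zero]
  module

lemma rotNormal_ortho (hC : C < 0) (hx : x ∈ Ω) :
    mink (rotNormal C F e₁ f E₃ x) (rotNormal C F e₁ f E₃ x) = -1 ∧
      mink (dd e₂ F x) (rotNormal C F e₁ f E₃ x) = 0 ∧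
      mink (F x) (rotNormal C F e₁ f E₃ x) = -(rotCurv C f x)⁻¹ := by
  have k0 := (h.rotCurv_pos hC hx).ne'
  have k2 := h.rotCurv_sq hC hx
  obtain ⟨p0, p1, p2, p3⟩ := h.perp_ortho hx
  obtain ⟨r1, r2, -⟩ := h.relations hx
  have s0 := h.ortho₀ x hx
  have s1 := h.ortho₁ x hx
  have s2 := h.ortho₂ x hx
  have u := h.ortho x hx
  have p0' := p0
  have p1' := p1
  have p2' := p2
  have p3' := p3
  have r1' := r1
  have r2' := r2
  have s0' := s0
  have s1' := s1
  have s2' := s2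
  have u' := u
  rw [mink_comm] at p0' p1' p2' p3' r1' r2' s0' s1' s2' u'
  simp only [rotNormal, mink_smul_left, mink_smul_right, mink_sub_left, mink_sub_right,
    mink_add_left, mink_add_right, mink_neg_left, mink_neg_right, p0, p1, p3, p0', p1', p2',
    p3', r1, r2, r1', s0, s1, s0', s1', s2', u', h.unit₁ x hx, h.unit₃ x hx,
    h.hyp x hx, h.perp_sq x hx]
  refine ⟨?_, by ring, by ring⟩
  field_simp
  rw [k2]
  ring

/-- The planes spanned by `E₂` and the normal of the `e₂`-curves are constant, and the position in
this plane is described by a smooth angle function. -/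
lemma exists_angle (hC : C < 0) (hc : IsPreconnected Ω) (hx : x ∈ Ω) :
    ∃ t : E2 → ℝ, ContDiffOn ℝ ∞ t Ω ∧ t x = 0 ∧ (∀ y ∈ Ω, HasD (e₁ y) t 0 y) ∧
      (∀ y ∈ Ω, HasD (e₂ y) t (rotCurv C f y) y) ∧
      (∀ y ∈ Ω, dd e₂ F y = Real.cosh (t y) • dd e₂ F x +
        Real.sinh (t y) • rotNormal C F e₁ f E₃ x) ∧
      ∀ y ∈ Ω, rotNormal C F e₁ f E₃ y = Real.sinh (t y) • dd e₂ F x +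
        Real.cosh (t y) • rotNormal C F e₁ f E₃ x := by
  obtain ⟨T, hT⟩ : ∃ T : E2 → R51, T = rotNormal C F e₁ f E₃ := ⟨_, rfl⟩
  obtain ⟨k, hk⟩ : ∃ k : E2 → ℝ, k = rotCurv C f := ⟨_, rfl⟩
  obtain ⟨A, hA⟩ : ∃ A : E2 → R51, A = dd e₂ F := ⟨_, rfl⟩
  have sT : ContDiffOn ℝ ∞ T Ω := hT ▸ h.smooth_rotNormal hC
  have sA : ContDiffOn ℝ ∞ A Ω := hA ▸ h.smooth_dd₂
  have T1 : ∀ y ∈ Ω, HasD (e₁ y) T 0 y := fun y hy => hT ▸ h.hasD_rotNormal₁ hC hy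
  have T2 : ∀ y ∈ Ω, HasD (e₂ y) T (k y • A y) y := fun y hy =>
    hT ▸ hk ▸ hA ▸ h.hasD_rotNormal₂ hC hy
  have A1 : ∀ y ∈ Ω, HasD (e₁ y) A 0 y := fun y hy => hA ▸ h.hasD_E₂₁ hy
  have A2 : ∀ y ∈ Ω, HasD (e₂ y) A (k y • T y) y := fun y hy => by
    rw [hA, hk, hT]; exact h.hasD_E₂₂ hC hy
  have AA : mink (A x) (A x) = 1 := hA ▸ h.unit₂ x hx
  obtain ⟨TT, AT, -⟩ := h.rotNormal_ortho hC hx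
  rw [← hT] at TT AT
  rw [← hA] at AT
  have TA := AT
  rw [mink_comm] at TA
  rw [← hk, ← hT, ← hA]
  -- Null directions decouple A' = kT, T' = kA: along e₂ the vector A + T is multiplied by k and A −
  -- T by −k. The function `s` is the ratio of A + T to its value at the base point, that is, eᵗ.
  obtain ⟨s, hs⟩ : ∃ s : E2 → ℝ, s = fun y => mink (A y + T y) ((1 / 2 : ℝ) • (A x - T x)) :=
    ⟨_, rfl⟩
  have ss : ContDiffOn ℝ ∞ s Ω := hs ▸ (sA.add sT).mink contDiffOn_const
  have s1 : ∀ y ∈ Ω, HasD (e₁ y) s 0 y := fun y hy => hs ▸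
    (((A1 y hy).add (T1 y hy)).mink (HasD.const _)).congr_eq (by simp)
  have s2 : ∀ y ∈ Ω, HasD (e₂ y) s (k y * s y) y := fun y hy => by
    rw [hs]
    refine (((A2 y hy).add (T2 y hy)).mink (HasD.const _)).congr_eq ?_
    simp only [mink_add_left, mink_smul_left, mink_zero_right]
    ring
  have sx : s x = 1 := by
    simp only [hs, mink_add_left, mink_smul_right, mink_sub_right, AA, TT, AT, TA]
    norm_num
  have const {G : E2 → R51} (h1 : ∀ y ∈ Ω, HasD (e₁ y) G 0 y) (h2 : ∀ y ∈ Ω, HasD (e₂ y) G 0 y) :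
      ∀ y ∈ Ω, G y = G x := fun y hy =>
    h.isOpen.is_const_of_fderiv_eq_zero (𝕜 := ℝ) hc
      (fun z hz => (h1 z hz).differentiableAt.differentiableWithinAt)
      (fun z hz => h.fderiv_eq_zero hz (h1 z hz).fderiv_eq (h2 z hz).fderiv_eq) hy hx
  have m : ∀ y ∈ Ω, s y • (A y - T y) = A x - T x := fun y hy => by
    have := const (G := fun y => s y • (A y - T y))
      (fun z hz => ((s1 z hz).smul ((A1 z hz).sub (T1 z hz))).congr_eq (by simp))
      (fun z hz => ((s2 z hz).smul ((A2 z hz).sub (T2 z hz))).congr_eq (by module)) y hy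
    simpa [sx] using this
  -- The product s(A − T) is constant and equals the nonzero vector A(x) − T(x), so `s` has no zero;
  -- being 1 at the base point, it stays positive on the connected domain.
  have s0 : ∀ y ∈ Ω, s y ≠ 0 := fun y hy h0 => by
    have := congrArg (mink (A x)) (m y hy)
    rw [h0, zero_smul, mink_zero_right, mink_sub_right, AA, AT] at this
    norm_num at this
  have sp : ∀ y ∈ Ω, 0 < s y := fun y hy => by
    by_contra! hn
    obtain ⟨z, hz, hz'⟩ := hc.intermediate_value hy hx ss.continuousOn ⟨hn, by rw [sx]; norm_num⟩
    exact s0 z hz hz'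
  have q : ∀ y ∈ Ω, A y + T y = s y • (A x + T x) := fun y hy => by
    have := const (G := fun y => (s y)⁻¹ • (A y + T y))
      (fun z hz => (((s1 z hz).inv (s0 z hz)).smul ((A1 z hz).add (T1 z hz))).congr_eq (by simp))
      (fun z hz => (((s2 z hz).inv (s0 z hz)).smul ((A2 z hz).add (T2 z hz))).congr_eq (by
        have e : -(k z * s z) / s z ^ 2 = -((s z)⁻¹ * k z) := by
          have := s0 z hz
          field_simp
        rw [e]
        module)) y hy
    simp only [sx, inv_one, one_smul] at this
    rw [← this, smul_inv_smul₀ (s0 y hy)]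
  have m' : ∀ y ∈ Ω, A y - T y = (s y)⁻¹ • (A x - T x) := fun y hy => by
    rw [← m y hy, inv_smul_smul₀ (s0 y hy)]
  refine ⟨fun y => Real.log (s y), ss.log s0, by simp [sx], fun y hy => ?_, fun y hy => ?_,
    fun y hy => ?_, fun y hy => ?_⟩
  · exact (HasD.comp_hasDerivAt (Real.hasDerivAt_log (s0 y hy)) (s1 y hy)).congr_eq (by simp)
  · refine (HasD.comp_hasDerivAt (Real.hasDerivAt_log (s0 y hy)) (s2 y hy)).congr_eq ?_
    have := s0 y hy
    rw [smul_eq_mul]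
    field_simp
  · rw [Real.cosh_eq, Real.sinh_eq, Real.exp_neg, Real.exp_log (sp y hy)]
    linear_combination (norm := module) (1 / 2 : ℝ) • q y hy + (1 / 2 : ℝ) • m' y hy
  · rw [Real.cosh_eq, Real.sinh_eq, Real.exp_neg, Real.exp_log (sp y hy)]
    linear_combination (norm := module) (1 / 2 : ℝ) • q y hy - (1 / 2 : ℝ) • m' y hy

end IsAdaptedWith

end PNMC

end

noncomputable section

namespace PNMC

variable {Ω : Set E2} {F E₃ : E2 → R51} {e₁ e₂ : E2 → E2} {f : E2 → ℝ} {x : E2} {c C : ℝ}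

/-! ### The adapted coordinates -/

lemma isOpen_pos_radicand (c C : ℝ) : IsOpen {v : ℝ | 0 < v ∧ 0 < radicand c C v} := by
  have : Continuous (radicand c C) := by
    unfold radicand
    exact ((continuous_const.add (continuous_const.mul
      (Real.continuous_rpow_const (by norm_num)))).sub (by fun_prop)).sub (by fun_prop)
  exact (isOpen_lt continuous_const continuous_id).inter (isOpen_lt continuous_const this)

/-- A primitive of the reciprocal of a positive smooth function near a point. -/
lemma exists_primitive_inv {q : ℝ → ℝ} {s : Set ℝ} (hs : IsOpen s) (hq : ContDiffOn ℝ ∞ q s)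
    (h0 : ∀ v ∈ s, q v ≠ 0) {a : ℝ} (ha : a ∈ s) : ∃ J ⊆ s, IsOpen J ∧ a ∈ J ∧
    ∃ U : ℝ → ℝ, U a = 0 ∧ ContDiffOn ℝ ∞ U J ∧ ∀ v ∈ J, HasDerivAt U (q v)⁻¹ v := by
  obtain ⟨r, hr, hb⟩ := Metric.isOpen_iff.1 hs a ha
  have hi : ContDiffOn ℝ ∞ (fun v => (q v)⁻¹) (Metric.ball a r) := (hq.mono hb).inv
    fun v hv => h0 v (hb hv)
  have hd : ∀ v ∈ Metric.ball a r,
      HasDerivAt (fun v => ∫ z in a..v, (q z)⁻¹) (q v)⁻¹ v := fun v hv => by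
    refine intervalIntegral.integral_hasDerivAt_right ?_ ?_ ?_
    · refine (hi.continuousOn.mono ?_).intervalIntegrable
      rw [← segment_eq_uIcc]
      exact (convex_ball a r).segment_subset (Metric.mem_ball_self hr) hv
    · exact hi.continuousOn.stronglyMeasurableAtFilter Metric.isOpen_ball v hv
    · exact hi.continuousOn.continuousAt (Metric.isOpen_ball.mem_nhds hv)
  refine ⟨Metric.ball a r, hb, Metric.isOpen_ball, Metric.mem_ball_self hr,
    fun v => ∫ z in a..v, (q z)⁻¹, by simp, ?_, hd⟩
  rw [contDiffOn_infty_iff_deriv_of_isOpen Metric.isOpen_ball]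
  exact ⟨fun v hv => (hd v hv).differentiableAt.differentiableWithinAt,
    hi.congr fun v hv => (hd v hv).deriv⟩

/-- The arc length parameter of the integral curves of `e₁`. -/
lemma IsAdaptedWith.exists_arclength (h : IsAdaptedWith Ω F e₁ e₂ f E₃ c C) (hx : x ∈ Ω) :
    ∃ Ω' ⊆ Ω, IsOpen Ω' ∧ x ∈ Ω' ∧ ∃ u : E2 → ℝ, ContDiffOn ℝ ∞ u Ω' ∧ u x = 0 ∧
      (∀ y ∈ Ω', HasD (e₁ y) u 1 y) ∧ ∀ y ∈ Ω', HasD (e₂ y) u 0 y := by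
  have hq : ContDiffOn ℝ ∞ (fun v => 4 / 3 * v * √(radicand c C v))
      {v : ℝ | 0 < v ∧ 0 < radicand c C v} := by
    refine (contDiffOn_const.mul contDiffOn_id).mul (ContDiffOn.sqrt ?_ fun v hv => hv.2.ne')
    refine ((contDiffOn_const.add (contDiffOn_const.mul ?_)).sub ?_).sub ?_
    · exact contDiffOn_id.rpow_const_of_ne fun v hv => hv.1.ne'
    · exact contDiffOn_const.mul (contDiffOn_id.pow 2)
    · exact contDiffOn_const.mul (contDiffOn_id.pow 3)
  -- Along e₁ one has f' = q(f) with q(v) = (4/3)v√radicand(v). Hence u = U(f) with U' = 1/q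
  -- satisfies e₁u = 1, and e₂u = 0 because e₂f = 0.
  obtain ⟨J, hJ, hJo, hxJ, U, U0, sU, dU⟩ := exists_primitive_inv (isOpen_pos_radicand c C) hq
    (fun v hv => (mul_pos (mul_pos (by norm_num) hv.1) (Real.sqrt_pos.2 hv.2)).ne')
    ⟨h.f_pos x hx, h.radicand_pos hx⟩
  refine ⟨Ω ∩ f ⁻¹' J, Set.inter_subset_left,
    h.smooth_f.continuousOn.isOpen_inter_preimage h.isOpen hJo, ⟨hx, hxJ⟩, fun y => U (f y),
    sU.comp (h.smooth_f.mono Set.inter_subset_left) fun y hy => hy.2, U0, fun y hy => ?_,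
    fun y hy => ?_⟩
  · refine (HasD.comp_hasDerivAt (dU _ hy.2) (h.hasD_f₁ hy.1)).congr_eq ?_
    have := h.f_pos y hy.1
    have := (h.conn_neg hy.1).ne
    rw [h.sqrt_radicand hy.1, smul_eq_mul]
    field_simp
  · exact (HasD.comp_hasDerivAt (dU _ hy.2) (h.hasD_f₂ hy.1)).congr_eq (by simp)

/-- The inverse function theorem, in the form of a smooth change of coordinates. -/
lemma exists_diffeo {Ψ : E2 → E2} (hΩ : IsOpen Ω) (hΨ : ContDiffOn ℝ ∞ Ψ Ω) (hx : x ∈ Ω)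
    (hs : ∀ y ∈ Ω, Function.Surjective (fderiv ℝ Ψ y)) :
    ∃ φ : OpenPartialHomeomorph E2 E2, x ∈ φ.source ∧ φ.source ⊆ Ω ∧ (∀ y, φ y = Ψ y) ∧
      ContDiffOn ℝ ∞ φ.symm φ.target := by
  have hL : ∀ y ∈ Ω, ∃ L : E2 ≃L[ℝ] E2, HasFDerivAt Ψ (L : E2 →L[ℝ] E2) y := fun y hy => by
    have hi : Function.Injective (fderiv ℝ Ψ y : E2 →ₗ[ℝ] E2) :=
      LinearMap.injective_iff_surjective.2 (hs y hy)
    refine ⟨(LinearEquiv.ofBijective _ ⟨hi, hs y hy⟩).toContinuousLinearEquiv, ?_⟩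
    exact (hΨ.differentiableAt_of_isOpen hΩ hy).hasFDerivAt.congr_fderiv (by ext v; rfl)
  obtain ⟨L, hL'⟩ := hL x hx
  have cx := hΨ.contDiffAt (hΩ.mem_nhds hx)
  obtain ⟨φ, hφ⟩ : ∃ φ : OpenPartialHomeomorph E2 E2,
      φ = (cx.toOpenPartialHomeomorph Ψ hL' (by simp)).restr Ω := ⟨_, rfl⟩
  have hsrc : φ.source = (cx.toOpenPartialHomeomorph Ψ hL' (by simp)).source ∩ Ω := by
    rw [hφ, OpenPartialHomeomorph.restr_source' _ _ hΩ]
  have hco : ∀ y, φ y = Ψ y := fun y => by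
    rw [hφ, OpenPartialHomeomorph.restr_apply, ContDiffAt.toOpenPartialHomeomorph_coe]
  have hsub : φ.source ⊆ Ω := hsrc ▸ Set.inter_subset_right
  refine ⟨φ, ?_, hsub, hco, fun z hz => ContDiffAt.contDiffWithinAt ?_⟩
  · rw [hsrc]
    exact ⟨cx.mem_toOpenPartialHomeomorph_source hL' (by simp), hx⟩
  -- Smoothness of the inverse at every point of the target uses invertibility of the derivative
  -- throughout `Ω`, not only at the centre.
  · have hy := hsub (φ.map_target hz)
    obtain ⟨L', hL''⟩ := hL _ hy
    have e : (φ : E2 → E2) = Ψ := funext hco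
    refine φ.contDiffAt_symm hz (f₀' := L') ?_ ?_
    · rwa [e]
    · rw [e]
      exact hΨ.contDiffAt (hΩ.mem_nhds hy)

/-- The coordinate rectangle with centre `0`. -/
def rect (ε δ : ℝ) : Set E2 := {x | |x 0| < ε ∧ |x 1| < δ}

lemma isOpen_rect (ε δ : ℝ) : IsOpen (rect ε δ) :=
  (isOpen_lt (f := fun x : E2 => |x 0|) (by fun_prop) continuous_const).inter
    (isOpen_lt (f := fun x : E2 => |x 1|) (by fun_prop) continuous_const)

lemma exists_rect_subset {s : Set E2} (hs : s ∈ nhds (0 : E2)) : ∃ ε > 0, rect ε ε ⊆ s := by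
  obtain ⟨r, hr, hb⟩ := Metric.mem_nhds_iff.1 hs
  refine ⟨r / 2, by positivity, fun x hx => hb ?_⟩
  rw [mem_ball_zero_iff, EuclideanSpace.norm_eq, Fin.sum_univ_two, Real.sqrt_lt' hr]
  have h0 := sq_lt_sq' (by linarith [norm_nonneg (x 0), hx.1] : -(r / 2) < ‖x 0‖) hx.1
  have h1 := sq_lt_sq' (by linarith [norm_nonneg (x 1), hx.2] : -(r / 2) < ‖x 1‖) hx.2
  nlinarith

/-- The point with coordinates `u, t`. -/
def pt (u t : ℝ) : E2 := !₂[u, t]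

lemma pt_eq (z : E2) : pt (z 0) (z 1) = z := by
  ext i; fin_cases i <;> rfl

lemma pt_eq_add (u t : ℝ) :
    pt u t = u • EuclideanSpace.single 0 1 + t • EuclideanSpace.single 1 1 := by
  ext i; fin_cases i <;> simp [pt]

lemma hasDerivAt_pt_left (u t : ℝ) :
    HasDerivAt (fun u => pt u t) (EuclideanSpace.single 0 1) u := by
  simp only [pt_eq_add]
  simpa using ((hasDerivAt_id u).smul_const (EuclideanSpace.single 0 1 : E2)).add_const
    (t • EuclideanSpace.single 1 1)

lemma hasDerivAt_pt_right (u t : ℝ) :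
    HasDerivAt (fun t => pt u t) (EuclideanSpace.single 1 1) t := by
  simp only [pt_eq_add]
  simpa using ((hasDerivAt_id t).smul_const (EuclideanSpace.single 1 1 : E2)).const_add
    (u • EuclideanSpace.single 0 1)

/-- A parametrization `G` of part of `Ω` by a rectangle, whose coordinate vector fields are `e₁`
and `k⁻¹ e₂`. -/
structure IsCoord (Ω : Set E2) (e₁ e₂ : E2 → E2) (k : E2 → ℝ) (G : E2 → E2) (ε : ℝ) : Prop where
  pos : 0 < ε
  smooth : ContDiffOn ℝ ∞ G (rect ε ε)
  mem : ∀ z ∈ rect ε ε, G z ∈ Ω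
  fderiv₁ : ∀ z ∈ rect ε ε, fderiv ℝ G z (EuclideanSpace.single 0 1) = e₁ (G z)
  fderiv₂ : ∀ z ∈ rect ε ε, fderiv ℝ G z (EuclideanSpace.single 1 1) = (k (G z))⁻¹ • e₂ (G z)

namespace IsCoord

variable {k : E2 → ℝ} {G : E2 → E2} {ε : ℝ} (h : IsCoord Ω e₁ e₂ k G ε)
include h

variable {W : Type*} [NormedAddCommGroup W] [NormedSpace ℝ W] {q : E2 → W}

lemma hasDerivAt_left {q' : W} {u t : ℝ} (hz : pt u t ∈ rect ε ε)
    (hq : HasD (e₁ (G (pt u t))) q q' (G (pt u t))) :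
    HasDerivAt (fun u => q (G (pt u t))) q' u := by
  obtain ⟨L, hL, rfl⟩ := hq
  have dG := (h.smooth.differentiableAt_of_isOpen (isOpen_rect ε ε) hz).hasFDerivAt
  have := (hL.comp _ dG).comp_hasDerivAt u (hasDerivAt_pt_left u t)
  rw [← h.fderiv₁ _ hz]
  exact this

lemma hasDerivAt_right {u t : ℝ} (hz : pt u t ∈ rect ε ε)
    (hq : HasD (e₂ (G (pt u t))) q 0 (G (pt u t))) :
    HasDerivAt (fun t => q (G (pt u t))) 0 t := by
  obtain ⟨L, hL, hL'⟩ := hq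
  have dG := (h.smooth.differentiableAt_of_isOpen (isOpen_rect ε ε) hz).hasFDerivAt
  have := (hL.comp _ dG).comp_hasDerivAt t (hasDerivAt_pt_right u t)
  rwa [ContinuousLinearMap.comp_apply, h.fderiv₂ _ hz, map_smul, hL', smul_zero] at this

lemma eq_of_hasD (hq : ∀ y ∈ Ω, HasD (e₂ y) q 0 y) {z : E2} (hz : z ∈ rect ε ε) :
    q (G z) = q (G (pt (z 0) 0)) := by
  have mem : ∀ t ∈ Set.Ioo (-ε) ε, pt (z 0) t ∈ rect ε ε := fun t ht => ⟨hz.1, abs_lt.2 ht⟩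
  have d : ∀ t ∈ Set.Ioo (-ε) ε, HasDerivAt (fun t => q (G (pt (z 0) t))) 0 t := fun t ht =>
    h.hasDerivAt_right (mem t ht) (hq _ (h.mem _ (mem t ht)))
  have := isOpen_Ioo.is_const_of_deriv_eq_zero isPreconnected_Ioo
    (fun t ht => (d t ht).differentiableAt.differentiableWithinAt) (fun t ht => (d t ht).deriv)
    (abs_lt.1 hz.2) (show (0 : ℝ) ∈ Set.Ioo (-ε) ε from ⟨by linarith [h.pos], h.pos⟩)
  simpa only [pt_eq] using this

lemma contDiffOn_left (hq : ContDiffOn ℝ ∞ q Ω) :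
    ContDiffOn ℝ ∞ (fun u => q (G (pt u 0))) (Set.Ioo (-ε) ε) := by
  have mem : ∀ u ∈ Set.Ioo (-ε) ε, pt u 0 ∈ rect ε ε := fun u hu =>
    ⟨abs_lt.2 hu, by simpa [pt] using h.pos⟩
  have hp : ContDiff ℝ ∞ fun u => pt u 0 := by
    rw [contDiff_euclidean]
    intro i
    fin_cases i
    · exact contDiff_id
    · exact contDiff_const
  exact hq.comp (h.smooth.comp hp.contDiffOn mem) fun u hu => h.mem _ (mem u hu)

end IsCoord

/-- The coordinates `(u, t)`. -/
lemma IsAdaptedWith.exists_coord (h : IsAdaptedWith Ω F e₁ e₂ f E₃ c C) (hC : C < 0)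
    (hc : IsPreconnected Ω) (hx : x ∈ Ω) :
    ∃ φ : OpenPartialHomeomorph E2 E2, x ∈ φ.source ∧ φ.source ⊆ Ω ∧ φ x = 0 ∧
      ContDiffOn ℝ ∞ φ φ.source ∧ ContDiffOn ℝ ∞ φ.symm φ.target ∧
      ∃ ε, φ.target = rect ε ε ∧ IsCoord Ω e₁ e₂ (rotCurv C f) φ.symm ε ∧
      ∀ z ∈ rect ε ε, dd e₂ F (φ.symm z) = Real.cosh (z 1) • dd e₂ F x +
          Real.sinh (z 1) • rotNormal C F e₁ f E₃ x ∧
        rotNormal C F e₁ f E₃ (φ.symm z) = Real.sinh (z 1) • dd e₂ F x +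
          Real.cosh (z 1) • rotNormal C F e₁ f E₃ x := by
  obtain ⟨t, st, tx, t1, t2, A, T⟩ := h.exists_angle hC hc hx
  obtain ⟨Ω', hs, hΩ', hx', u, su, ux, u1, u2⟩ := h.exists_arclength hx
  -- The map (u, t) sends e₁ and κ̂⁻¹e₂ to the two coordinate vectors, hence is a local
  -- diffeomorphism.
  obtain ⟨Ψ, hΨ⟩ : ∃ Ψ : E2 → E2, Ψ = fun y => pt (u y) (t y) := ⟨_, rfl⟩
  have sΨ : ContDiffOn ℝ ∞ Ψ Ω' := by
    rw [contDiffOn_euclidean]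
    intro i
    fin_cases i
    · exact hΨ ▸ su
    · exact hΨ ▸ st.mono hs
  have dΨ : ∀ y ∈ Ω', ∀ v, fderiv ℝ Ψ y v = pt (fderiv ℝ u y v) (fderiv ℝ t y v) := by
    intro y hy v
    have du := hasD_of_differentiableAt (su.differentiableAt_of_isOpen hΩ' hy) v
    have dt := hasD_of_differentiableAt (st.differentiableAt_of_isOpen h.isOpen (hs hy)) v
    rw [pt_eq_add, hΨ]
    simp only [pt_eq_add]
    exact (((du.smul (HasD.const (EuclideanSpace.single 0 1 : E2))).add
      (dt.smul (HasD.const (EuclideanSpace.single 1 1 : E2)))).congr_eq (by simp)).fderiv_eq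
  have dΨ1 : ∀ y ∈ Ω', fderiv ℝ Ψ y (e₁ y) = EuclideanSpace.single 0 1 := fun y hy => by
    rw [dΨ y hy, (u1 y hy).fderiv_eq, (t1 y (hs hy)).fderiv_eq]
    ext i; fin_cases i <;> simp [pt]
  have dΨ2 : ∀ y ∈ Ω', fderiv ℝ Ψ y ((rotCurv C f y)⁻¹ • e₂ y) = EuclideanSpace.single 1 1 :=
    fun y hy => by
      have := (h.rotCurv_pos hC (hs hy)).ne'
      rw [map_smul, dΨ y hy, (u2 y hy).fderiv_eq, (t2 y (hs hy)).fderiv_eq]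
      ext i; fin_cases i <;> simp [pt, this]
  have surj : ∀ y ∈ Ω', Function.Surjective (fderiv ℝ Ψ y) := fun y hy w => by
    refine ⟨w 0 • e₁ y + w 1 • (rotCurv C f y)⁻¹ • e₂ y, ?_⟩
    rw [map_add, map_smul, map_smul _ (w 1), dΨ1 y hy, dΨ2 y hy]
    ext i; fin_cases i <;> simp
  obtain ⟨φ, hxφ, hφ, hφΨ, sφ⟩ := exists_diffeo hΩ' sΨ hx' surj
  have φx : φ x = 0 := by
    rw [hφΨ, hΨ]
    ext i; fin_cases i <;> simp [pt, ux, tx]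
  obtain ⟨ε, hε, hr⟩ := exists_rect_subset (φ.open_target.mem_nhds (φx ▸ φ.map_source hxφ))
  -- Restricting the inverse, not `φ` itself, makes the image of the chart exactly a rectangle.
  obtain ⟨χ, hχ⟩ : ∃ χ : OpenPartialHomeomorph E2 E2, χ = (φ.symm.restr (rect ε ε)).symm :=
    ⟨_, rfl⟩
  have tχ : χ.target = rect ε ε := by
    rw [hχ, OpenPartialHomeomorph.symm_target,
      OpenPartialHomeomorph.restr_source' _ _ (isOpen_rect ε ε), OpenPartialHomeomorph.symm_source]
    exact Set.inter_eq_right.2 hr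
  have sχ : χ.source ⊆ φ.source := by
    intro y hy
    have h1 := χ.map_source hy
    have h2 : φ.symm (χ y) = y := by
      have := χ.left_inv hy
      rwa [hχ] at this ⊢
    rw [← h2]
    exact φ.map_target (hr (tχ ▸ h1))
  have cχ : ∀ y, χ y = φ y := fun y => by rw [hχ]; rfl
  have cχ' : ∀ y, χ.symm y = φ.symm y := fun y => by rw [hχ]; rfl
  have hxχ : x ∈ χ.source := by
    have h1 : (0 : E2) ∈ χ.target := by rw [tχ]; simp [rect, hε]
    have := χ.map_target h1
    rwa [cχ', ← φx, φ.left_inv hxφ] at this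
  have sχ' : ContDiffOn ℝ ∞ χ.symm (rect ε ε) := (sφ.mono hr).congr fun y _ => cχ' y
  have mem : ∀ z ∈ rect ε ε, χ.symm z ∈ Ω' := fun z hz => hφ (sχ (χ.map_target (tχ ▸ hz)))
  have inv : ∀ z ∈ rect ε ε, Ψ (χ.symm z) = z := fun z hz => by
    rw [← hφΨ, ← cχ]
    exact χ.right_inv (tχ ▸ hz)
  -- The derivatives of Ψ and of the inverse chart compose to the identity; injectivity of dΨ then
  -- identifies the coordinate fields.
  have dd' : ∀ z ∈ rect ε ε, ∀ v, fderiv ℝ Ψ (χ.symm z) (fderiv ℝ χ.symm z v) = v := by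
    intro z hz v
    have d1 := (sχ'.differentiableAt_of_isOpen (isOpen_rect ε ε) hz).hasFDerivAt
    have d2 := (sΨ.differentiableAt_of_isOpen hΩ' (mem z hz)).hasFDerivAt
    have := (d2.comp z d1).unique ((hasFDerivAt_id z).congr_of_eventuallyEq
      (Filter.eventuallyEq_of_mem ((isOpen_rect ε ε).mem_nhds hz) inv))
    exact congrArg (fun L => L v) this
  have inj : ∀ y ∈ Ω', Function.Injective (fderiv ℝ Ψ y) := fun y hy =>
    LinearMap.injective_iff_surjective (f := (fderiv ℝ Ψ y : E2 →ₗ[ℝ] E2)).2 (surj y hy)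
  refine ⟨χ, hxχ, fun y hy => hs (hφ (sχ hy)), by rw [cχ, φx], ?_, by rw [tχ]; exact sχ', ε, tχ,
    ⟨hε, sχ', fun z hz => hs (mem z hz), fun z hz => ?_, fun z hz => ?_⟩, fun z hz => ?_⟩
  · exact (sΨ.mono fun y hy => hφ (sχ hy)).congr fun y _ => by rw [cχ, hφΨ]
  · exact inj _ (mem z hz) (by rw [dd' z hz, dΨ1 _ (mem z hz)])
  · exact inj _ (mem z hz) (by rw [dd' z hz, dΨ2 _ (mem z hz)])
  · have tz : t (χ.symm z) = z 1 := by
      conv_rhs => rw [← inv z hz, hΨ]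
      simp [pt]
    have hz' := hs (mem z hz)
    rw [← tz]
    exact ⟨A _ hz', T _ hz'⟩

end PNMC

end

/-! ### The directrix, the hyperbolas and the main theorem -/

noncomputable section

namespace PNMC

variable {Ω : Set E2} {F E₃ : E2 → R51} {e₁ e₂ G : E2 → E2} {f : E2 → ℝ} {x : E2} {c C ε : ℝ}

/-- The `e₁`-curve orthogonal to `b` is a Frenet curve in `ℍ³ = ℍ⁴ ∩ b^⊥`. -/
lemma IsAdaptedWith.isFrenetCurve (h : IsAdaptedWith Ω F e₁ e₂ f E₃ c C) {k : E2 → ℝ}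
    (hG : IsCoord Ω e₁ e₂ k G ε) (hF : ∀ y ∈ Ω, F y ∈ hyp4) {b : R51}
    (hb : ∀ u ∈ Set.Ioo (-ε) ε, dd e₂ F (G (pt u 0)) = b) :
    IsFrenetCurve b (fun u => F (G (pt u 0)))
      (fun u => f (G (pt u 0)) * √(1 + c ^ 2 * f (G (pt u 0))))
      (fun u => 2 * |c| * √(f (G (pt u 0))) / (3 * (1 + c ^ 2 * f (G (pt u 0)))) *
        √(radicand c C (f (G (pt u 0))))) (Set.Ioo (-ε) ε) := by
  have mem : ∀ u ∈ Set.Ioo (-ε) ε, pt u 0 ∈ rect ε ε := fun u hu =>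
    ⟨abs_lt.2 hu, by simpa [pt] using hG.pos⟩
  refine ⟨hG.contDiffOn_left h.smooth, fun u hu => ?_, ![fun u => dd e₁ F (G (pt u 0)),
    fun u => frenet₁ c F e₁ f E₃ (G (pt u 0)), fun u => frenet₂ c F e₁ f E₃ (G (pt u 0))],
    fun i => ?_, fun u hu => ?_⟩
  · have hy := hG.mem _ (mem u hu)
    refine ⟨hF _ hy, ?_⟩
    rw [← hb u hu, mink_comm]
    exact (h.relations hy).2.1
  · fin_cases i
    · exact hG.contDiffOn_left h.smooth_dd₁
    · exact hG.contDiffOn_left h.smooth_frenet₁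
    · exact hG.contDiffOn_left h.smooth_frenet₂
  · have hm := mem u hu
    have hy := hG.mem _ hm
    have fy := h.f_pos _ hy
    obtain ⟨⟨a0, a1, a2⟩, ⟨b0, b1, b2⟩, f11, f12, f22⟩ := h.frenet_ortho hy
    have dF := (hG.hasDerivAt_left hm (h.hasD_F₁ hy)).deriv
    have d0 := (hG.hasDerivAt_left hm (h.hasD_E₁₁ hy)).deriv
    have d1 := (hG.hasDerivAt_left hm (h.hasD_frenet₁ hy)).deriv
    have d2 := (hG.hasDerivAt_left hm (h.hasD_frenet₂ hy)).deriv
    have r1 := (h.relations hy).1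
    rw [abs_of_pos h.c_pos]
    refine ⟨fun i => ?_, fun i j => ?_, dF.symm,
      mul_pos fy (Real.sqrt_pos.2 (h.one_add_pos hy)), ?_, ?_, ?_⟩
    · rw [← hb u hu]
      fin_cases i
      · exact ⟨r1, h.ortho _ hy⟩
      · exact ⟨a0, a2⟩
      · exact ⟨b0, b2⟩
    · fin_cases i <;> fin_cases j
      · exact h.unit₁ _ hy
      · exact (mink_comm _ _).trans a1
      · exact (mink_comm _ _).trans b1
      · exact a1
      · exact f11
      · exact f12
      · exact b1
      · exact (mink_comm _ _).trans f12
      · exact f22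
    · change deriv (fun u => dd e₁ F (G (pt u 0))) u +
        mink (deriv (fun u => dd e₁ F (G (pt u 0))) u) (F (G (pt u 0))) • F (G (pt u 0)) = _
      rw [d0]
      change _ = _ • frenet₁ c F e₁ f E₃ (G (pt u 0))
      rw [frenet₁, smul_inv_smul₀ (mul_pos fy (Real.sqrt_pos.2 (h.one_add_pos hy))).ne']
      simp only [mink_add_left, mink_sub_left, mink_smul_left, (h.perp_ortho hy).1, h.ortho₀ _ hy,
        h.hyp _ hy]
      module
    · change deriv (fun u => frenet₁ c F e₁ f E₃ (G (pt u 0))) u +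
        mink (deriv (fun u => frenet₁ c F e₁ f E₃ (G (pt u 0))) u) (F (G (pt u 0))) •
          F (G (pt u 0)) = _
      rw [d1]
      simp only [mink_add_left, mink_smul_left, b0, r1, mul_zero, add_zero, zero_smul]
      rfl
    · change deriv (fun u => frenet₂ c F e₁ f E₃ (G (pt u 0))) u +
        mink (deriv (fun u => frenet₂ c F e₁ f E₃ (G (pt u 0))) u) (F (G (pt u 0))) •
          F (G (pt u 0)) = _
      rw [d2]
      simp only [mink_smul_left, a0, mul_zero, add_zero, zero_smul]
      rfl

/-- The surface is swept out by hyperbolas in planes parallel to the plane of `b₁, b₂`. -/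
lemma IsAdaptedWith.immersion_eq (h : IsAdaptedWith Ω F e₁ e₂ f E₃ c C) (hC : C < 0)
    (hG : IsCoord Ω e₁ e₂ (rotCurv C f) G ε) {b₁ b₂ : R51}
    (hb : ∀ z ∈ rect ε ε, rotNormal C F e₁ f E₃ (G z) = Real.sinh (z 1) • b₁ +
      Real.cosh (z 1) • b₂) {z : E2} (hz : z ∈ rect ε ε) :
    F (G z) = F (G (pt (z 0) 0)) + (1 / rotCurv C f (G (pt (z 0) 0))) •
      (Real.sinh (z 1) • b₁ + (Real.cosh (z 1) - 1) • b₂) := by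
  have hz0 : pt (z 0) 0 ∈ rect ε ε := ⟨hz.1, by simpa [pt] using hG.pos⟩
  -- The centre F − κ̂⁻¹T of the hyperbola is constant along e₂: κ̂ is constant there and e₂T = κ̂
  -- e₂F.
  have key := hG.eq_of_hasD (q := fun y => F y - (rotCurv C f y)⁻¹ • rotNormal C F e₁ f E₃ y)
    (fun y hy => by
      have k0 := (h.rotCurv_pos hC hy).ne'
      refine ((h.hasD_F₂ hy).sub (((h.hasD_rotCurv₂ hy).inv k0).smul
        (h.hasD_rotNormal₂ hC hy))).congr_eq ?_
      rw [inv_smul_smul₀ k0]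
      simp) hz
  have kz : rotCurv C f (G z) = rotCurv C f (G (pt (z 0) 0)) :=
    hG.eq_of_hasD (fun y hy => h.hasD_rotCurv₂ hy) hz
  have b0 := hb _ hz0
  simp only [hb z hz, kz, b0] at key
  rw [sub_eq_iff_eq_add] at key
  rw [key]
  have : (pt (z 0) 0) 1 = 0 := rfl
  rw [this, Real.sinh_zero, Real.cosh_zero, one_div]
  module

section Global

variable {M : Type*} [TopologicalSpace M] [ChartedSpace E2 M]

lemma trans_mem_charts {e : OpenPartialHomeomorph M E2} (he : e ∈ charts M)
    {φ : OpenPartialHomeomorph E2 E2} (h₁ : ContDiffOn ℝ ∞ φ φ.source)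
    (h₂ : ContDiffOn ℝ ∞ φ.symm φ.target) : e.trans φ ∈ charts M := by
  have hφ : φ ∈ contDiffGroupoid ∞ (𝓡 2) := by
    rw [contDiffGroupoid, mem_groupoid_of_pregroupoid]
    simpa [contDiffPregroupoid] using ⟨h₁, h₂⟩
  intro e' he'
  obtain ⟨l, r⟩ := he e' he'
  constructor
  · rw [OpenPartialHomeomorph.trans_symm_eq_symm_trans_symm, OpenPartialHomeomorph.trans_assoc]
    exact (contDiffGroupoid ∞ (𝓡 2)).trans ((contDiffGroupoid ∞ (𝓡 2)).symm hφ) l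
  · rw [← OpenPartialHomeomorph.trans_assoc]
    exact (contDiffGroupoid ∞ (𝓡 2)).trans r hφ

end Global

end PNMC

end

theorem mainTheorem3 {M : Type*} [TopologicalSpace M] [ChartedSpace PNMC.E2 M]
    [IsManifold (𝓡 2) ∞ M] [ConnectedSpace M] (Φ : M → PNMC.R51)
    (hΦ : PNMC.IsPNMCBiconservative Φ) :
    ∃ c C : ℝ, c ≠ 0 ∧ PNMC.HasConstants Φ c C ∧
      (∀ c' C' : ℝ, PNMC.HasConstants Φ c' C' → c' ^ 2 = c ^ 2 ∧ C' = C) ∧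
      (C < 0 → ∀ p : M, ∃ e ∈ PNMC.charts M, ∃ ε > 0, ∃ δ > 0,
        ∃ (f k : ℝ → ℝ) (σ : ℝ → PNMC.R51) (b₁ b₂ : PNMC.R51),
        -- a local chart `(u, t)` around `p`
        p ∈ e.source ∧ e p = 0 ∧ e.target = {x | |x 0| < ε ∧ |x 1| < δ} ∧
        (∀ x ∈ e.target, Φ (e.symm x) =
          σ (x 0) + (1 / k (x 0)) • (Real.sinh (x 1) • b₁ + (Real.cosh (x 1) - 1) • b₂)) ∧
        (∀ x ∈ e.target, PNMC.meanCurv (Φ ∘ e.symm) x = f (x 0)) ∧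
        (∀ u ∈ Set.Ioo (-ε) ε, 0 < f u ∧
          HasDerivAt f (4 / 3 * f u * Real.sqrt (PNMC.radicand c C (f u))) u ∧
          0 < 4 / 3 * f u * Real.sqrt (PNMC.radicand c C (f u))) ∧
        (∀ u ∈ Set.Ioo (-ε) ε, k u = 3 * Real.sqrt (-C) * f u ^ (3 / 4 : ℝ)) ∧
        PNMC.mink b₁ b₂ = 0 ∧ PNMC.mink b₁ b₁ = 1 ∧ PNMC.mink b₂ b₂ = -1 ∧
        -- the directrix curve, its curvature and its torsion
        PNMC.IsFrenetCurve b₁ σ (fun u => f u * Real.sqrt (1 + c ^ 2 * f u))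
          (fun u => 2 * |c| * Real.sqrt (f u) / (3 * (1 + c ^ 2 * f u)) *
            Real.sqrt (PNMC.radicand c C (f u))) (Set.Ioo (-ε) ε) ∧
        (∀ u ∈ Set.Ioo (-ε) ε, PNMC.mink (σ u) b₂ = -(1 / k u))) := by
  open PNMC in
  obtain ⟨c, C, c0, hc⟩ := hΦ.exists_hasConstants
  refine ⟨c, C, c0.ne', hc, fun c' C' hc' => hΦ.hasConstants_unique hc hc', fun hC p => ?_⟩
  obtain ⟨e₀, he₀⟩ : ∃ e : OpenPartialHomeomorph M E2, e = chartAt E2 p := ⟨_, rfl⟩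
  have hp : p ∈ e₀.source := he₀ ▸ mem_chart_source E2 p
  have hm : e₀ ∈ charts M := he₀ ▸ IsManifold.chart_mem_maximalAtlas p
  obtain ⟨r, hr, hb⟩ := Metric.isOpen_iff.1 e₀.open_target (e₀ p) (e₀.map_source hp)
  have hl := (hΦ.isLocalSurface hm).mono Metric.isOpen_ball hb
  obtain ⟨e₁, e₂, ha⟩ := hl.exists_isAdapted
  obtain ⟨F, hF⟩ : ∃ F : E2 → R51, F = Φ ∘ e₀.symm := ⟨_, rfl⟩
  obtain ⟨E₃, hE₃⟩ : ∃ E₃ : E2 → R51, E₃ = fun y => (meanCurv F y)⁻¹ • meanCurvVec F y := ⟨_, rfl⟩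
  -- The constants of this adapted frame are the global ones, since they can be read off at each
  -- point.
  have h : IsAdaptedWith (Metric.ball (e₀ p) r) F e₁ e₂ (meanCurv F) E₃ c C := by
    subst hE₃ hF
    refine ⟨ha, c0, fun y hy => ?_, fun y hy => ?_⟩
    · exact (ha.eq_of_hasConstantsAt hy (hasConstants_iff.1 hc _ hm _ (hb hy))).1
    · exact (ha.eq_of_hasConstantsAt hy (hasConstants_iff.1 hc _ hm _ (hb hy))).2
  have hx : e₀ p ∈ Metric.ball (e₀ p) r := Metric.mem_ball_self hr
  obtain ⟨φ, xφ, φs, φx, s₁, s₂, ε, tφ, hG, hAT⟩ :=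
    h.exists_coord hC (convex_ball _ _).isPreconnected hx
  have he : e₀.trans φ ∈ charts M := trans_mem_charts hm s₁ s₂
  have te : (e₀.trans φ).target = rect ε ε := by
    rw [OpenPartialHomeomorph.trans_target, tφ]
    refine Set.inter_eq_left.2 fun z hz => hb (φs (φ.map_target (tφ ▸ hz)))
  have line : ∀ u ∈ Set.Ioo (-ε) ε, pt u 0 ∈ rect ε ε := fun u hu =>
    ⟨abs_lt.2 hu, by simpa [pt] using hG.pos⟩
  obtain ⟨TT, AT, -⟩ := h.rotNormal_ortho hC hx
  -- The directrix is the line t = 0; b₁ and b₂ are the values at p of E₂ and of the normal T of the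
  -- hyperbolas.
  refine ⟨e₀.trans φ, he, ε, hG.pos, ε, hG.pos, fun u => meanCurv F (φ.symm (pt u 0)),
    fun u => rotCurv C (meanCurv F) (φ.symm (pt u 0)), fun u => F (φ.symm (pt u 0)),
    dd e₂ F (e₀ p), rotNormal C F e₁ (meanCurv F) E₃ (e₀ p), ?_, φx, te, fun z hz => ?_,
    fun z hz => ?_, fun u hu => ?_, fun u hu => rfl, AT, h.unit₂ _ hx, TT, ?_, fun u hu => ?_⟩
  · rw [OpenPartialHomeomorph.trans_source]
    exact ⟨hp, xφ⟩
  · rw [te] at hz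
    rw [← h.immersion_eq hC hG (fun z hz => (hAT z hz).2) hz, hF]
    rfl
  · have hq := (e₀.trans φ).map_target hz
    have hq' := hq
    rw [OpenPartialHomeomorph.trans_source] at hq'
    have := hΦ.meanCurv_comp_symm hm he hq'.1 hq
    rw [(e₀.trans φ).right_inv hz, ← hF] at this
    rw [this]
    rw [te] at hz
    have hz' : φ.symm z ∈ e₀.target := hb (hG.mem z hz)
    change meanCurv F (e₀ (e₀.symm (φ.symm z))) = _
    rw [e₀.right_inv hz']
    exact hG.eq_of_hasD (fun y hy => h.hasD_f₂ hy) hz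
  · have hy := hG.mem _ (line u hu)
    have d := hG.hasDerivAt_left (line u hu) (h.hasD_f₁ hy)
    refine ⟨h.f_pos _ hy, d.congr_deriv ?_, mul_pos (mul_pos (by norm_num) (h.f_pos _ hy))
      (Real.sqrt_pos.2 (h.radicand_pos hy))⟩
    rw [h.sqrt_radicand hy]
    ring
  · refine h.isFrenetCurve hG (fun y hy => hF ▸ hΦ.mem_hyp _) fun u hu => ?_
    rw [(hAT _ (line u hu)).1]
    simp [pt]
  -- On the line t = 0 the field T equals b₂, so ⟨F, T⟩ = −1/κ̂ is the required relation.
  · have hy := hG.mem _ (line u hu)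
    have := (h.rotNormal_ortho hC hy).2.2
    rw [(hAT _ (line u hu)).2] at this
    rw [one_div, ← this]
    simp [pt]
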